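/- **Setting.** A signature is a finite set of predicate symbols with arities, containing a special predicate $\bot$ of arity $0$; constants are finite words over $\{0,1\}$, and distinct constants denote distinct objects. A *database* is a finite set of facts $p(c_1,\dots,c_n)$ that does not contain the fact $\bot$. A *conjunction with inequalities* is a nonempty finite conjunction of predicate atoms $p(t_1,\dots,t_n)$ and inequalities $t\neq t'$, the terms being variables or constants. A *dependency* is a sentence $$\forall \vec x\,\Bigl(\gamma \rightarrow \bigvee_{i=1}^m \exists \vec y_i\, \gamma_i\Bigr),\qquad m\ge 1,$$ where $\gamma$ and the $\gamma_i$ are conjunctions with inequalities, $\vec x$ is the sequence of variables of $\gamma$, the $\vec y_i$ are disjoint from $\vec x$, every variable of $\gamma_i$ is in $\vec x$ or $\vec y_i$, every variable of $\gamma$ occurs in a predicate atom of $\gamma$, and every variable in $\vec y_i$ occurs in a predicate atom of $\gamma_i$. The dependency is *linear* if exactly one predicate atom occurs in $\gamma$; it is *full* if exactly one conjunctive query occurs in the head $\bigvee_i\exists\vec y_i\,\gamma_i$ and all variables of the head occur in $\gamma$. A set of dependencies is linear (full) if all its members are. Let $\Sigma$ be a finite set of dependencies. A set of facts is *consistent*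 with $\Sigma$ if it satisfies every dependency of $\Sigma$. A *repair* of $\langle\Sigma,\mathcal D\rangle$ is a maximal subset of $\mathcal D$ consistent with $\Sigma$. A set $\mathcal D'$ is *weakly consistent* with $\langle\Sigma,\mathcal D\rangle$ if $\mathcal D'\subseteq\mathcal D''\subseteq\mathcal D$ for some $\mathcal D''$ consistent with $\Sigma$. *Repair checking* for $\Sigma$ is the problem of deciding, given databases $\mathcal D$ and $\mathcal D'$, whether $\mathcal D'$ is a repair of $\langle\Sigma,\mathcal D\rangle$. Complexity is *data complexity*: $\Sigma$ is fixed, the databases are the input (listed fact by fact), and polynomial time means polynomial in the length of the input on a deterministic multi-tape Turing machine. For full $\Sigma$, $\mathrm{Chase}(\mathcal D',\Sigma)$ is the smallest set of facts that contains $\mathcal D'$ and such that, for every dependency of $\Sigma$ and every instantiation $\sigma$ of its body in the set, it contains $\sigma(\alpha)$ for every predicate atom $\alpha$ of the head, and contains $\bot$ if $\sigma(t)=\sigma(t')$ for some inequality $t\ne t'$ of the head. A *deletion step* on a set of facts $\mathcal E$ picks a dependency of $\Sigma$ and an instantiation $\sigma$ of its body in $\mathcal E$ for which the instantiated head does not hold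 in $\mathcal E$, and removes from $\mathcal E$ the facts $\sigma(\alpha)$ for the predicate atoms $\alpha$ of the body. **Theorem.** Let $\Sigma$ be a finite set of dependencies. 1. If $\Sigma$ is linear or $\Sigma$ is full, then repair checking for $\Sigma$ is in PTIME in data complexity. 2. If $\Sigma$ is full, then for all databases $\mathcal D'\subseteq\mathcal D$, $\mathcal D'$ is weakly consistent with $\langle\Sigma,\mathcal D\rangle$ if and only if $\mathrm{Chase}(\mathcal D',\Sigma)\subseteq\mathcal D$; moreover, deciding, given databases $\mathcal D$ and $\mathcal D'$, whether $\mathcal D'$ is weakly consistent with $\langle\Sigma,\mathcal D\rangle$ is in PTIME in data complexity. 3. If $\Sigma$ is linear, then for every database $\mathcal D$ there is exactly one repair of $\langle\Sigma,\mathcal D\rangle$, and the function that maps $\mathcal D$ to it is computable in time polynomial in the size of $\mathcal D$. Moreover, every sequence of deletion steps starting from $\mathcal D$ has at most $|\mathcal D|$ steps, and if no deletion step is possible on its last set, then this set is the unique repair of $\langle\Sigma,\mathcal D\rangle$. -/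

import Mathlib

namespace CQA

/-! ### Signatures, atoms, facts -/

/-- A (finite) predicate signature. It contains the special predicate `⊥` of arity `0`. -/
structure Signature where
  Pred : Type
  finite_pred : Finite Pred
  arity : Pred → ℕ
  bot : Pred
  arity_bot : arity bot = 0

/-- Constant symbols are the finite words over `{0, 1}`; distinct words are distinct constants. -/
abbrev Const : Type := List Bool

/-- Variable symbols. -/
abbrev Var : Type := ℕ

/-- A term is a variable or a constant. -/
inductive Term : Type where
  | var (x : Var) : Term
  | const (c : Const) : Term

/-- A predicate atom `p(t₁, …, tₙ)`. -/
structure Atom (S : Signature) : Type where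
  pred : S.Pred
  args : Fin (S.arity pred) → Term

/-- A fact, that is, a ground atom `p(c₁, …, cₙ)`. -/
structure Fact (S : Signature) : Type where
  pred : S.Pred
  args : Fin (S.arity pred) → Const

/-- The fact `⊥`. -/
def botFact (S : Signature) : Fact S where
  pred := S.bot
  args := fun i => absurd (lt_of_lt_of_eq i.isLt S.arity_bot) (Nat.not_lt_zero _)

/-- A substitution of the variables with constants. -/
abbrev Subst : Type := Var → Const

/-- The value of a term under a substitution. -/
def Term.eval (s : Subst) : Term → Const
  | .var x => s x
  | .const c => c

/-- The variables of a term. -/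
def Term.vars : Term → Set Var
  | .var x => {x}
  | .const _ => ∅

/-- The variables of a predicate atom. -/
def Atom.vars {S : Signature} (a : Atom S) : Set Var := ⋃ i, (a.args i).vars

/-- The fact obtained by applying a substitution to a predicate atom. -/
def Atom.inst {S : Signature} (s : Subst) (a : Atom S) : Fact S where
  pred := a.pred
  args := fun i => (a.args i).eval s

/-! ### Conjunctions with inequalities and dependencies -/

/-- A conjunction with inequalities `α₁ ∧ … ∧ αₖ ∧ λ₁ ∧ … ∧ λₕ` with `k + h ≥ 1`; the pair
`(t, t')` in `ineqs` stands for the inequality `t ≠ t'`. -/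
structure Conj (S : Signature) : Type where
  atoms : List (Atom S)
  ineqs : List (Term × Term)
  nonempty : 1 ≤ atoms.length + ineqs.length

namespace Conj

variable {S : Signature}

/-- The variables that occur in predicate atoms. -/
def atomVars (g : Conj S) : Set Var := ⋃ a ∈ g.atoms, a.vars

/-- The variables that occur in inequalities. -/
def ineqVars (g : Conj S) : Set Var := ⋃ e ∈ g.ineqs, (e.1.vars ∪ e.2.vars)

/-- All the variables that occur in the conjunction. -/
def vars (g : Conj S) : Set Var := g.atomVars ∪ g.ineqVars

/-- `s` is an instantiation of `g` in the set of facts `D`. -/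
def IsInstantiation (g : Conj S) (s : Subst) (D : Set (Fact S)) : Prop :=
  (∀ a ∈ g.atoms, a.inst s ∈ D) ∧ ∀ e ∈ g.ineqs, e.1.eval s ≠ e.2.eval s

end Conj

/-- A disjunctive embedded dependency with inequalities
`∀ x (body → ⋁ q ∈ head, ∃ y_q, q)`. The universally quantified variables are those of the body.
Bound variables being renamed apart, the existentially quantified variables `y_q` of a disjunct
are those variables of the disjunct that do not occur in the body. The two safety conditions say
that `∃ x (body)` is a safe Boolean conjunctive query, and that the head becomes one (a safe union
of them) once its free variables are replaced with constants. -/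
structure Dependency (S : Signature) : Type where
  body : Conj S
  head : List (Conj S)
  head_nonempty : head ≠ []
  body_safe : body.ineqVars ⊆ body.atomVars
  head_safe : ∀ q ∈ head, q.ineqVars ⊆ q.atomVars ∪ body.vars

namespace Dependency

variable {S : Signature}

/-- The head of the dependency, with its free variables instantiated by `s`, has an image
in `D`. -/
def HeadHolds (t : Dependency S) (s : Subst) (D : Set (Fact S)) : Prop :=
  ∃ q ∈ t.head, ∃ s' : Subst, (∀ x ∈ t.body.vars, s' x = s x) ∧ q.IsInstantiation s' D

/-- The dependency is satisfied in the set of facts `D`. -/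
def Satisfied (t : Dependency S) (D : Set (Fact S)) : Prop :=
  ∀ s : Subst, t.body.IsInstantiation s D → t.HeadHolds s D

/-- Linear: exactly one predicate atom occurs in the body. -/
def IsLinear (t : Dependency S) : Prop := {a | a ∈ t.body.atoms}.ncard = 1

/-- Full (non-disjunctive): exactly one conjunctive query occurs in the head, and all the
variables of the head occur in the body. -/
def IsFull (t : Dependency S) : Prop :=
  {q | q ∈ t.head}.ncard = 1 ∧ ∀ q ∈ t.head, q.vars ⊆ t.body.vars

end Dependency

/-! ### Consistency, repairs, weak consistency -/

section Semantics

variable {S : Signature}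

/-- `D` is consistent with the set of dependencies `T`. -/
def Consistent (T : Set (Dependency S)) (D : Set (Fact S)) : Prop := ∀ t ∈ T, t.Satisfied D

/-- `R` is a repair of `⟨T, D⟩`: a maximal subset of `D` that is consistent with `T`. -/
def IsRepair (T : Set (Dependency S)) (D R : Set (Fact S)) : Prop :=
  Maximal (fun E => E ⊆ D ∧ Consistent T E) R

/-- `D'` is weakly consistent with `⟨T, D⟩`. -/
def WeaklyConsistent (T : Set (Dependency S)) (D D' : Set (Fact S)) : Prop :=
  ∃ E, D' ⊆ E ∧ E ⊆ D ∧ Consistent T E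

/-- The chase of `D` with a set `T` of full dependencies: the smallest set of facts that
contains `D`, contains the instantiated head atoms of every dependency of `T` for every
instantiation of its body in the set, and contains `⊥` whenever such an instantiation makes the
two sides of an inequality of the head equal. -/
inductive Chase (T : Set (Dependency S)) (D : Set (Fact S)) : Fact S → Prop where
  | base (f : Fact S) (hf : f ∈ D) : Chase T D f
  | atom (t : Dependency S) (ht : t ∈ T) (s : Subst)
      (hatoms : ∀ a ∈ t.body.atoms, Chase T D (a.inst s))
      (hineqs : ∀ e ∈ t.body.ineqs, e.1.eval s ≠ e.2.eval s)
      (q : Conj S) (hq : q ∈ t.head) (a : Atom S) (ha : a ∈ q.atoms) : Chase T D (a.inst s)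
  | bot (t : Dependency S) (ht : t ∈ T) (s : Subst)
      (hatoms : ∀ a ∈ t.body.atoms, Chase T D (a.inst s))
      (hineqs : ∀ e ∈ t.body.ineqs, e.1.eval s ≠ e.2.eval s)
      (q : Conj S) (hq : q ∈ t.head) (e : Term × Term) (he : e ∈ q.ineqs)
      (heq : e.1.eval s = e.2.eval s) : Chase T D (botFact S)

/-- One deletion: for a dependency of `T` and an instantiation of its body in `D` for which the
head has no image in `D`, the facts of the instantiated body are removed from `D`. -/
def DeletionStep (T : Set (Dependency S)) (D D' : Set (Fact S)) : Prop :=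
  ∃ t ∈ T, ∃ s : Subst, t.body.IsInstantiation s D ∧ ¬ t.HeadHolds s D ∧
    D' = D \ {f | ∃ a ∈ t.body.atoms, f = a.inst s}

end Semantics

/-! ### Databases as inputs -/

/-- A database, presented as a list of facts (in any order) that does not contain `⊥`. -/
structure Database (S : Signature) : Type where
  list : List (Fact S)
  bot_not_mem : botFact S ∉ list

/-- The finite set of facts that a database consists of. -/
def Database.facts {S : Signature} (D : Database S) : Set (Fact S) := {f | f ∈ D.list}

/-- The input alphabet: one letter for each predicate, two bits, a marker in front of each
argument of a fact, and a separator between two databases. -/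
inductive Letter (S : Signature) : Type where
  | pred (p : S.Pred) : Letter S
  | bit (b : Bool) : Letter S
  | arg : Letter S
  | sep : Letter S

/-- The word that stands for the fact `p(c₁, …, cₙ)`. -/
def encodeFact {S : Signature} (f : Fact S) : List (Letter S) :=
  Letter.pred f.pred ::
    (List.ofFn f.args).flatMap (fun c => Letter.arg :: c.map Letter.bit)

/-- The word that stands for a database. -/
def encodeDatabase {S : Signature} (D : Database S) : List (Letter S) :=
  D.list.flatMap encodeFact

/-- The word that stands for a pair of databases. -/
def encodePair {S : Signature} (I : Database S × Database S) : List (Letter S) :=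
  encodeDatabase I.1 ++ Letter.sep :: encodeDatabase I.2

/-! ### Polynomial time -/

/-- `f` is computed by a deterministic (multi-stack) Turing machine in time polynomial in the
length of the encoded argument. -/
def ComputableInPTIME {A B AL BL : Type} (encA : A → List AL) (encB : B → List BL)
    (f : A → B) : Prop :=
  Nonempty (Turing.TM2ComputableInPolyTime encA encB f)

/-- The decision problem `P`, with instances encoded by `enc`, is in PTIME. -/
def InPTIME {A AL : Type} (enc : A → List AL) (P : A → Prop) : Prop :=
  ∃ f : A → Bool, (∀ a, f a = true ↔ P a) ∧ ComputableInPTIME enc Computability.encodeBool f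

/-- Repair checking for `T` is in PTIME in data complexity: the set of dependencies is fixed, and
the two databases are the input. -/
def RepairCheckingInPTIME {S : Signature} (T : Set (Dependency S)) : Prop :=
  InPTIME encodePair (fun I : Database S × Database S => IsRepair T I.1.facts I.2.facts)

/-- Deciding whether the second of two given databases is weakly consistent with `⟨T, D⟩`, where
`D` is the first one, is in PTIME in data complexity. -/
def WeakConsistencyInPTIME {S : Signature} (T : Set (Dependency S)) : Prop :=
  InPTIME encodePair (fun I : Database S × Database S => WeaklyConsistent T I.1.facts I.2.facts)

end CQA

/-! Heads are monotone in the set of facts, because their inequalities do not depend on it. This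
drives the linear case. There a body is matched by a single fact. If that fact lies in a consistent
set `R ⊆ E`, the head holds in `R` and hence in `E`. So a fact that violates a dependency relative
to `E` belongs to no consistent subset of `E`, and deleting it loses nothing. When no violation is
left, the remaining set is consistent and contains every consistent subset of the database. It is
therefore the unique repair. Each effective deletion or round of deletions removes a fact, so as
many rounds as there are facts suffice (`isRepair_iff_iterate_removeViolations`,
`deletion_sequence`).

For full dependencies the instantiation of the body determines the whole head. A consistent set that
contains `D'` must contain its chase. Conversely, if the chase stays within the database, it is
itself consistent, since a violated inequality would have produced `⊥`, which no database contains
(`weaklyConsistent_iff_chase_subset`). The algorithm uses a truncated chase that only adds facts of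
the database; it becomes stationary after at most as many rounds as there are facts, and weak
consistency amounts to consistency of its result (`weaklyConsistent_iff_consistent_iterate`). Repair
checking reduces to this: a consistent subset is maximal if and only if adding any missing fact
destroys weak consistency (`isRepair_iff`).

The complexity claims need actual machines. Structured programs over finitely many stacks are
compiled to `TM2` machines with the same step count (`stepsTo_of_exec`). The database is kept on one
stack as a list of facts, whose predicate letters carry finitely many marks. A pass over the list
updates the marks, and a mark that walks along the list serves as a loop variable (`runs_forEach`).
A first-order variable is represented by a marked fact together with a fixed argument number, and
equality of constants is tested by copying two arguments onto word stacks. Hence every fixed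
first-order formula over the marks is evaluated in polynomial time (`decides_comp`), the nesting of
loops being bounded by the formula. Violation of a dependency and one-step derivation are such
formulas, so a round of either iteration evaluates one formula at every fact. -/

namespace StackProg

open Turing

/-! ### Structured programs over finitely many stacks -/

section Programs

variable {K : Type} (Γ : K → Type) (σ : Type)

/-- Elementary stack operations. A push is guarded by a condition on the control state. -/
inductive Op : Type where
  | push (k : K) (c : σ → Bool) (g : σ → Γ k) : Op
  | pop (k : K) (f : σ → Option (Γ k) → σ) : Op
  | load (f : σ → σ) : Op

/-- Structured programs; `drain k p` runs `p` as long as the stack `k` is nonempty. -/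
inductive Prog : Type where
  | ops (l : List (Op Γ σ)) : Prog
  | seq (p q : Prog) : Prog
  | ite (b : σ → Bool) (p q : Prog) : Prog
  | loop (b : σ → Bool) (p : Prog) : Prog
  | drain (k : K) (p : Prog) : Prog

/-- States: the control state and the contents of the stacks. -/
structure St : Type where
  v : σ
  stk : ∀ k, List (Γ k)

variable {Γ σ}

/-- The effect of an elementary operation. -/
def Op.app [DecidableEq K] (s : St Γ σ) : Op Γ σ → St Γ σ
  | .push k c g => if c s.v then ⟨s.v, Function.update s.stk k (g s.v :: s.stk k)⟩ else s
  | .pop k f => ⟨f s.v (s.stk k).head?, Function.update s.stk k (s.stk k).tail⟩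
  | .load f => ⟨f s.v, s.stk⟩

/-- `Exec p s s' t`: started in `s`, the program `p` ends in `s'` after `t` steps. -/
inductive Exec [DecidableEq K] : Prog Γ σ → St Γ σ → St Γ σ → ℕ → Prop where
  | ops (l : List (Op Γ σ)) (s : St Γ σ) : Exec (.ops l) s (l.foldl Op.app s) 1
  | seq {p q s s' s'' t t'} : Exec p s s' t → Exec q s' s'' t' → Exec (.seq p q) s s'' (t + t')
  | ite_true {b p q s s' t} : b s.v = true → Exec p s s' t → Exec (.ite b p q) s s' (t + 1)
  | ite_false {b p q s s' t} : b s.v = false → Exec q s s' t → Exec (.ite b p q) s s' (t + 1)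
  | loop_false {b p s} : b s.v = false → Exec (.loop b p) s s 1
  | loop_true {b p s s' s'' t t'} : b s.v = true → Exec p s s' t → Exec (.loop b p) s' s'' t' →
      Exec (.loop b p) s s'' (t + t' + 1)
  | drain_nil {k p s} : s.stk k = [] → Exec (.drain k p) s s 1
  | drain_cons {k p s s' s'' t t'} : s.stk k ≠ [] → Exec p s s' t → Exec (.drain k p) s' s'' t' →
      Exec (.drain k p) s s'' (t + t' + 1)

/-- Started in `s`, the program `p` ends in `s'` after at most `T` steps. -/
def Within [DecidableEq K] (p : Prog Γ σ) (s s' : St Γ σ) (T : ℕ) : Prop :=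
  ∃ t ≤ T, Exec p s s' t

namespace Within

variable [DecidableEq K] {p q : Prog Γ σ} {s s' s'' : St Γ σ} {T T' : ℕ}

theorem mono (h : Within p s s' T) (hT : T ≤ T') : Within p s s' T' := by
  obtain ⟨t, ht, h⟩ := h
  exact ⟨t, ht.trans hT, h⟩

theorem ops (l : List (Op Γ σ)) (h : l.foldl Op.app s = s') : Within (.ops l) s s' 1 := by
  subst h
  exact ⟨1, le_rfl, .ops l s⟩

theorem seq (h : Within p s s' T) (h' : Within q s' s'' T') : Within (.seq p q) s s'' (T + T') := by
  obtain ⟨t, ht, h⟩ := h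
  obtain ⟨t', ht', h'⟩ := h'
  exact ⟨_, Nat.add_le_add ht ht', h.seq h'⟩

theorem ite_true {b : σ → Bool} (hb : b s.v = true) (h : Within p s s' T) :
    Within (.ite b p q) s s' (T + 1) := by
  obtain ⟨t, ht, h⟩ := h
  exact ⟨_, Nat.succ_le_succ ht, h.ite_true hb⟩

theorem ite_false {b : σ → Bool} (hb : b s.v = false) (h : Within q s s' T) :
    Within (.ite b p q) s s' (T + 1) := by
  obtain ⟨t, ht, h⟩ := h
  exact ⟨_, Nat.succ_le_succ ht, h.ite_false hb⟩

/-- The run is described by its whole sequence of states between passes, so no invariant has to be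
guessed when it is applied. -/
theorem loop {b : σ → Bool} (a : ℕ → St Γ σ) (n : ℕ) (hb : ∀ i < n, b (a i).v = true)
    (hn : b (a n).v = false) (h : ∀ i < n, Within p (a i) (a (i + 1)) T) :
    Within (.loop b p) (a 0) (a n) (n * (T + 1) + 1) := by
  induction n generalizing a with
  | zero => exact ⟨1, by simp, .loop_false hn⟩
  | succ n ih =>
    obtain ⟨t, ht, h0⟩ := h 0 (Nat.succ_pos n)
    obtain ⟨t', ht', h1⟩ := ih (fun i => a (i + 1)) (fun i hi => hb _ (Nat.succ_lt_succ hi)) hn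
      (fun i hi => h _ (Nat.succ_lt_succ hi))
    refine ⟨t + t' + 1, ?_, .loop_true (hb 0 (Nat.succ_pos n)) h0 h1⟩
    rw [Nat.succ_mul]
    omega

/-- `C l x` is the state whose stack `k` holds `l` and whose other relevant data are `x`. Since each
pass consumes exactly one letter, the loop is a left fold, and the correctness of list-processing
programs becomes a computation with `List.foldl`. -/
theorem drain {X : Type*} {k : K} (C : List (Γ k) → X → St Γ σ) (g : X → Γ k → X)
    (hC : ∀ l x, (C l x).stk k = l) (h : ∀ a l x, Within p (C (a :: l) x) (C l (g x a)) T)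
    (l : List (Γ k)) (x : X) :
    Within (.drain k p) (C l x) (C [] (l.foldl g x)) (l.length * (T + 1) + 1) := by
  induction l generalizing x with
  | nil => exact ⟨1, by simp, .drain_nil (hC _ _)⟩
  | cons a l ih =>
    obtain ⟨t, ht, h0⟩ := h a l x
    obtain ⟨t', ht', h1⟩ := ih (g x a)
    refine ⟨t + t' + 1, ?_, .drain_cons (by simp [hC]) h0 h1⟩
    rw [List.length_cons, Nat.succ_mul]
    omega

end Within

/-! ### Translation into machines -/

/-- The labels of the machine that a program is translated into. -/
def Lab : Prog Γ σ → Type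
  | .ops _ => Unit
  | .seq p q => Lab p ⊕ Lab q
  | .ite _ p q => Option (Lab p ⊕ Lab q)
  | .loop _ p => Option (Lab p)
  | .drain _ p => Option (Lab p)

theorem finite_lab : ∀ p : Prog Γ σ, Finite (Lab p)
  | .ops _ => inferInstanceAs (Finite Unit)
  | .seq p q =>
    have := finite_lab p
    have := finite_lab q
    inferInstanceAs (Finite (Lab p ⊕ Lab q))
  | .ite _ p q =>
    have := finite_lab p
    have := finite_lab q
    inferInstanceAs (Finite (Option (Lab p ⊕ Lab q)))
  | .loop _ p =>
    have := finite_lab p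
    inferInstanceAs (Finite (Option (Lab p)))
  | .drain _ p =>
    have := finite_lab p
    inferInstanceAs (Finite (Option (Lab p)))

/-- The label at which a program starts. -/
def entry : (p : Prog Γ σ) → Lab p
  | .ops _ => ()
  | .seq p _ => Sum.inl (entry p)
  | .ite _ _ _ => none
  | .loop _ _ => none
  | .drain _ _ => none

/-- The translation of an elementary operation, with a given continuation. -/
def Op.stmt {Λ : Type} (q : TM2.Stmt Γ Λ (σ × Bool)) : Op Γ σ → TM2.Stmt Γ Λ (σ × Bool)
  | .push k c g => .branch (fun v => c v.1) (.push k (fun v => g v.1) q) q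
  | .pop k f => .pop k (fun v x => (f v.1 x, v.2)) q
  | .load f => .load (fun v => (f v.1, v.2)) q

/-- The translation of a program whose labels are embedded by `emb` and which continues at the
label `nxt`. The additional bit of the control state serves to test a stack for emptiness. -/
def code {Λ : Type} : (p : Prog Γ σ) → (Lab p → Λ) → Λ → Lab p → TM2.Stmt Γ Λ (σ × Bool)
  | .ops l, _, nxt, _ => l.foldr (fun o q => o.stmt q) (.goto fun _ => nxt)
  | .seq p q, emb, nxt, l => match l with
    | Sum.inl l => code p (fun l => emb (Sum.inl l)) (emb (Sum.inr (entry q))) l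
    | Sum.inr l => code q (fun l => emb (Sum.inr l)) nxt l
  | .ite b p q, emb, nxt, l => match l with
    | none => .branch (fun v => b v.1) (.goto fun _ => emb (some (Sum.inl (entry p))))
        (.goto fun _ => emb (some (Sum.inr (entry q))))
    | some (Sum.inl l) => code p (fun l => emb (some (Sum.inl l))) nxt l
    | some (Sum.inr l) => code q (fun l => emb (some (Sum.inr l))) nxt l
  | .loop b p, emb, nxt, l => match l with
    | none => .branch (fun v => b v.1) (.goto fun _ => emb (some (entry p))) (.goto fun _ => nxt)
    | some l => code p (fun l => emb (some l)) (emb none) l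
  | .drain k p, emb, nxt, l => match l with
    | none => .peek k (fun v x => (v.1, x.isSome)) (.branch (fun v => v.2)
        (.load (fun v => (v.1, false)) (.goto fun _ => emb (some (entry p))))
        (.load (fun v => (v.1, false)) (.goto fun _ => nxt)))
    | some l => code p (fun l => emb (some l)) (emb none) l

/-- The machine configuration that stands for the state `s` at the label `l`. -/
def cfg {Λ : Type} (l : Λ) (s : St Γ σ) : TM2.Cfg Γ Λ (σ × Bool) := ⟨some l, (s.v, false), s.stk⟩

variable [DecidableEq K]

/-- A block of operations becomes one `TM2` statement, hence one machine step whatever its length.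
This is the cost that `Exec.ops` charges. -/
theorem stepAux_foldr {Λ : Type} (nxt : Λ) (l : List (Op Γ σ)) (s : St Γ σ) :
    TM2.stepAux (l.foldr (fun o q => o.stmt q) (.goto fun _ => nxt)) (s.v, false) s.stk =
      cfg nxt (l.foldl Op.app s) := by
  induction l generalizing s with
  | nil => rfl
  | cons o l ih =>
    rw [List.foldl_cons, ← ih]
    cases o with
    | push k c g => by_cases h : c s.v <;> simp [Op.stmt, Op.app, h]
    | pop k f => rfl
    | load f => rfl

/-- The configuration `c'` is reached from `c` in exactly `n` steps. -/
def StepsTo {Λ : Type} (M : Λ → TM2.Stmt Γ Λ (σ × Bool)) (n : ℕ) (c c' : TM2.Cfg Γ Λ (σ × Bool)) :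
    Prop :=
  (flip bind (TM2.step M))^[n] (some c) = some c'

theorem StepsTo.trans {Λ : Type} {M : Λ → TM2.Stmt Γ Λ (σ × Bool)} {n m : ℕ}
    {c c' c'' : TM2.Cfg Γ Λ (σ × Bool)} (h : StepsTo M n c c') (h' : StepsTo M m c' c'') :
    StepsTo M (n + m) c c'' := by
  unfold StepsTo at *
  rw [Nat.add_comm, Function.iterate_add_apply, h, h']

theorem StepsTo.one {Λ : Type} {M : Λ → TM2.Stmt Γ Λ (σ × Bool)} {l : Λ} {s : St Γ σ}
    {c : TM2.Cfg Γ Λ (σ × Bool)} (h : TM2.stepAux (M l) (s.v, false) s.stk = c) :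
    StepsTo M 1 (cfg l s) c :=
  congrArg some h

/-- The machine is arbitrary and only has to contain the code of `p` at the labels given by `emb`,
with exit `nxt`. This generality lets the induction descend to subprograms and return to the head of
a loop. -/
theorem stepsTo_of_exec {p : Prog Γ σ} {s s' : St Γ σ} {t : ℕ} (h : Exec p s s' t) :
    ∀ {Λ : Type} (M : Λ → TM2.Stmt Γ Λ (σ × Bool)) (emb : Lab p → Λ) (nxt : Λ),
      (∀ l, M (emb l) = code p emb nxt l) → StepsTo M t (cfg (emb (entry p)) s) (cfg nxt s') := by
  induction h with
  | ops l s =>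
    intro Λ M emb nxt hM
    apply StepsTo.one
    rw [hM]
    exact stepAux_foldr nxt l s
  | seq _ _ ih ih' =>
    intro Λ M emb nxt hM
    exact (ih M (fun l => emb (Sum.inl l)) _ fun l => hM (Sum.inl l)).trans
      (ih' M (fun l => emb (Sum.inr l)) _ fun l => hM (Sum.inr l))
  | ite_true hb _ ih =>
    intro Λ M emb nxt hM
    rw [Nat.add_comm]
    refine StepsTo.trans (StepsTo.one ?_)
      (ih M (fun l => emb (some (Sum.inl l))) nxt fun l => hM (some (Sum.inl l)))
    rw [hM]
    simp [entry, code, hb, cfg]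
  | ite_false hb _ ih =>
    intro Λ M emb nxt hM
    rw [Nat.add_comm]
    refine StepsTo.trans (StepsTo.one ?_)
      (ih M (fun l => emb (some (Sum.inr l))) nxt fun l => hM (some (Sum.inr l)))
    rw [hM]
    simp [entry, code, hb, cfg]
  | loop_false hb =>
    intro Λ M emb nxt hM
    apply StepsTo.one
    rw [hM]
    simp [entry, code, hb, cfg]
  | loop_true hb _ _ ih ih' =>
    intro Λ M emb nxt hM
    rw [Nat.add_comm]
    refine StepsTo.trans (StepsTo.one ?_)
      ((ih M (fun l => emb (some l)) _ fun l => hM (some l)).trans (ih' M emb nxt hM))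
    rw [hM]
    simp [entry, code, hb, cfg]
  | drain_nil hk =>
    intro Λ M emb nxt hM
    apply StepsTo.one
    rw [hM]
    simp [entry, code, hk, cfg]
  | @drain_cons k p s _ _ _ _ hk _ _ ih ih' =>
    intro Λ M emb nxt hM
    rw [Nat.add_comm]
    refine StepsTo.trans (StepsTo.one ?_)
      ((ih M (fun l => emb (some l)) _ fun l => hM (some l)).trans (ih' M emb nxt hM))
    have : (s.stk k).head?.isSome = true := by
      cases h : s.stk k with
      | nil => exact absurd h hk
      | cons => rfl
    rw [hM]
    simp [entry, code, this, cfg]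

/-- The state in which the only nonempty stack is `k`. -/
def single (v : σ) (k : K) (l : List (Γ k)) : St Γ σ := ⟨v, Function.update (fun _ => []) k l⟩

/-- The machine that runs a program and then resets the control state. -/
noncomputable def machine [Fintype K] [Finite σ] (p : Prog Γ σ) (v : σ) (k₀ k₁ : K)
    [Finite (Γ k₀)] : FinTM2 where
  K := K
  k₀ := k₀
  k₁ := k₁
  Γ := Γ
  Λ := Option (Lab p)
  main := some (entry p)
  ΛFin := have := finite_lab p; Fintype.ofFinite _
  σ := σ × Bool
  initialState := (v, false)
  σFin := Fintype.ofFinite _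
  Γk₀Fin := Fintype.ofFinite _
  m := fun l => match l with
    | none => .load (fun _ => (v, false)) .halt
    | some l => code p some none l

theorem dite_eq_update (k₀ : K) (l : List (Γ k₀)) :
    (fun k => @dite (List (Γ k)) (k = k₀) _ (fun h => by rw [h]; exact l) fun _ => []) =
      Function.update (fun _ => []) k₀ l := by
  funext k
  by_cases hk : k = k₀
  · subst hk
    simp
  · simp [hk]

/-- The additional step is spent at the label `none`: the halting configuration is required to have
the initial control state, which must be restored first. -/
theorem machine_outputs [Fintype K] [Finite σ] {k₀ k₁ : K} [Finite (Γ k₀)] {p : Prog Γ σ}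
    {v v' : σ} {l : List (Γ k₀)} {l' : List (Γ k₁)} {T : ℕ}
    (h : Within p (single v k₀ l) (single v' k₁ l') T) :
    ∃ n, (flip bind (machine p v k₀ k₁).step)^[n] (some (initList (machine p v k₀ k₁) l)) =
        some (haltList (machine p v k₀ k₁) l') ∧ n ≤ T + 1 := by
  obtain ⟨t, ht, he⟩ := h
  have h0 : initList (machine p v k₀ k₁) l = cfg (some (entry p)) (single v k₀ l) :=
    congrArg (TM2.Cfg.mk _ _) (dite_eq_update k₀ l)
  have h1 : haltList (machine p v k₀ k₁) l' = TM2.Cfg.mk none (v, false) (single v' k₁ l').stk :=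
    congrArg (TM2.Cfg.mk _ _) (dite_eq_update k₁ l')
  refine ⟨t + 1, ?_, Nat.succ_le_succ ht⟩
  rw [h0, h1]
  exact (stepsTo_of_exec he (machine p v k₀ k₁).m some none fun _ => rfl).trans (StepsTo.one rfl)

theorem computableInPTIME_of_within [Fintype K] [Finite σ] {A B : Type} {k₀ k₁ : K}
    [Finite (Γ k₀)] {encA : A → List (Γ k₀)} {encB : B → List (Γ k₁)} {f : A → B}
    (p : Prog Γ σ) (v : σ) (P : Polynomial ℕ)
    (h : ∀ a, ∃ v', Within p (single v k₀ (encA a)) (single v' k₁ (encB (f a)))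
      (P.eval (encA a).length)) :
    CQA.ComputableInPTIME encA encB f := by
  -- The words are variables here because the definition of computability passes them through the
  -- alphabet equivalences, which are identities but not syntactically so.
  have key : ∀ a, ∀ l l', l = encA a → l' = encB (f a) → ∃ n,
      (flip bind (machine p v k₀ k₁).step)^[n] (some (initList (machine p v k₀ k₁) l)) =
        some (haltList (machine p v k₀ k₁) l') ∧ n ≤ (P + 1).eval (encA a).length := by
    rintro a _ _ rfl rfl
    obtain ⟨v', h⟩ := h a
    simpa using machine_outputs h
  refine ⟨⟨⟨machine p v k₀ k₁, Equiv.refl (Γ k₀), Equiv.refl (Γ k₁)⟩, P + 1, fun a => ?_⟩⟩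
  have h' := key a _ _ (List.map_id _) (List.map_id _)
  exact ⟨⟨h'.choose, h'.choose_spec.1⟩, h'.choose_spec.2⟩

end Programs

end StackProg

/-! ### Databases as lists of marked facts, and programs that work on them -/

namespace FactTape

open CQA StackProg

/-! ### Lists of marked facts on a stack -/

/-- The marks of facts that formulas may refer to. -/
inductive Base : Type where
  | db | sub | cur | set | pick
deriving DecidableEq

instance : Fintype Base := ⟨{.db, .sub, .cur, .set, .pick}, fun b => by cases b <;> decide⟩

/-- The marks that a fact of the list may carry. -/
inductive Mark (V : ℕ) : Type where
  | base (b : Base) : Mark V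
  | new : Mark V
  | round : Mark V
  | rel : Mark V
  | var (x : Fin (V + 1)) : Mark V
deriving DecidableEq, Fintype

/-- The letters of a list of marked facts. The marks of a fact are attached to its predicate. -/
inductive MLetter (S : Signature) (V : ℕ) : Type where
  | pred (p : S.Pred) (m : Mark V → Bool) : MLetter S V
  | bit (b : Bool) : MLetter S V
  | arg : MLetter S V

/-- The stacks: input, output, the list of facts, an auxiliary list, and two words. -/
inductive Stack : Type where
  | inp | out | main | tmp
  | reg (s : Bool) : Stack
deriving DecidableEq, Fintype

instance (S : Signature) : Finite S.Pred := S.finite_pred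

instance (S : Signature) : Finite (Letter S) := by
  refine Finite.of_injective (β := Option (S.Pred ⊕ Bool ⊕ Unit)) (fun l => match l with
    | .pred p => some (.inl p)
    | .bit b => some (.inr (.inl b))
    | .arg => some (.inr (.inr ()))
    | .sep => none) ?_
  rintro (_ | _ | _ | _) (_ | _ | _ | _) h <;> simp_all

instance (S : Signature) (V : ℕ) : Finite (MLetter S V) := by
  refine Finite.of_injective (β := Option (S.Pred × (Mark V → Bool) ⊕ Bool)) (fun l => match l with
    | .pred p m => some (.inl (p, m))
    | .bit b => some (.inr b)
    | .arg => none) ?_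
  rintro (_ | _ | _) (_ | _ | _) h <;> simp_all

variable {S : Signature} {V C : ℕ} {Out : Type}

/-- The alphabets of the stacks. -/
abbrev Gam (S : Signature) (V : ℕ) (Out : Type) : Stack → Type
  | .inp => Letter S
  | .out => Out
  | .main => MLetter S V
  | .tmp => MLetter S V
  | .reg _ => Bool

/-- The control states. -/
@[ext] structure Ctl (S : Signature) (V C : ℕ) : Type where
  flag : Bool := false
  go : Bool := false
  sel : Bool := false
  cnt : Fin (C + 1) := 0
  buf : Option (MLetter S V) := none
  ibuf : Option (Letter S) := none
  xa : Option Bool := none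
  xb : Option Bool := none

instance : Finite (Ctl S V C) := by
  refine Finite.of_injective
    (fun v => (v.flag, v.go, v.sel, v.cnt, v.buf, v.ibuf, v.xa, v.xb)) ?_
  intro v w h
  simp only [Prod.mk.injEq] at h
  obtain ⟨h1, h2, h3, h4, h5, h6, h7, h8⟩ := h
  exact Ctl.ext h1 h2 h3 h4 h5 h6 h7 h8

/-- Programs of the machine. -/
abbrev Prg (S : Signature) (V C : ℕ) (Out : Type) : Type := Prog (Gam S V Out) (Ctl S V C)

/-- The contents of all the stacks. -/
def tapes (i : List (Letter S)) (o : List Out) (m t : List (MLetter S V))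
    (R : Bool → List Bool) : ∀ k, List (Gam S V Out k)
  | .inp => i
  | .out => o
  | .main => m
  | .tmp => t
  | .reg s => R s

section Stacks

variable (i i' : List (Letter S)) (o o' : List Out) (m m' t t' : List (MLetter S V))
  (R : Bool → List Bool)

@[simp] theorem tapes_inp : tapes i o m t R .inp = i := rfl
@[simp] theorem tapes_out : tapes i o m t R .out = o := rfl
@[simp] theorem tapes_main : tapes i o m t R .main = m := rfl
@[simp] theorem tapes_tmp : tapes i o m t R .tmp = t := rfl
@[simp] theorem tapes_reg (s : Bool) : tapes i o m t R (.reg s) = R s := rfl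

@[simp] theorem update_inp :
    Function.update (tapes i o m t R) .inp i' = tapes i' o m t R := by
  funext k; cases k <;> rfl

@[simp] theorem update_out :
    Function.update (tapes i o m t R) .out o' = tapes i o' m t R := by
  funext k; cases k <;> rfl

@[simp] theorem update_main :
    Function.update (tapes i o m t R) .main m' = tapes i o m' t R := by
  funext k; cases k <;> rfl

@[simp] theorem update_tmp :
    Function.update (tapes i o m t R) .tmp t' = tapes i o m t' R := by
  funext k; cases k <;> rfl

@[simp] theorem update_reg (s : Bool) (x : List Bool) :
    Function.update (tapes i o m t R) (.reg s) x =
      tapes i o m t (Function.update R s x) := by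
  funext k
  cases k with
  | reg s' =>
    by_cases h : s' = s
    · subst h
      simp
    · rw [Function.update_of_ne (by simpa using h)]
      simp [Function.update_of_ne h]
  | _ => rfl

end Stacks

/-- States with empty input and output stacks. -/
def work (v : Ctl S V C) (m t : List (MLetter S V)) (R : Bool → List Bool) :
    St (Gam S V Out) (Ctl S V C) :=
  ⟨v, tapes [] [] m t R⟩

/-- The letters of a marked fact. -/
def markedFact (f : Fact S) (m : Mark V → Bool) : List (MLetter S V) :=
  .pred f.pred m :: (List.ofFn f.args).flatMap fun c => .arg :: c.map .bit

/-- The letters of a list of facts, the `i`-th of which carries the marks `μ i`. -/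
def enc : List (Fact S) → (ℕ → Mark V → Bool) → List (MLetter S V)
  | [], _ => []
  | f :: fs, μ => markedFact f (μ 0) ++ enc fs fun i => μ (i + 1)

/-- The length of the word that stands for a list of facts. -/
def size (fs : List (Fact S)) : ℕ := (fs.flatMap encodeFact).length

theorem length_markedFact (f : Fact S) (m : Mark V → Bool) :
    (markedFact f m).length = (encodeFact f).length := by
  simp [markedFact, encodeFact, List.length_flatMap]

@[simp] theorem length_enc (fs : List (Fact S)) (μ : ℕ → Mark V → Bool) :
    (enc fs μ).length = size fs := by
  induction fs generalizing μ with
  | nil => rfl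
  | cons f fs ih => simp [enc, ih, size, length_markedFact]

theorem length_le_size (fs : List (Fact S)) : fs.length ≤ size fs := by
  induction fs with
  | nil => simp
  | cons f fs ih =>
    have : size (f :: fs) = (encodeFact f).length + size fs := by simp [size]
    rw [this]
    simp [encodeFact]
    omega

theorem enc_congr (fs : List (Fact S)) {μ μ' : ℕ → Mark V → Bool}
    (h : ∀ i < fs.length, μ i = μ' i) : enc fs μ = enc fs μ' := by
  induction fs generalizing μ μ' with
  | nil => rfl
  | cons f fs ih =>
    rw [enc, enc, h 0 (by simp), ih fun i hi => h (i + 1) (by simpa using hi)]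

theorem enc_append (fs gs : List (Fact S)) (μ : ℕ → Mark V → Bool) :
    enc (fs ++ gs) μ = enc fs μ ++ enc gs fun i => μ (i + fs.length) := by
  induction fs generalizing μ with
  | nil => rfl
  | cons f fs ih => simp [enc, ih, Nat.add_assoc]

/-- Abstract states: the marks of the facts, and a flag. -/
abbrev AState (V : ℕ) : Type := (ℕ → Mark V → Bool) × Bool

/-- The machine state that stands for an abstract state. -/
def conc (fs : List (Fact S)) (a : AState V) : St (Gam S V Out) (Ctl S V C) :=
  work { flag := a.2 } (enc fs a.1) [] fun _ => []

/-- On the list `fs`, the program leads from the abstract state `a` to `a'` within `T` steps. -/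
def Runs (p : Prg S V C Out) (fs : List (Fact S)) (a a' : AState V) (T : ℕ) : Prop :=
  Within p (conc fs a) (conc fs a') T

/-! ### Sweeps -/

/-- Moves the auxiliary list back. -/
def restore : Prg S V C Out :=
  .drain .tmp (.ops [.pop .tmp fun v o => { v with buf := o },
    .push .main (fun _ => true) fun v => v.buf.getD .arg, .load fun v => { v with buf := none }])

theorem within_restore (v : Ctl S V C) (hv : v.buf = none) (l m : List (MLetter S V))
    (R : Bool → List Bool) :
    Within restore (work (Out := Out) v m l R) (work v (l.reverse ++ m) [] R)
      (l.length * 2 + 1) := by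
  have h := Within.drain (p := .ops [.pop .tmp fun v o => { v with buf := o },
      .push .main (fun _ => true) fun v => v.buf.getD .arg, .load fun v => { v with buf := none }])
    (k := Stack.tmp) (T := 1) (fun l m => work (Out := Out) v m l R) (fun m a => a :: m)
    (fun _ _ => rfl) (fun a l m => Within.ops _ ?_) l m
  · have : l.foldl (fun m a => a :: m) m = l.reverse ++ m := by
      rw [List.foldl_flip_cons_eq_append, List.map_id']
    rw [this] at h
    exact h
  · obtain ⟨_, _, _, _, _, _, _, _⟩ := v
    simp only at hv
    subst hv
    simp [Op.app, work]

/-- The type of the maps that define a sweep: from two bits, a predicate and the marks of a fact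
to two bits and new marks. -/
abbrev Trans (S : Signature) (V : ℕ) : Type :=
  Bool → Bool → S.Pred → (Mark V → Bool) → Bool × Bool × (Mark V → Bool)

/-- The control state after reading a letter. -/
def Trans.ctl (δ : Trans S V) (v : Ctl S V C) : Option (MLetter S V) → Ctl S V C
  | some (.pred p m) =>
    { v with
      flag := (δ v.flag v.go p m).1
      go := (δ v.flag v.go p m).2.1
      buf := some (.pred p (δ v.flag v.go p m).2.2) }
  | o => { v with buf := o }

/-- The first half of a sweep. -/
def sweepFst (δ : Trans S V) : Prg S V C Out :=
  .drain .main (.ops [.pop .main δ.ctl, .push .tmp (fun _ => true) fun v => v.buf.getD .arg,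
    .load fun v => { v with buf := none }])

/-- Rewrites the marks of all the facts, from left to right. -/
def sweep (δ : Trans S V) : Prg S V C Out := .seq (sweepFst δ) restore

/-- The effect of a letter on the two bits and the auxiliary list. -/
def Trans.letter (δ : Trans S V) (x : Bool × Bool × List (MLetter S V)) :
    MLetter S V → Bool × Bool × List (MLetter S V)
  | .pred p m => ((δ x.1 x.2.1 p m).1, (δ x.1 x.2.1 p m).2.1,
      .pred p (δ x.1 x.2.1 p m).2.2 :: x.2.2)
  | a => (x.1, x.2.1, a :: x.2.2)

/-- Moving the list to the auxiliary stack reverses it and `restore` reverses it back, hence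
`l'.reverse` in the hypothesis. The bits `flag` and `go` are all that is carried along the pass. -/
theorem within_sweep (δ : Trans S V) (l l' : List (MLetter S V)) (b g b' g' : Bool)
    (R : Bool → List Bool) (h : l.foldl δ.letter (b, g, []) = (b', g', l'.reverse))
    (hl : l'.length = l.length) :
    Within (sweep δ) (work (Out := Out) (C := C) { flag := b, go := g } l [] R)
      (work { flag := b', go := g' } l' [] R) (l.length * 4 + 2) := by
  have h1 := Within.drain (p := .ops [.pop .main δ.ctl,
      .push .tmp (fun _ => true) fun v => v.buf.getD .arg, .load fun v => { v with buf := none }])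
    (k := Stack.main) (T := 1)
    (fun l x => work (Out := Out) (C := C) { flag := x.1, go := x.2.1 } l x.2.2 R) δ.letter
    (fun _ _ => rfl) (fun a l m => Within.ops _ ?_) l (b, g, [])
  · rw [h] at h1
    have h2 := within_restore (C := C) (Out := Out) { flag := b', go := g' } rfl l'.reverse [] R
    refine (h1.seq ?_).mono ?_ (T := l.length * 2 + 1 + (l.length * 2 + 1))
    · simpa [hl] using h2
    · omega
  · cases a <;> simp [Op.app, work, Trans.ctl, Trans.letter]

theorem foldl_letter_args (δ : Trans S V) (x : Bool × Bool × List (MLetter S V))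
    (l : List Const) :
    (l.flatMap fun c => MLetter.arg :: c.map MLetter.bit).foldl δ.letter x =
      (x.1, x.2.1, (l.flatMap fun c => MLetter.arg :: c.map MLetter.bit).reverse ++ x.2.2) := by
  have hbits : ∀ (c : Const) (x : Bool × Bool × List (MLetter S V)),
      (c.map MLetter.bit).foldl δ.letter x =
        (x.1, x.2.1, (c.map MLetter.bit).reverse ++ x.2.2) := by
    intro c
    induction c with
    | nil => intro x; rfl
    | cons b c ih => intro x; simp [ih, Trans.letter]
  induction l generalizing x with
  | nil => rfl
  | cons c l ih => simp [ih, hbits, Trans.letter]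

theorem foldl_letter_fact (δ : Trans S V) (b g : Bool) (t : List (MLetter S V)) (f : Fact S)
    (m : Mark V → Bool) :
    (markedFact f m).foldl δ.letter (b, g, t) =
      ((δ b g f.pred m).1, (δ b g f.pred m).2.1,
        (markedFact f (δ b g f.pred m).2.2).reverse ++ t) := by
  simp [markedFact, foldl_letter_args, Trans.letter]

/-- Changes the marks of every fact in the same way, depending on the flag. -/
def mapMarks (h : Bool → (Mark V → Bool) → (Mark V → Bool)) : Prg S V C Out :=
  sweep fun b g _ m => (b, g, h b m)

theorem runs_mapMarks (h : Bool → (Mark V → Bool) → (Mark V → Bool)) (fs : List (Fact S))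
    (a : AState V) :
    Runs (mapMarks (C := C) (Out := Out) h) fs a (fun i => h a.2 (a.1 i), a.2)
      (size fs * 4 + 2) := by
  have key : ∀ (fs : List (Fact S)) (μ : ℕ → Mark V → Bool) (b g : Bool) t,
      (enc fs μ).foldl (Trans.letter fun b g _ m => (b, g, h b m)) (b, g, t) =
        (b, g, (enc fs fun i => h b (μ i)).reverse ++ t) := by
    intro fs
    induction fs with
    | nil => intros; rfl
    | cons f fs ih => intros; simp [enc, foldl_letter_fact, ih]
  have := within_sweep (C := C) (Out := Out) (fun b g _ m => (b, g, h b m)) (enc fs a.1) _ a.2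
    false _ _ (fun _ => []) ((key fs a.1 a.2 false []).trans (by rw [List.append_nil])) (by simp)
  rw [length_enc] at this
  exact this

/-- Adds to the flag whether some fact with the mark `k` has the property `h`. -/
def test (k : Mark V) (h : S.Pred → (Mark V → Bool) → Bool) : Prg S V C Out :=
  sweep fun b g p m => (b || (m k && h p m), g, m)

open Classical in
theorem runs_test (k : Mark V) (h : S.Pred → (Mark V → Bool) → Bool) (fs : List (Fact S))
    (a : AState V) :
    Runs (test (C := C) (Out := Out) k h) fs a
      (a.1, a.2 || decide (∃ i f, fs[i]? = some f ∧ a.1 i k = true ∧ h f.pred (a.1 i) = true))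
      (size fs * 4 + 2) := by
  have key : ∀ (fs : List (Fact S)) (μ : ℕ → Mark V → Bool) (b g : Bool) t,
      (enc fs μ).foldl (Trans.letter fun b g p m => (b || (m k && h p m), g, m)) (b, g, t) =
        (b || decide (∃ i f, fs[i]? = some f ∧ μ i k = true ∧ h f.pred (μ i) = true), g,
          (enc fs μ).reverse ++ t) := by
    intro fs
    induction fs with
    | nil => intros; simp [enc]
    | cons f fs ih =>
      intro μ b g t
      simp only [enc, List.foldl_append, foldl_letter_fact, ih, List.reverse_append,
        List.append_assoc, Prod.mk.injEq, and_true]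
      rw [Bool.or_assoc]
      congr 1
      rw [Bool.eq_iff_iff]
      simp only [Bool.or_eq_true, Bool.and_eq_true, decide_eq_true_eq]
      constructor
      · rintro (h1 | ⟨i, f', h1⟩)
        · exact ⟨0, f, rfl, h1⟩
        · exact ⟨i + 1, f', by simpa using h1⟩
      · rintro ⟨_ | i, f', h1, h2⟩
        · simp only [List.getElem?_cons_zero, Option.some.injEq] at h1
          subst h1
          exact Or.inl h2
        · exact Or.inr ⟨i, f', by simpa using h1, h2⟩
  have := within_sweep (C := C) (Out := Out) (fun b g p m => (b || (m k && h p m), g, m))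
    (enc fs a.1) _ a.2 false _ _ (fun _ => [])
    ((key fs a.1 a.2 false []).trans (by rw [List.append_nil])) (by simp)
  rw [length_enc] at this
  exact this

/-! ### Loops over the facts -/

/-- The marking in which the mark `k` is put on the `i`-th fact only. -/
def put (k : Mark V) (i : ℕ) (μ : ℕ → Mark V → Bool) : ℕ → Mark V → Bool :=
  fun j => Function.update (μ j) k (decide (j = i))

/-- Shifts the mark `k` by one position; the bit `go` is moved in and out. -/
def shift (k : Mark V) : Prg S V C Out :=
  .seq (sweep fun b g _ m => (b, m k, Function.update m k g))
    (.ops [.load fun v => { v with go := !v.go }])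

/-- `go` acts as a carry: each fact receives the mark of its predecessor, the first one receives the
incoming bit, and the mark of the last one is left in `go`. -/
theorem foldl_letter_shift (k : Mark V) (fs : List (Fact S)) (μ : ℕ → Mark V → Bool) (b g : Bool)
    (t : List (MLetter S V)) :
    (enc fs μ).foldl (Trans.letter fun b g _ m => (b, m k, Function.update m k g)) (b, g, t) =
      (b, (if fs = [] then g else μ (fs.length - 1) k),
        (enc fs fun j => Function.update (μ j) k
          (match j with | 0 => g | j + 1 => μ j k)).reverse ++ t) := by
  induction fs generalizing μ g t with
  | nil => rfl
  | cons f fs ih =>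
    simp only [enc, List.foldl_append, foldl_letter_fact, ih, List.reverse_append,
      List.append_assoc, Prod.mk.injEq, true_and]
    refine ⟨?_, ?_⟩
    · cases fs <;> simp
    · congr 3
      funext j
      cases j <;> rfl

/-- As `conc`, with the given bit `go`. -/
def concGo (fs : List (Fact S)) (g : Bool) (a : AState V) : St (Gam S V Out) (Ctl S V C) :=
  work { flag := a.2, go := g } (enc fs a.1) [] fun _ => []

/-- An incoming `true` puts the mark on the first fact. It comes out again only if the list is
empty, so the negated bit tells whether there is a fact to process. -/
theorem within_shift_start (k : Mark V) (fs : List (Fact S)) (a : AState V)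
    (hk : ∀ i, a.1 i k = false) :
    Within (shift k) (concGo (C := C) (Out := Out) fs true a)
      (concGo fs (decide (0 < fs.length)) (put k 0 a.1, a.2)) (size fs * 4 + 3) := by
  have := within_sweep (C := C) (Out := Out) (fun b g _ m => (b, m k, Function.update m k g))
    (enc fs a.1) _ a.2 true _ _ (fun _ => [])
    ((foldl_letter_shift k fs a.1 a.2 true []).trans (by rw [List.append_nil])) (by simp)
  rw [length_enc] at this
  refine this.seq (Within.ops _ ?_)
  simp only [List.foldl_cons, Op.app, work, List.foldl_nil, concGo, St.mk.injEq, Ctl.mk.injEq,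
    true_and, and_true]
  have e : (fun j => Function.update (a.1 j) k (match j with | 0 => true | j + 1 => a.1 j k)) =
      put k 0 a.1 := by
    funext j
    cases j <;> simp [put, hk]
  rw [e]
  cases fs <;> simp [hk]

/-- The mark drops out exactly when it was on the last fact; negating the outgoing bit therefore
gives the loop condition. -/
theorem within_shift_succ (k : Mark V) (fs : List (Fact S)) (i : ℕ) (hi : i < fs.length)
    (a : AState V) :
    Within (shift k) (concGo (C := C) (Out := Out) fs false (put k i a.1, a.2))
      (concGo fs (decide (i + 1 < fs.length)) (put k (i + 1) a.1, a.2)) (size fs * 4 + 3) := by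
  have := within_sweep (C := C) (Out := Out) (fun b g _ m => (b, m k, Function.update m k g))
    (enc fs (put k i a.1)) _ a.2 false _ _ (fun _ => [])
    ((foldl_letter_shift k fs (put k i a.1) a.2 false []).trans (by rw [List.append_nil]))
    (by simp)
  rw [length_enc] at this
  refine this.seq (Within.ops _ ?_)
  have hne : fs ≠ [] := List.ne_nil_of_length_pos (Nat.zero_lt_of_lt hi)
  simp only [List.foldl_cons, Op.app, work, List.foldl_nil, concGo, St.mk.injEq, Ctl.mk.injEq,
    true_and, and_true, if_neg hne]
  have e : (fun j => Function.update (put k i a.1 j) k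
      (match j with | 0 => false | j + 1 => put k i a.1 j k)) = put k (i + 1) a.1 := by
    funext j
    cases j <;> simp [put]
  rw [e]
  rw [Bool.eq_iff_iff]
  simp only [put, Function.update_self, Bool.not_eq_true', decide_eq_false_iff_not,
    decide_eq_true_eq, and_true]
  omega

/-- Runs the program `p` for every fact, which is marked by `k` meanwhile. -/
def forEach (k : Mark V) (p : Prg S V C Out) : Prg S V C Out :=
  .seq (.ops [.load fun v => { v with go := true }]) <| .seq (shift k) <|
    .loop (fun v => v.go) <| .seq (.ops [.load fun v => { v with go := false }]) <|
      .seq p (shift k)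

/-- The walking mark replaces a counter. The states `a i` describe the marks with `k` left out, and
the body must find and leave `k` on the `i`-th fact. -/
theorem runs_forEach (k : Mark V) (p : Prg S V C Out) (fs : List (Fact S)) (a : ℕ → AState V)
    (T : ℕ) (hk : ∀ i ≤ fs.length, ∀ j, (a i).1 j k = false)
    (h : ∀ i < fs.length, Runs p fs (put k i (a i).1, (a i).2)
      (put k i (a (i + 1)).1, (a (i + 1)).2) T) :
    Runs (forEach k p) fs (a 0) (a fs.length)
      (size fs * (T + (size fs * 4 + 3) + 2) + (size fs * 4 + 3) + 2) := by
  have h1 : Within (.ops [.load fun v => { v with go := true }])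
      (conc (C := C) (Out := Out) fs (a 0)) (concGo fs true (a 0)) 1 := Within.ops _ rfl
  have h2 := within_shift_start (C := C) (Out := Out) k fs (a 0) (hk 0 (Nat.zero_le _))
  have h3 := Within.loop (b := fun v => v.go)
    (p := .seq (.ops [.load fun v => { v with go := false }]) <| .seq p (shift k))
    (T := 1 + (T + (size fs * 4 + 3)))
    (fun i => concGo (C := C) (Out := Out) fs (decide (i < fs.length)) (put k i (a i).1, (a i).2))
    fs.length (fun i hi => by simp [concGo, work, hi]) (by simp [concGo, work])
    (fun i hi => Within.seq (Within.ops _ (s' := conc fs (put k i (a i).1, (a i).2)) rfl)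
      ((h i hi).seq (within_shift_succ k fs i hi (a (i + 1)))))
  -- After the last shift the mark formally sits at position `fs.length`, beyond the list, so it is
  -- not encoded at all.
  have h4 : concGo (C := C) (Out := Out) fs (decide (fs.length < fs.length))
      (put k fs.length (a fs.length).1, (a fs.length).2) = conc fs (a fs.length) := by
    simp only [concGo, conc, lt_irrefl, decide_false]
    rw [enc_congr]
    intro i hi
    funext m
    by_cases hm : m = k
    · subst hm
      simp [put, hk _ le_rfl, hi.ne]
    · simp [put, hm]
  rw [h4] at h3
  refine (h1.seq (h2.seq h3)).mono ?_
  have := Nat.mul_le_mul_right (T + (size fs * 4 + 3) + 2) (length_le_size fs)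
  have e : 1 + (T + (size fs * 4 + 3)) + 1 = T + (size fs * 4 + 3) + 2 := by ring
  rw [e]
  omega

end FactTape

namespace FactTape

open CQA StackProg

variable {S : Signature} {V C : ℕ} {Out : Type}

/-! ### Comparing arguments of marked facts -/

/-- The list of arguments of a fact. -/
def _root_.CQA.Fact.argList (f : Fact S) : List Const := List.ofFn f.args

/-- The state of the argument counter after reading a letter: the value `1` indicates that the
argument that is looked for is being read. -/
def count (k : Mark V) (i : ℕ) (c : Fin (C + 1)) : MLetter S V → Fin (C + 1)
  | .pred _ m => if m k then ⟨min (i + 2) C, by omega⟩ else 0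
  | .arg => ⟨c - 1, by omega⟩
  | .bit _ => c

/-- The effect of a letter on the argument counter, the auxiliary list and the extracted word. -/
def pick (k : Mark V) (i : ℕ) (x : Fin (C + 1) × List (MLetter S V) × List Bool)
    (a : MLetter S V) : Fin (C + 1) × List (MLetter S V) × List Bool :=
  (count k i x.1 a, a :: x.2.1, match a with
    | .bit b => if x.1.val = 1 then b :: x.2.2 else x.2.2
    | _ => x.2.2)

/-- The bit that a letter stands for, if the argument that is looked for is being read. -/
def pickBit (v : Ctl S V C) : Option Bool :=
  if v.cnt.val = 1 then (match v.buf with | some (.bit b) => some b | _ => none) else none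

/-- Pushes the `i`-th argument of the fact marked by `k` onto the word stack `s`. -/
def extract (s : Bool) (k : Mark V) (i : ℕ) : Prg S V C Out :=
  .seq (.drain .main (.ops [
    .pop .main fun v o => { v with buf := o, cnt := (o.map (count k i v.cnt)).getD 0 },
    .push .tmp (fun _ => true) fun v => v.buf.getD .arg,
    .push (.reg s) (fun v => (pickBit v).isSome) fun v => (pickBit v).getD false,
    .load fun v => { v with buf := none }]))
  (.seq (.ops [.load fun v => { v with cnt := 0 }]) restore)

theorem within_extract (s : Bool) (k : Mark V) (i : ℕ) (l : List (MLetter S V)) (b : Bool)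
    (R : Bool → List Bool) (w : List Bool) (c : Fin (C + 1))
    (h : l.foldl (pick k i) (0, [], R s) = (c, l.reverse, w)) :
    Within (extract s k i) (work (Out := Out) (C := C) { flag := b } l [] R)
      (work { flag := b } l [] (Function.update R s w)) (l.length * 4 + 3) := by
  have h1 := Within.drain (p := .ops [
      .pop .main fun v o => { v with buf := o, cnt := (o.map (count k i v.cnt)).getD 0 },
      .push .tmp (fun _ => true) fun v => v.buf.getD .arg,
      .push (.reg s) (fun v => (pickBit v).isSome) fun v => (pickBit v).getD false,
      .load fun v => { v with buf := none }])
    (k := Stack.main) (T := 1)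
    (fun l x => work (Out := Out) (C := C) { flag := b, cnt := x.1 } l x.2.1
      (Function.update R s x.2.2)) (pick k i)
    (fun _ _ => rfl) (fun a l x => Within.ops _ ?_) l (0, [], R s)
  · rw [h, Function.update_eq_self] at h1
    have h2 := within_restore (C := C) (Out := Out) { flag := b } rfl l.reverse []
      (Function.update R s w)
    rw [List.reverse_reverse, List.append_nil, List.length_reverse] at h2
    exact (h1.seq ((Within.ops _ rfl).seq h2)).mono (by omega)
  · cases a with
    | bit b' =>
      by_cases hx : x.1.val = 1 <;> simp [Op.app, work, pick, count, pickBit, hx]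
    | _ => simp [Op.app, work, pick, count, pickBit]

theorem foldl_pick_bits (k : Mark V) (i : ℕ) (c : Fin (C + 1)) (t : List (MLetter S V))
    (r : List Bool) (w : Const) :
    (w.map MLetter.bit).foldl (pick k i) (c, t, r) =
      (c, (w.map MLetter.bit).reverse ++ t, if c.val = 1 then w.reverse ++ r else r) := by
  induction w generalizing t r with
  | nil => simp
  | cons b w ih =>
    simp only [List.map_cons, List.foldl_cons, pick, count]
    rw [ih]
    by_cases hc : c.val = 1 <;> simp [hc]

/-- The counter goes down at every argument marker and stays at `0` by truncated subtraction. It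
equals `1` exactly during argument number `c - 2`, if `2 ≤ c`, and only then are bits copied.
Pushing them reverses the word. -/
theorem foldl_pick_args (k : Mark V) (i : ℕ) (c : Fin (C + 1)) (t : List (MLetter S V))
    (r : List Bool) (l : List Const) :
    ∃ c', (l.flatMap fun w => MLetter.arg :: w.map MLetter.bit).foldl (pick k i) (c, t, r) =
      (c', (l.flatMap fun w => MLetter.arg :: w.map MLetter.bit).reverse ++ t,
        ((if 2 ≤ c.val then l[c.val - 2]? else none).getD []).reverse ++ r) := by
  induction l generalizing c t r with
  | nil => exact ⟨c, by simp⟩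
  | cons w l ih =>
    simp only [List.flatMap_cons, List.foldl_append, List.foldl_cons]
    rw [show pick k i (c, t, r) MLetter.arg = (⟨c - 1, by omega⟩, MLetter.arg :: t, r) from rfl,
      foldl_pick_bits]
    obtain ⟨c', h⟩ := ih ⟨c - 1, by omega⟩ ((w.map MLetter.bit).reverse ++ MLetter.arg :: t)
      (if (⟨c - 1, by omega⟩ : Fin (C + 1)).val = 1 then w.reverse ++ r else r)
    refine ⟨c', h.trans ?_⟩
    obtain ⟨c, hc⟩ := c
    rcases c with _ | _ | _ | c <;> simp

/-- The cap in `min (i + 2) C` only keeps the counter within its finite type; `hi` makes it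
harmless. -/
theorem foldl_pick_fact (k : Mark V) (i : ℕ) (hi : i + 2 ≤ C) (c : Fin (C + 1))
    (t : List (MLetter S V)) (r : List Bool) (f : Fact S) (m : Mark V → Bool) :
    ∃ c', (markedFact f m).foldl (pick k i) (c, t, r) =
      (c', (markedFact f m).reverse ++ t,
        ((if m k then f.argList[i]? else none).getD []).reverse ++ r) := by
  simp only [markedFact, List.foldl_cons]
  obtain ⟨c', h⟩ := foldl_pick_args (C := C) k i
    (if m k then ⟨min (i + 2) C, by omega⟩ else 0) (.pred f.pred m :: t) r (List.ofFn f.args)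
  refine ⟨c', Eq.trans h ?_⟩
  by_cases hm : m k <;> simp [hm, hi, Fact.argList]

theorem foldl_pick_of_forall_false (k : Mark V) (i : ℕ) (hi : i + 2 ≤ C) (fs : List (Fact S))
    (μ : ℕ → Mark V → Bool) (hμ : ∀ j, μ j k = false) (c : Fin (C + 1)) (t : List (MLetter S V))
    (r : List Bool) :
    ∃ c', (enc fs μ).foldl (pick k i) (c, t, r) = (c', (enc fs μ).reverse ++ t, r) := by
  induction fs generalizing μ c t r with
  | nil => exact ⟨c, rfl⟩
  | cons f fs ih =>
    obtain ⟨c', h⟩ := foldl_pick_fact k i hi c t r f (μ 0)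
    obtain ⟨c'', h'⟩ := ih (fun j => μ (j + 1)) (fun j => hμ _) c'
      ((markedFact f (μ 0)).reverse ++ t) r
    refine ⟨c'', ?_⟩
    rw [enc, List.foldl_append, h, hμ]
    simpa using h'

/-- Every predicate letter resets the counter, so unmarked facts contribute nothing, and the only
marked fact supplies the word. -/
theorem foldl_pick_of_eq_decide (k : Mark V) (i : ℕ) (hi : i + 2 ≤ C) (fs : List (Fact S))
    (μ : ℕ → Mark V → Bool) (p : ℕ) (hμ : ∀ j, μ j k = decide (j = p)) (f : Fact S)
    (hf : fs[p]? = some f) (c : Fin (C + 1)) (t : List (MLetter S V)) (r : List Bool) :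
    ∃ c', (enc fs μ).foldl (pick k i) (c, t, r) =
      (c', (enc fs μ).reverse ++ t, (f.argList[i]?.getD []).reverse ++ r) := by
  induction fs generalizing μ c t r p with
  | nil => simp at hf
  | cons f' fs ih =>
    obtain ⟨c', h⟩ := foldl_pick_fact k i hi c t r f' (μ 0)
    rw [enc, List.foldl_append, h, hμ]
    cases p with
    | zero =>
      simp only [List.getElem?_cons_zero, Option.some.injEq] at hf
      subst hf
      obtain ⟨c'', h'⟩ := foldl_pick_of_forall_false k i hi fs (fun j => μ (j + 1))
        (fun j => by simp [hμ]) c' ((markedFact f' (μ 0)).reverse ++ t)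
        ((f'.argList[i]?.getD []).reverse ++ r)
      exact ⟨c'', by simpa using h'⟩
    | succ p =>
      obtain ⟨c'', h'⟩ := ih (fun j => μ (j + 1)) p (fun j => by simp [hμ]) (by simpa using hf)
        c' ((markedFact f' (μ 0)).reverse ++ t) r
      exact ⟨c'', by simpa using h'⟩

/-- Operands of comparisons: an argument of a marked fact, or a constant. -/
inductive Opd (V : ℕ) : Type where
  | pos (k : Mark V) (i : ℕ) : Opd V
  | const (c : Const) : Opd V

/-- `c` is the value of the operand. -/
def Opd.Val (C : ℕ) (fs : List (Fact S)) (μ : ℕ → Mark V → Bool) : Opd V → Const → Prop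
  | .pos k i, c => i + 2 ≤ C ∧ ∃ p f, fs[p]? = some f ∧ (∀ j, μ j k = decide (j = p)) ∧
      f.argList[i]? = some c
  | .const c', c => c' = c

/-- Pushes the value of an operand, reversed, onto the word stack `s`. -/
def fetch (s : Bool) : Opd V → Prg S V C Out
  | .pos k i => extract s k i
  | .const c => .ops (c.map fun b => .push (.reg s) (fun _ => true) fun _ => b)

theorem foldl_push (s : Bool) (v : Ctl S V C) (l t : List (MLetter S V)) (c : Const)
    (R : Bool → List Bool) :
    (c.map fun b => Op.push (Γ := Gam S V Out) (.reg s) (fun _ => true) fun _ => b).foldl Op.app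
      (work v l t R) = work (Out := Out) v l t (Function.update R s (c.reverse ++ R s)) := by
  induction c generalizing R with
  | nil => simp
  | cons b c ih =>
    rw [List.map_cons, List.foldl_cons]
    have : Op.app (work v l t R)
        (.push (Γ := Gam S V Out) (.reg s) (fun _ => true) fun _ => b) =
        work v l t (Function.update R s (b :: R s)) := by
      simp [Op.app, work]
    rw [this, ih]
    simp

theorem within_fetch (s : Bool) (o : Opd V) (fs : List (Fact S)) (μ : ℕ → Mark V → Bool)
    (c : Const) (h : o.Val C fs μ c) (b : Bool) (R : Bool → List Bool) (hR : R s = []) :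
    Within (fetch s o) (work (Out := Out) (C := C) { flag := b } (enc fs μ) [] R)
      (work { flag := b } (enc fs μ) [] (Function.update R s c.reverse)) (size fs * 4 + 3) := by
  cases o with
  | pos k i =>
    obtain ⟨hi, p, f, hf, hμ, hc⟩ := h
    obtain ⟨c', h'⟩ := foldl_pick_of_eq_decide k i hi fs μ p hμ f hf 0 [] (R s)
    rw [hc, hR] at h'
    have := within_extract (Out := Out) s k i (enc fs μ) b R c.reverse c' (by simp [hR, h'])
    rwa [length_enc] at this
  | const c' =>
    cases h
    refine (Within.ops _ ?_).mono (by omega)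
    rw [foldl_push, hR, List.append_nil]

/-- The length of the constant that an operand consists of. -/
def Opd.constLen : Opd V → ℕ
  | .pos _ _ => 0
  | .const c => c.length

/-- This bounds the running time of a comparison: a value is either part of the list or a constant
of the fixed program. -/
theorem Opd.Val.length_le {C : ℕ} {fs : List (Fact S)} {μ : ℕ → Mark V → Bool} {o : Opd V}
    {c : Const} (h : o.Val C fs μ c) :
    c.length ≤ size fs + o.constLen := by
  cases o with
  | const c' => cases h; simp [Opd.constLen]
  | pos k i =>
    obtain ⟨-, p, f, hf, -, hc⟩ := h
    have h1 : c ∈ List.ofFn f.args := List.mem_of_getElem? hc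
    have h2 : f ∈ fs := List.mem_of_getElem? hf
    have h3 : c.length ≤ (encodeFact f).length := by
      have : ∀ l : List Const, c ∈ l → c.length ≤
          (l.flatMap fun c => Letter.arg (S := S) :: c.map Letter.bit).length := by
        intro l hl
        induction l with
        | nil => cases hl
        | cons d l ih =>
          rcases List.mem_cons.1 hl with rfl | hl
          · simp; omega
          · have := ih hl
            simp at this ⊢; omega
      exact (this _ h1).trans (by simp [encodeFact])
    have h4 : (encodeFact f).length ≤ size fs := by
      clear hf
      induction fs with
      | nil => cases h2
      | cons g fs ih =>
        have e : size (g :: fs) = (encodeFact g).length + size fs := by simp [size]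
        rw [e]
        rcases List.mem_cons.1 h2 with rfl | h2
        · omega
        · have := ih h2
          omega
    simpa [Opd.constLen] using h3.trans h4

/-- Sets the flag according to whether the two words are equal. -/
def compare : Prg S V C Out :=
  .seq (.ops [.load fun v => { v with flag := true, go := true }]) <|
    .loop (fun v => v.go) <| .ops [
      .pop (.reg false) fun v o => { v with xa := o },
      .pop (.reg true) fun v o => { v with xb := o },
      .load fun v => { v with
        flag := v.flag && (v.xa == v.xb)
        go := v.xa.isSome || v.xb.isSome
        xa := none
        xb := none }]

theorem update_update_false (R : Bool → List Bool) (x y : List Bool) :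
    Function.update (Function.update R false x) true y = fun s => if s then y else x := by
  funext s
  cases s <;> simp

/-- Both words are popped in parallel. If one ends first, `none` meets `some` and the flag is lost
for good, while the loop goes on to empty the other word. A last pass, in which `none` meets `none`,
detects the end without changing the flag. -/
theorem within_compare_loop (l t : List (MLetter S V)) (x y : List Bool) (b : Bool) :
    Within (.loop (fun v => v.go) <| .ops [
      .pop (.reg false) fun v o => { v with xa := o },
      .pop (.reg true) fun v o => { v with xb := o },
      .load fun v => { v with
        flag := v.flag && (v.xa == v.xb)
        go := v.xa.isSome || v.xb.isSome
        xa := none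
        xb := none }])
      (work (Out := Out) (C := C) { flag := b, go := true } l t fun s => if s then y else x)
      (work { flag := b && (x == y) } l t fun _ => []) ((x.length + y.length) * 2 + 3) := by
  induction hn : x.length + y.length using Nat.strong_induction_on generalizing x y b with
  | _ n ih =>
    have hstep : ∀ (x y : List Bool),
        [Op.pop (Γ := Gam S V Out) (.reg false) fun (v : Ctl S V C) o => { v with xa := o },
        .pop (.reg true) fun v o => { v with xb := o },
        .load fun v => { v with
          flag := v.flag && (v.xa == v.xb)
          go := v.xa.isSome || v.xb.isSome
          xa := none
          xb := none }].foldl Op.app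
          (work (Out := Out) (C := C) { flag := b, go := true } l t fun s => if s then y else x) =
        work { flag := b && (x.head? == y.head?), go := x.head?.isSome || y.head?.isSome } l t
          fun s => if s then y.tail else x.tail := by
      intro x y
      simp only [List.foldl_cons, Op.app, work, tapes_reg, update_reg, List.foldl_nil,
        update_update_false]
      simp
    by_cases h0 : n = 0
    · have hx : x = [] := List.length_eq_zero_iff.1 (by omega)
      have hy : y = [] := List.length_eq_zero_iff.1 (by omega)
      subst hx hy
      refine ⟨3, by omega, .loop_true (t := 1) (t' := 1) rfl (.ops _ _) ?_⟩
      rw [hstep]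
      simpa using Exec.loop_false rfl
    · obtain ⟨t', ht', h⟩ := ih (x.tail.length + y.tail.length)
        (by simp only [List.length_tail]; omega) x.tail y.tail (b && (x.head? == y.head?)) rfl
      refine ⟨1 + t' + 1, ?_, .loop_true rfl (.ops _ _) ?_⟩
      · simp only [List.length_tail] at ht'
        omega
      · rw [hstep]
        have e1 : (x.head?.isSome || y.head?.isSome) = true := by
          cases x <;> cases y <;> simp_all
        have e2 : (b && (x == y)) = (b && (x.head? == y.head?) && (x.tail == y.tail)) := by
          rw [Bool.and_assoc]
          congr 1
          cases x <;> cases y <;> simp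
        rw [e1, e2]
        exact h

/-- Sets the flag according to whether the two operands have the same value. -/
def eqTest (o o' : Opd V) : Prg S V C Out :=
  .seq (fetch false o) <| .seq (fetch true o') compare

open Polynomial in
theorem exists_runs_eqTest (o o' : Opd V) : ∃ P : ℕ[X], ∀ (fs : List (Fact S)) (a : AState V)
    (c c' : Const), o.Val C fs a.1 c → o'.Val C fs a.1 c' →
    Runs (eqTest (C := C) (Out := Out) o o') fs a (a.1, decide (c = c')) (P.eval (size fs)) := by
  refine ⟨12 * X + Polynomial.C (10 + (2 * o.constLen + 2 * o'.constLen)), fun fs a c c' h h' => ?_⟩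
  have h1 := within_fetch (Out := Out) false o fs a.1 c h a.2 (fun _ => []) rfl
  have h2 := within_fetch (Out := Out) true o' fs a.1 c' h' a.2
    (Function.update (fun _ => []) false c.reverse) (by simp)
  rw [update_update_false] at h2
  have h3 := within_compare_loop (Out := Out) (C := C) (enc fs a.1) [] c.reverse c'.reverse true
  -- Both operands arrive reversed, which does not affect whether they are equal.
  have h4 : decide (c = c') = (true && (c.reverse == c'.reverse)) := by
    rw [Bool.eq_iff_iff]
    simp
  have e1 := h.length_le
  have e2 := h'.length_le
  unfold Runs conc
  rw [h4]
  refine (h1.seq (h2.seq ((Within.ops _ rfl).seq h3))).mono ?_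
  simp only [List.length_reverse, eval_add, eval_mul, eval_ofNat, eval_X, eval_C]
  omega

end FactTape

namespace FactTape

open CQA StackProg Polynomial

variable {S : Signature} {V C : ℕ} {Out : Type}

/-! ### Programs that decide properties of marked lists -/

/-- The truth value of a proposition. -/
noncomputable def truth (P : Prop) : Bool := @decide P (Classical.propDecidable P)

@[simp] theorem truth_eq_true {P : Prop} : truth P = true ↔ P := by simp [truth]

@[simp] theorem truth_eq_false {P : Prop} : truth P = false ↔ ¬ P := by simp [truth]

theorem truth_congr {P Q : Prop} (h : P ↔ Q) : truth P = truth Q := by rw [propext h]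

theorem decide_eq_truth (P : Prop) [Decidable P] : decide P = truth P := by
  rw [Bool.eq_iff_iff]
  simp

@[simp] theorem not_truth (P : Prop) : (!truth P) = truth (¬ P) := by
  rw [Bool.eq_iff_iff]
  simp

/-- The program that does nothing. -/
def skip : Prg S V C Out := .ops []

/-- Sets the flag. -/
def setFlag (b : Bool) : Prg S V C Out := .ops [.load fun v => { v with flag := b }]

/-- Negates the flag. -/
def notFlag : Prg S V C Out := .ops [.load fun v => { v with flag := !v.flag }]

/-- Branches on the flag. -/
def ifFlag (p q : Prg S V C Out) : Prg S V C Out := .ite (fun v => v.flag) p q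

theorem runs_skip (fs : List (Fact S)) (a : AState V) :
    Runs (skip (C := C) (Out := Out)) fs a a 1 := Within.ops _ rfl

theorem runs_setFlag (b : Bool) (fs : List (Fact S)) (a : AState V) :
    Runs (setFlag (C := C) (Out := Out) b) fs a (a.1, b) 1 := Within.ops _ rfl

theorem runs_notFlag (fs : List (Fact S)) (a : AState V) :
    Runs (notFlag (C := C) (Out := Out)) fs a (a.1, !a.2) 1 := Within.ops _ rfl

namespace Runs

variable {p q : Prg S V C Out} {fs : List (Fact S)} {a a' a'' : AState V} {T T' : ℕ}

theorem mono (h : Runs p fs a a' T) (hT : T ≤ T') : Runs p fs a a' T' := Within.mono h hT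

theorem seq (h : Runs p fs a a' T) (h' : Runs q fs a' a'' T') :
    Runs (.seq p q) fs a a'' (T + T') := Within.seq h h'

theorem if_true (ha : a.2 = true) (h : Runs p fs a a' T) : Runs (ifFlag p q) fs a a' (T + 1) :=
  Within.ite_true ha h

theorem if_false (ha : a.2 = false) (h : Runs q fs a a' T) : Runs (ifFlag p q) fs a a' (T + 1) :=
  Within.ite_false ha h

end Runs

/-- In polynomial time, and for all lists that satisfy the precondition, the program sets the flag
according to whether `Q` holds, and leaves the marks unchanged. -/
def Decides {G : Type*} (p : Prg S V C Out)
    (Pre Q : G → List (Fact S) → (ℕ → Mark V → Bool) → Prop) :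
    Prop :=
  ∃ P : ℕ[X], ∀ g fs μ b, Pre g fs μ → Runs p fs (μ, b) (μ, truth (Q g fs μ)) (P.eval (size fs))

/-- Conjunction. -/
def andProg (p q : Prg S V C Out) : Prg S V C Out := .seq p (ifFlag q skip)

/-- Disjunction. -/
def orProg (p q : Prg S V C Out) : Prg S V C Out := .seq p (ifFlag skip q)

/-- Conjunction over a list. -/
def allProg {ι : Type*} (l : List ι) (p : ι → Prg S V C Out) : Prg S V C Out :=
  l.foldr (fun i q => andProg (p i) q) (setFlag true)

/-- Disjunction over a list. -/
def anyProg {ι : Type*} (l : List ι) (p : ι → Prg S V C Out) : Prg S V C Out :=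
  l.foldr (fun i q => orProg (p i) q) (setFlag false)

/-- Existential quantification over the facts; the fact in question is marked by `k`. -/
def existsProg (k : Mark V) (p : Prg S V C Out) : Prg S V C Out :=
  .seq (setFlag false) (forEach k (ifFlag skip p))

/-- Whether some fact that is marked by `k` has the property `h`. -/
def testAt (k : Mark V) (h : S.Pred → (Mark V → Bool) → Bool) : Prg S V C Out :=
  .seq (setFlag false) (test k h)

namespace Decides

variable {G : Type*} {p q : Prg S V C Out}
  {Pre Pre' Q Q' : G → List (Fact S) → (ℕ → Mark V → Bool) → Prop}

theorem congr (h : Decides p Pre Q) (hPre : ∀ g fs μ, Pre' g fs μ → Pre g fs μ)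
    (hQ : ∀ g fs μ, Pre' g fs μ → (Q g fs μ ↔ Q' g fs μ)) : Decides p Pre' Q' := by
  obtain ⟨P, h⟩ := h
  refine ⟨P, fun g fs μ b hg => ?_⟩
  have := h g fs μ b (hPre _ _ _ hg)
  rwa [truth_congr (hQ _ _ _ hg)] at this

theorem setFlag_true : Decides (setFlag (C := C) (Out := Out) true) Pre fun _ _ _ => True :=
  ⟨1, fun g fs μ b _ => by
    rw [truth_eq_true.2 trivial]
    simpa using runs_setFlag true fs (μ, b)⟩

theorem setFlag_false : Decides (setFlag (C := C) (Out := Out) false) Pre fun _ _ _ => False :=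
  ⟨1, fun g fs μ b _ => by
    rw [truth_eq_false.2 not_false]
    simpa using runs_setFlag false fs (μ, b)⟩

theorem neg (h : Decides p Pre Q) :
    Decides (.seq p notFlag) Pre fun g fs μ => ¬ Q g fs μ := by
  obtain ⟨P, h⟩ := h
  refine ⟨P + 1, fun g fs μ b hg => ?_⟩
  simpa using (h g fs μ b hg).seq (runs_notFlag fs _)

/-- The second program runs only if the first test succeeded, so it may presuppose it. This matters
for comparisons of arguments, which are meaningful only after the predicate or its arity has been
checked. -/
theorem and (h : Decides p Pre Q)
    (h' : Decides q (fun g fs μ => Pre g fs μ ∧ Q g fs μ) Q') :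
    Decides (andProg p q) Pre fun g fs μ => Q g fs μ ∧ Q' g fs μ := by
  obtain ⟨P, h⟩ := h
  obtain ⟨P', h'⟩ := h'
  refine ⟨P + P' + 2, fun g fs μ b hg => ?_⟩
  beta_reduce
  by_cases hQ : Q g fs μ
  · have e : truth (Q g fs μ ∧ Q' g fs μ) = truth (Q' g fs μ) := truth_congr (by simp [hQ])
    rw [e]
    exact ((h g fs μ b hg).seq (.if_true (by simpa using hQ) (h' g fs μ _ ⟨hg, hQ⟩))).mono
      (by simp; omega)
  · have e : truth (Q g fs μ ∧ Q' g fs μ) = truth (Q g fs μ) := truth_congr (by simp [hQ])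
    rw [e]
    exact ((h g fs μ b hg).seq (.if_false (by simpa using hQ) (runs_skip _ _))).mono
      (by simp)

theorem or (h : Decides p Pre Q) (h' : Decides q Pre Q') :
    Decides (orProg p q) Pre fun g fs μ => Q g fs μ ∨ Q' g fs μ := by
  obtain ⟨P, h⟩ := h
  obtain ⟨P', h'⟩ := h'
  refine ⟨P + P' + 2, fun g fs μ b hg => ?_⟩
  beta_reduce
  by_cases hQ : Q g fs μ
  · have e : truth (Q g fs μ ∨ Q' g fs μ) = truth (Q g fs μ) := truth_congr (by simp [hQ])
    rw [e]
    exact ((h g fs μ b hg).seq (.if_true (by simpa using hQ) (runs_skip _ _))).mono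
      (by simp)
  · have e : truth (Q g fs μ ∨ Q' g fs μ) = truth (Q' g fs μ) := truth_congr (by simp [hQ])
    rw [e]
    exact ((h g fs μ b hg).seq (.if_false (by simpa using hQ) (h' g fs μ _ hg))).mono
      (by simp; omega)

theorem all {ι : Type*} {l : List ι} {p : ι → Prg S V C Out}
    {Q : ι → G → List (Fact S) → (ℕ → Mark V → Bool) → Prop}
    (h : ∀ i ∈ l, Decides (p i) Pre (Q i)) :
    Decides (allProg l p) Pre fun g fs μ => ∀ i ∈ l, Q i g fs μ := by
  induction l with
  | nil => exact setFlag_true.congr (fun _ _ _ h => h) (by simp)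
  | cons i l ih =>
    exact ((h i (by simp)).and ((ih fun j hj => h j (by simp [hj])).congr (fun _ _ _ h => h.1)
      fun _ _ _ _ => Iff.rfl)).congr (fun _ _ _ h => h) (by simp)

theorem any {ι : Type*} {l : List ι} {p : ι → Prg S V C Out}
    {Q : ι → G → List (Fact S) → (ℕ → Mark V → Bool) → Prop}
    (h : ∀ i ∈ l, Decides (p i) Pre (Q i)) :
    Decides (anyProg l p) Pre fun g fs μ => ∃ i ∈ l, Q i g fs μ := by
  induction l with
  | nil => exact setFlag_false.congr (fun _ _ _ h => h) (by simp)
  | cons i l ih =>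
    exact ((h i (by simp)).or (ih fun j hj => h j (by simp [hj]))).congr (fun _ _ _ h => h)
      (by simp)

theorem testAt (k : Mark V) (h : S.Pred → (Mark V → Bool) → Bool) :
    Decides (testAt (C := C) (Out := Out) k h) Pre fun _ fs μ =>
      ∃ i f, fs[i]? = some f ∧ μ i k = true ∧ h f.pred (μ i) = true := by
  refine ⟨4 * X + 3, fun g fs μ b _ => ?_⟩
  have := (runs_setFlag (C := C) (Out := Out) false fs (μ, b)).seq (runs_test k h fs _)
  rw [Bool.false_or, decide_eq_truth] at this
  refine this.mono ?_
  simp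
  omega

/-- After `i` passes the flag records whether a witness occurs before position `i`; once it is set,
the remaining passes do nothing. -/
theorem exists_mark {k : Mark V} {p : Prg S V C Out}
    {Q : ℕ → G → List (Fact S) → (ℕ → Mark V → Bool) → Prop}
    (hk : ∀ g fs μ, Pre g fs μ → ∀ j, μ j k = false)
    (h : ∃ P : ℕ[X], ∀ g fs μ b i, Pre g fs μ → i < fs.length →
      Runs p fs (put k i μ, b) (put k i μ, truth (Q i g fs μ)) (P.eval (size fs))) :
    Decides (existsProg k p) Pre fun g fs μ => ∃ i < fs.length, Q i g fs μ := by
  obtain ⟨P, h⟩ := h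
  refine ⟨X * (P + 2 + (X * 4 + 3) + 2) + (X * 4 + 3) + 3, fun g fs μ b hg => ?_⟩
  have h1 := runs_forEach (C := C) (Out := Out) k (ifFlag skip p) fs
    (fun i => (μ, truth (∃ j < i, Q j g fs μ))) (P.eval (size fs) + 2)
    (fun i _ => hk g fs μ hg) (fun i hi => ?_)
  · have h0 : ¬ ∃ j < 0, Q j g fs μ := by simp
    simp only [truth_eq_false.2 h0] at h1
    exact ((runs_setFlag false fs (μ, b)).seq h1).mono (by simp; omega)
  · by_cases hQ : ∃ j < i, Q j g fs μ
    · have hQ' : ∃ j < i + 1, Q j g fs μ :=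
        hQ.imp fun j hj => ⟨hj.1.trans (Nat.lt_succ_self i), hj.2⟩
      simp only [truth_eq_true.2 hQ, truth_eq_true.2 hQ']
      exact (Runs.if_true rfl (runs_skip _ _)).mono (by omega)
    · have hQ' : (∃ j < i + 1, Q j g fs μ) ↔ Q i g fs μ := by
        constructor
        · rintro ⟨j, hj, hj'⟩
          rcases Nat.lt_succ_iff_lt_or_eq.1 hj with hj | rfl
          · exact absurd ⟨j, hj, hj'⟩ hQ
          · exact hj'
        · exact fun h => ⟨i, Nat.lt_succ_self i, h⟩
      simp only [truth_congr hQ', truth_eq_false.2 hQ]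
      exact (Runs.if_false rfl (h g fs μ false i hg hi)).mono (by omega)

end Decides

theorem Opd.Val.unique {fs : List (Fact S)} {μ : ℕ → Mark V → Bool} {o : Opd V} {c c' : Const}
    (h : o.Val C fs μ c) (h' : o.Val C fs μ c') : c = c' := by
  cases o with
  | const d => exact Eq.trans (Eq.symm h) h'
  | pos k i =>
    obtain ⟨-, p, f, hf, hp, hc⟩ := h
    obtain ⟨-, p', f', hf', hp', hc'⟩ := h'
    have : p = p' := by
      have := (hp p).symm.trans (hp' p)
      simpa using this
    subst this
    rw [hf] at hf'
    cases hf'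
    rw [hc] at hc'
    exact Option.some.inj hc'

/-- An operand has a value only if its mark singles out one fact with enough arguments, so the
precondition has to guarantee this. -/
theorem decides_eqTest {G : Type*} (o o' : Opd V)
    {Pre : G → List (Fact S) → (ℕ → Mark V → Bool) → Prop}
    (h : ∀ g fs μ, Pre g fs μ → (∃ c, o.Val C fs μ c) ∧ ∃ c, o'.Val C fs μ c) :
    Decides (eqTest (C := C) (Out := Out) o o') Pre fun _ fs μ =>
      ∃ c, o.Val C fs μ c ∧ o'.Val C fs μ c := by
  obtain ⟨P, hP⟩ := exists_runs_eqTest (S := S) (C := C) (Out := Out) o o'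
  refine ⟨P, fun g fs μ b hg => ?_⟩
  obtain ⟨⟨c, hc⟩, c', hc'⟩ := h g fs μ hg
  have e : (∃ c, o.Val C fs μ c ∧ o'.Val C fs μ c) ↔ c = c' := by
    constructor
    · rintro ⟨d, hd, hd'⟩
      exact (hc.unique hd).trans (hd'.unique hc')
    · rintro rfl
      exact ⟨c, hc, hc'⟩
  rw [truth_congr e, ← decide_eq_truth]
  exact hP fs (μ, b) c c' hc hc'

/-! ### First-order formulas -/

/-- First-order formulas over a list of marked facts: `rel b a` says that the fact `a` occurs with
the mark `b`. Quantifiers range over the constants that occur in the list. -/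
inductive Form (S : Signature) : Type where
  | rel (b : Base) (a : Atom S) : Form S
  | eq (t t' : Term) : Form S
  | tru : Form S
  | neg (φ : Form S) : Form S
  | and (φ ψ : Form S) : Form S
  | ex (x : Var) (φ : Form S) : Form S

namespace Form

/-- The satisfaction relation. -/
def Sat (I : Base → Set (Fact S)) (A : Set Const) : Form S → Subst → Prop
  | .rel b a, s => a.inst s ∈ I b
  | .eq t t', s => t.eval s = t'.eval s
  | .tru, _ => True
  | .neg φ, s => ¬ φ.Sat I A s
  | .and φ ψ, s => φ.Sat I A s ∧ ψ.Sat I A s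
  | .ex x φ, s => ∃ c ∈ A, φ.Sat I A (Function.update s x c)

/-- The free variables belong to `X`, and no variable is bound twice. -/
def WF : Form S → Set Var → Prop
  | .rel _ a, X => a.vars ⊆ X
  | .eq t t', X => t.vars ∪ t'.vars ⊆ X
  | .tru, _ => True
  | .neg φ, X => φ.WF X
  | .and φ ψ, X => φ.WF X ∧ ψ.WF X
  | .ex x φ, X => x ∉ X ∧ φ.WF (insert x X)

/-- The largest bound variable. -/
def maxVar : Form S → ℕ
  | .rel _ _ => 0
  | .eq _ _ => 0
  | .tru => 0
  | .neg φ => φ.maxVar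
  | .and φ ψ => max φ.maxVar ψ.maxVar
  | .ex x φ => max x φ.maxVar

end Form

/-- The mark that belongs to a variable. -/
def varMark (V : ℕ) (x : Var) : Mark V := .var (Fin.ofNat (V + 1) x)

theorem varMark_ne {x y : Var} (hx : x ≤ V) (hy : y ≤ V) (h : x ≠ y) :
    varMark V x ≠ varMark V y := by
  intro e
  simp only [varMark, Mark.var.injEq, Fin.ext_iff, Fin.val_ofNat] at e
  rw [Nat.mod_eq_of_lt (Nat.lt_succ_of_le hx), Nat.mod_eq_of_lt (Nat.lt_succ_of_le hy)] at e
  exact h e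

/-- The operand that a term stands for; a variable `x` stands for the argument with the number
`ρ x` of the fact that is marked by `varMark V x`. -/
def opd (ρ : Var → ℕ) : Term → Opd V
  | .var x => .pos (varMark V x) (ρ x)
  | .const c => .const c

/-- The program that evaluates a formula. -/
noncomputable def comp : Form S → (Var → ℕ) → Prg S V C Out
  | .rel b a, ρ => existsProg .rel (andProg
      (testAt .rel fun p m => m (.base b) && truth (p = a.pred))
      (allProg (List.finRange (S.arity a.pred)) fun i => eqTest (.pos .rel i) (opd ρ (a.args i))))
  | .eq t t', ρ => eqTest (opd ρ t) (opd ρ t')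
  | .tru, _ => setFlag true
  | .neg φ, ρ => .seq (comp φ ρ) notFlag
  | .and φ ψ, ρ => andProg (comp φ ρ) (comp ψ ρ)
  | .ex x φ, ρ => existsProg (varMark V x) (anyProg (List.range C) fun i => andProg
      (testAt (varMark V x) fun p _ => decide (i < S.arity p))
      (comp φ (Function.update ρ x i)))

/-- The facts that carry the mark `b`. -/
def factsOf (fs : List (Fact S)) (μ : ℕ → Mark V → Bool) (b : Base) : Set (Fact S) :=
  {f | ∃ i, fs[i]? = some f ∧ μ i (.base b) = true}

/-- The constants that occur in a list of facts. -/
def adom (fs : List (Fact S)) : Set Const := {c | ∃ f ∈ fs, c ∈ f.argList}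

/-- The marks of the variables in `X` represent the substitution `s`; those of the other variables
are not in use. -/
structure Env (C : ℕ) (X : Set Var) (ρ : Var → ℕ) (s : Subst) (fs : List (Fact S))
    (μ : ℕ → Mark V → Bool) : Prop where
  val : ∀ x ∈ X, Opd.Val C fs μ (.pos (varMark V x) (ρ x)) (s x)
  free : ∀ x ≤ V, x ∉ X → ∀ j, μ j (varMark V x) = false
  rel : ∀ j, μ j .rel = false

theorem Opd.Val.put {fs : List (Fact S)} {μ : ℕ → Mark V → Bool} {k k' : Mark V} {i n : ℕ}
    {c : Const} (h : Opd.Val C fs μ (.pos k i) c) (hk : k ≠ k') :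
    Opd.Val C fs (put k' n μ) (.pos k i) c := by
  obtain ⟨hi, p, f, hf, hp, hc⟩ := h
  exact ⟨hi, p, f, hf, fun j => by simp [FactTape.put, hk, hp], hc⟩

theorem val_put_iff {fs : List (Fact S)} {μ : ℕ → Mark V → Bool} {k : Mark V} {i n : ℕ}
    {c : Const} : Opd.Val C fs (put k n μ) (.pos k i) c ↔
      i + 2 ≤ C ∧ ∃ f, fs[n]? = some f ∧ f.argList[i]? = some c := by
  constructor
  · rintro ⟨hi, p, f, hf, hp, hc⟩
    have : p = n := by
      have := hp p
      simpa [put] using this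
    subst this
    exact ⟨hi, f, hf, hc⟩
  · rintro ⟨hi, f, hf, hc⟩
    exact ⟨hi, n, f, hf, fun j => by simp [put], hc⟩

theorem val_opd {fs : List (Fact S)} {μ : ℕ → Mark V → Bool} {X : Set Var} {ρ : Var → ℕ}
    {s : Subst} (h : ∀ x ∈ X, Opd.Val C fs μ (.pos (varMark V x) (ρ x)) (s x)) {t : Term}
    (ht : t.vars ⊆ X) : (opd ρ t).Val C fs μ (t.eval s) := by
  cases t with
  | var x => exact h x (ht rfl)
  | const c => exact rfl

theorem factsOf_put {fs : List (Fact S)} {μ : ℕ → Mark V → Bool} {k : Mark V} {n : ℕ}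
    (hk : ∀ b, Mark.base b ≠ k) : factsOf fs (put k n μ) = factsOf fs μ := by
  funext b
  simp [factsOf, put, hk]

/-- Equality of facts involves arguments whose number depends on the predicate. This form splits it
into a test of the predicate and comparisons by position, which is what the machine carries out. -/
theorem eq_inst_iff {f : Fact S} {a : Atom S} {s : Subst} :
    f = a.inst s ↔ f.pred = a.pred ∧
      ∀ i : Fin (S.arity a.pred), f.argList[i.val]? = some ((a.args i).eval s) := by
  constructor
  · rintro rfl
    exact ⟨rfl, fun i => by simp [Fact.argList, Atom.inst]⟩
  · obtain ⟨p, args⟩ := f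
    rintro ⟨h, h'⟩
    obtain ⟨q, args'⟩ := a
    cases h
    simp only [Atom.inst, Fact.mk.injEq, heq_eq_eq, true_and]
    funext i
    have := h' i
    simpa [Fact.argList] using this

theorem inst_vars_subset {a : Atom S} {X : Set Var} (h : a.vars ⊆ X) (i : Fin (S.arity a.pred)) :
    (a.args i).vars ⊆ X := (Set.subset_iUnion (fun i => (a.args i).vars) i).trans h

/-- The mark `rel` runs through the list in search of the instantiated atom; each candidate is
checked for predicate and mark first, and only then argument by argument. -/
theorem decides_rel (hC : ∀ p, S.arity p + 2 ≤ C) (b : Base) (a : Atom S) (ρ : Var → ℕ)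
    {X : Set Var} (ha : a.vars ⊆ X) :
    Decides (comp (V := V) (C := C) (Out := Out) (.rel b a) ρ)
      (fun s fs μ => Env C X ρ s fs μ) fun s fs μ => a.inst s ∈ factsOf fs μ b := by
  have hrel : ∀ x, varMark V x ≠ .rel := fun x h => by cases h
  -- The parameter couples the substitution with the position that carries `rel`, so that the rules
  -- for `Decides` apply to the body of the loop.
  have inner : Decides (andProg (testAt (V := V) (C := C) (Out := Out) .rel
        fun p m => m (.base b) && truth (p = a.pred))
      (allProg (List.finRange (S.arity a.pred)) fun i => eqTest (.pos .rel i) (opd ρ (a.args i))))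
      (fun (g : Subst × ℕ) fs μ => g.2 < fs.length ∧ ∃ μ', Env C X ρ g.1 fs μ' ∧
        μ = put .rel g.2 μ')
      fun g fs μ => ∃ f, fs[g.2]? = some f ∧ μ g.2 (.base b) = true ∧ f = a.inst g.1 := by
    refine Decides.congr ((Decides.testAt _ _).and (Decides.all fun i _ => decides_eqTest _ _ ?_))
      (fun _ _ _ h => h) ?_
    · rintro ⟨s, n⟩ fs _ ⟨⟨hn, μ, hμ, rfl⟩, j, f, hf, hj, hj'⟩
      have : j = n := by simpa [put] using hj
      subst this
      simp only [Bool.and_eq_true, truth_eq_true] at hj'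
      refine ⟨⟨f.argList[i.val]'(by simp [Fact.argList, hj'.2]), val_put_iff.2
        ⟨by have := hC a.pred; omega, f, hf, List.getElem?_eq_getElem _⟩⟩, _,
        val_opd (fun x hx => (hμ.val x hx).put (hrel x)) (inst_vars_subset ha i)⟩
    · rintro ⟨s, n⟩ fs _ ⟨hn, μ, hμ, rfl⟩
      have hv : ∀ i, (opd ρ (a.args i)).Val C fs (put .rel n μ) ((a.args i).eval s) := fun i =>
        val_opd (fun x hx => (hμ.val x hx).put (hrel x)) (inst_vars_subset ha i)
      simp only [List.mem_finRange, true_implies, Bool.and_eq_true, truth_eq_true]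
      constructor
      · rintro ⟨⟨j, f, hf, hj, hb, hp⟩, h⟩
        have : j = n := by simpa [put] using hj
        subst this
        refine ⟨f, hf, hb, eq_inst_iff.2 ⟨hp, fun i => ?_⟩⟩
        obtain ⟨c, hc, hc'⟩ := h i
        rw [← hc'.unique (hv i)]
        obtain ⟨-, f', hf', hc⟩ := val_put_iff.1 hc
        rw [hf] at hf'
        cases hf'
        exact hc
      · rintro ⟨f, hf, hb, he⟩
        obtain ⟨hp, he⟩ := eq_inst_iff.1 he
        refine ⟨⟨n, f, hf, by simp [put], hb, hp⟩, fun i => ⟨_, ?_, hv i⟩⟩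
        exact val_put_iff.2 ⟨by have := hC a.pred; omega, f, hf, he i⟩
  obtain ⟨P, hP⟩ := inner
  refine (Decides.exists_mark (Q := fun i s fs μ => ∃ f, fs[i]? = some f ∧
    μ i (.base b) = true ∧ f = a.inst s) (fun s fs μ h => h.rel) ⟨P, ?_⟩).congr
    (fun _ _ _ h => h) ?_
  · intro s fs μ b' i hμ hi
    simpa [put] using hP (s, i) fs (put .rel i μ) b' ⟨hi, μ, hμ, rfl⟩
  · intro s fs μ hμ
    constructor
    · rintro ⟨i, -, f, hf, hb, rfl⟩
      exact ⟨i, hf, hb⟩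
    · rintro ⟨i, hf, hb⟩
      exact ⟨i, (List.getElem?_eq_some_iff.1 hf).1, _, hf, hb, rfl⟩

/-- Programs for formulas are correct and run in polynomial time. -/
theorem decides_comp (hC : ∀ p, S.arity p + 2 ≤ C) (φ : Form S) (ρ : Var → ℕ) (X : Set Var)
    (hφ : φ.WF X) (hV : φ.maxVar ≤ V) (hX : ∀ x ∈ X, x ≤ V) :
    Decides (comp (V := V) (C := C) (Out := Out) φ ρ) (fun s fs μ => Env C X ρ s fs μ)
      fun s fs μ => φ.Sat (factsOf fs μ) (adom fs) s := by
  induction φ generalizing ρ X with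
  | rel b a => exact decides_rel hC b a ρ hφ
  | eq t t' =>
    have h := Set.union_subset_iff.1 hφ
    refine (decides_eqTest (opd ρ t) (opd ρ t') fun s fs μ hμ =>
      ⟨⟨_, val_opd hμ.val h.1⟩, _, val_opd hμ.val h.2⟩).congr (fun _ _ _ h => h) ?_
    intro s fs μ hμ
    constructor
    · rintro ⟨c, hc, hc'⟩
      exact ((val_opd hμ.val h.1).unique hc).trans (hc'.unique (val_opd hμ.val h.2))
    · intro (e : t.eval s = t'.eval s)
      exact ⟨_, val_opd hμ.val h.1, e ▸ val_opd hμ.val h.2⟩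
  | tru => exact Decides.setFlag_true
  | neg φ ih => exact (ih ρ X hφ hV hX).neg
  | and φ ψ ih ih' =>
    exact (ih ρ X hφ.1 (le_trans (le_max_left _ _) hV) hX).and
      ((ih' ρ X hφ.2 (le_trans (le_max_right _ _) hV) hX).congr (fun _ _ _ h => h.1)
        fun _ _ _ _ => Iff.rfl)
  | ex x φ ih =>
    have hxV : x ≤ V := le_trans (le_max_left _ _) hV
    have hbase : ∀ b, Mark.base b ≠ varMark V x := fun b h => by cases h
    -- A constant of the list is an argument of some fact. The fact is found by a loop, whereas the
    -- argument number, being less than `C`, ranges over a disjunction unrolled in the program. The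
    -- default `[]` is never reached, since the guard ensures `i < S.arity f.pred`.
    have inner : Decides (anyProg (List.range C) fun i => andProg
        (testAt (V := V) (C := C) (Out := Out) (varMark V x) fun p _ => decide (i < S.arity p))
        (comp φ (Function.update ρ x i)))
        (fun (g : Subst × ℕ) fs μ => g.2 < fs.length ∧ ∃ μ', Env C X ρ g.1 fs μ' ∧
          μ = put (varMark V x) g.2 μ')
        fun g fs μ => ∃ i ∈ List.range C, (∃ j f, fs[j]? = some f ∧ μ j (varMark V x) = true ∧
          decide (i < S.arity f.pred) = true) ∧ φ.Sat (factsOf fs μ) (adom fs)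
            (Function.update g.1 x ((fs[g.2]?.bind fun f => f.argList[i]?).getD [])) := by
      refine Decides.any fun i _ => (Decides.testAt _ _).and ?_
      obtain ⟨P, hP⟩ := ih (Function.update ρ x i) (insert x X) hφ.2
        (le_trans (le_max_right _ _) hV) (fun y hy => hy.elim (fun h => h ▸ hxV) (hX y))
      refine ⟨P, ?_⟩
      rintro ⟨s, n⟩ fs _ b ⟨⟨hn, μ, hμ, rfl⟩, j, f, hf, hj, hi⟩
      have : j = n := by simpa [put] using hj
      subst this
      refine hP (Function.update s x ((fs[j]?.bind fun f => f.argList[i]?).getD [])) fs _ b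
        ⟨fun y hy => ?_, fun y hy hy' l => ?_, fun l => ?_⟩
      · by_cases hyx : y = x
        · subst hyx
          simp only [decide_eq_true_eq] at hi
          simp only [Function.update_self]
          refine val_put_iff.2 ⟨by have := hC f.pred; omega, f, hf, ?_⟩
          simp [hf, Fact.argList, hi]
        · have hyX : y ∈ X := hy.resolve_left hyx
          simp only [Function.update_of_ne hyx]
          exact (hμ.val y hyX).put (varMark_ne (hX y hyX) hxV hyx)
      · have h := not_or.1 hy'
        simp only [put, Function.update_of_ne (varMark_ne hy hxV h.1)]
        exact hμ.free y hy h.2 l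
      · have : Mark.rel ≠ varMark V x := fun h => by cases h
        simp only [put, Function.update_of_ne this]
        exact hμ.rel l
    obtain ⟨P, hP⟩ := inner
    refine (Decides.exists_mark (Q := fun n s fs μ => ∃ f, fs[n]? = some f ∧
      ∃ c ∈ f.argList, φ.Sat (factsOf fs μ) (adom fs) (Function.update s x c))
      (fun s fs μ h => h.free x hxV hφ.1) ⟨P, ?_⟩).congr (fun _ _ _ h => h) ?_
    · intro s fs μ b n hμ hn
      have h := hP (s, n) fs (put (varMark V x) n μ) b ⟨hn, μ, hμ, rfl⟩
      simp only [factsOf_put hbase] at h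
      refine (truth_congr ?_) ▸ h
      constructor
      · rintro ⟨i, -, ⟨j, f, hf, hj, hi⟩, h⟩
        have : j = n := by simpa [put] using hj
        subst this
        have hi' : i < f.argList.length := by simpa [Fact.argList] using hi
        refine ⟨f, hf, _, List.getElem_mem hi', ?_⟩
        simpa [hf, hi'] using h
      · rintro ⟨f, hf, c, hc, h⟩
        obtain ⟨i, hi, rfl⟩ := List.getElem_of_mem hc
        have hi' : i < S.arity f.pred := by simpa [Fact.argList] using hi
        refine ⟨i, ?_, ⟨n, f, hf, by simp [put], by simpa using hi'⟩, ?_⟩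
        · have := hC f.pred
          simp
          omega
        · simpa [hf, hi] using h
    · intro s fs μ hμ
      constructor
      · rintro ⟨n, -, f, hf, c, hc, h⟩
        exact ⟨c, ⟨f, List.mem_of_getElem? hf, hc⟩, h⟩
      · rintro ⟨c, ⟨f, hf, hc⟩, h⟩
        obtain ⟨n, hn, rfl⟩ := List.getElem_of_mem hf
        exact ⟨n, hn, _, List.getElem?_eq_getElem hn, c, hc, h⟩

end FactTape

namespace FactTape

open CQA StackProg Polynomial

variable {S : Signature} {V C : ℕ} {Out : Type}

/-! ### Rounds of updates -/

/-- The working marks, except for the one that counts rounds, are not in use. -/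
structure Clean (μ : ℕ → Mark V → Bool) : Prop where
  cur : ∀ j, μ j (.base .cur) = false
  new : ∀ j, μ j .new = false
  rel : ∀ j, μ j .rel = false
  var : ∀ j x, μ j (.var x) = false

theorem Clean.env {μ : ℕ → Mark V → Bool} (h : Clean μ) (ρ : Var → ℕ) (s : Subst)
    (fs : List (Fact S)) : Env C ∅ ρ s fs μ :=
  ⟨fun _ hx => hx.elim, fun _ _ _ j => h.var j _, h.rel⟩

/-- The interpretation of the marks when the current fact is `f`. -/
def interp (fs : List (Fact S)) (μ : ℕ → Mark V → Bool) (f : Fact S) : Base → Set (Fact S) :=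
  Function.update (factsOf fs μ) .cur {f}

theorem factsOf_put_cur {fs : List (Fact S)} {μ : ℕ → Mark V → Bool} {i : ℕ} {f : Fact S}
    (hf : fs[i]? = some f) : factsOf fs (put (.base .cur) i μ) = interp fs μ f := by
  funext b
  by_cases hb : b = .cur
  · subst hb
    ext g
    simp only [factsOf, put, Function.update_self, decide_eq_true_eq, Set.mem_ofPred_eq, interp,
      Set.mem_singleton_iff]
    constructor
    · rintro ⟨j, hg, rfl⟩
      exact Option.some.inj (hg.symm.trans hf)
    · rintro rfl
      exact ⟨i, hf, rfl⟩
  · simp [interp, factsOf, put, hb]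

/-- Satisfaction of a closed formula. -/
def Form.Holds (φ : Form S) (I : Base → Set (Fact S)) (A : Set Const) : Prop :=
  φ.Sat I A fun _ => []

/-- The formula holds when the `j`-th fact is the current one. -/
def HoldsAt (φ : Form S) (fs : List (Fact S)) (μ : ℕ → Mark V → Bool) (j : ℕ) : Prop :=
  ∃ f, fs[j]? = some f ∧ φ.Holds (interp fs μ f) (adom fs)

/-- The marks after a round: the mark `set` is updated as `g` prescribes, depending on its old
value and on whether the formula holds for the fact. -/
noncomputable def stepMarks (φ : Form S) (g : Bool → Bool → Bool) (fs : List (Fact S))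
    (μ : ℕ → Mark V → Bool) : ℕ → Mark V → Bool :=
  fun j => Function.update (μ j) (.base .set) (g (μ j (.base .set)) (truth (HoldsAt φ fs μ j)))

/-- One round of updates. -/
noncomputable def roundProg (φ : Form S) (g : Bool → Bool → Bool) : Prg S V C Out :=
  .seq (setFlag false) <|
  .seq (forEach (.base .cur) <| .seq (comp φ fun _ => 0) <|
    .seq (mapMarks fun b m => if m (.base .cur) then Function.update m .new b else m)
      (setFlag false))
  (mapMarks fun _ m => Function.update (Function.update m (.base .set) (g (m (.base .set)) (m .new)))
    .new false)

/-- All facts must be judged by the same old values of `set`. The verdicts are therefore collected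
in `new`, which formulas cannot see, and transferred to `set` by one final sweep. -/
theorem exists_runs_roundProg (hC : ∀ p, S.arity p + 2 ≤ C) (φ : Form S) (hφ : φ.WF ∅)
    (hV : φ.maxVar ≤ V) (g : Bool → Bool → Bool) :
    ∃ P : ℕ[X], ∀ (fs : List (Fact S)) (μ : ℕ → Mark V → Bool) (b : Bool), Clean μ →
      Runs (roundProg (C := C) (Out := Out) φ g) fs (μ, b) (stepMarks φ g fs μ, false)
        (P.eval (size fs)) := by
  obtain ⟨P, hP⟩ := decides_comp (Out := Out) hC φ (fun _ => 0) ∅ hφ hV (by simp)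
  refine ⟨X * (P + 4 * X + 3 + (X * 4 + 3) + 2) + (X * 4 + 3) + 2 + (X * 4 + 2) + 1,
    fun fs μ b hμ => ?_⟩
  have h1 := runs_forEach (C := C) (Out := Out) (.base .cur) (.seq (comp φ fun _ => 0) <|
      .seq (mapMarks fun b m => if m (.base .cur) then Function.update m .new b else m)
        (setFlag false)) fs
    (fun i => (fun j => Function.update (μ j) .new (truth (j < i ∧ HoldsAt φ fs μ j)), false))
    (P.eval (size fs) + 4 * size fs + 3) (fun i _ j => by simp [hμ.cur]) (fun i hi => ?_)
  · have e : (fun j => Function.update (μ j) .new (truth (j < 0 ∧ HoldsAt φ fs μ j))) = μ := by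
      funext j
      rw [truth_eq_false.2 (by simp), ← hμ.new j, Function.update_eq_self]
    beta_reduce at h1
    rw [e] at h1
    have h2 := (runs_setFlag false fs (μ, b)).seq (h1.seq (runs_mapMarks (fun _ m =>
      Function.update (Function.update m (.base .set) (g (m (.base .set)) (m .new))) .new false)
      fs _))
    have e' : (fun j => Function.update (Function.update
        (Function.update (μ j) .new (truth (j < fs.length ∧ HoldsAt φ fs μ j))) (.base .set)
        (g (Function.update (μ j) .new (truth (j < fs.length ∧ HoldsAt φ fs μ j)) (.base .set))
          (Function.update (μ j) .new (truth (j < fs.length ∧ HoldsAt φ fs μ j)) .new)))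
        .new false) = stepMarks φ g fs μ := by
      funext j
      have e : (j < fs.length ∧ HoldsAt φ fs μ j) ↔ HoldsAt φ fs μ j := by
        refine and_iff_right_of_imp ?_
        rintro ⟨f, hf, -⟩
        exact (List.getElem?_eq_some_iff.1 hf).1
      rw [truth_congr e]
      funext k
      by_cases hk : k = .new
      · subst hk
        simp [hμ.new, stepMarks]
      · by_cases hk' : k = .base .set
        · subst hk'
          simp [stepMarks]
        · simp [hk, hk', stepMarks]
    beta_reduce at h2
    rw [e'] at h2
    exact h2.mono (by simp; omega)
  · obtain ⟨f, hf⟩ : ∃ f, fs[i]? = some f := ⟨_, List.getElem?_eq_getElem hi⟩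
    -- The verdicts already stored in `new` do not affect the interpretation of formulas.
    have hfacts : ∀ c : ℕ → Bool,
        factsOf fs (put (.base .cur) i fun j => Function.update (μ j) .new (c j)) =
          interp fs μ f := by
      intro c
      rw [factsOf_put_cur hf]
      unfold interp factsOf
      congr 1
    have h2 := hP (fun _ => []) fs (put (.base .cur) i fun j =>
      Function.update (μ j) .new (truth (j < i ∧ HoldsAt φ fs μ j))) false
      ⟨fun _ hx => hx.elim, fun x _ _ j => by simp [put, varMark, hμ.var],
        fun j => by simp [put, hμ.rel]⟩
    simp only [hfacts] at h2
    have hh : φ.Sat (interp fs μ f) (adom fs) (fun _ => []) ↔ HoldsAt φ fs μ i := by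
      simp [HoldsAt, hf, Form.Holds]
    rw [truth_congr hh] at h2
    refine (h2.seq ((runs_mapMarks _ fs _).seq (a'' := _) ?_)).mono (T := P.eval (size fs) +
      (size fs * 4 + 2 + 1)) (by omega)
    convert runs_setFlag (C := C) (Out := Out) false fs _ using 2
    funext j k
    by_cases hj : j = i
    · subst hj
      by_cases hk : k = .new
      · subst hk
        simp [put]
      · by_cases hk' : k = .base .cur
        · subst hk'
          simp [put]
        · simp [put, hk, hk']
    · have e : j < i + 1 ↔ j < i := by omega
      simp [put, hj, e]

/-- As many rounds of updates as there are facts. -/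
noncomputable def iterProg (φ : Form S) (g : Bool → Bool → Bool) : Prg S V C Out :=
  .seq (setFlag false) (forEach .round (roundProg φ g))

theorem Clean.stepMarks {φ : Form S} {g : Bool → Bool → Bool} {fs : List (Fact S)}
    {μ : ℕ → Mark V → Bool} (h : Clean μ) : Clean (stepMarks φ g fs μ) :=
  ⟨fun j => by simp [FactTape.stepMarks, h.cur], fun j => by simp [FactTape.stepMarks, h.new],
    fun j => by simp [FactTape.stepMarks, h.rel], fun j x => by simp [FactTape.stepMarks, h.var]⟩

theorem Clean.iterate {φ : Form S} {g : Bool → Bool → Bool} {fs : List (Fact S)}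
    {μ : ℕ → Mark V → Bool} (h : Clean μ) (n : ℕ) : Clean ((FactTape.stepMarks φ g fs)^[n] μ) := by
  induction n with
  | zero => exact h
  | succ n ih =>
    rw [Function.iterate_succ_apply']
    exact ih.stepMarks

theorem iterate_stepMarks_of_ne {φ : Form S} {g : Bool → Bool → Bool} {fs : List (Fact S)}
    {μ : ℕ → Mark V → Bool} (n j : ℕ) {k : Mark V} (hk : k ≠ .base .set) :
    (stepMarks φ g fs)^[n] μ j k = μ j k := by
  induction n with
  | zero => rfl
  | succ n ih =>
    rw [Function.iterate_succ_apply', stepMarks, Function.update_of_ne hk, ih]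

/-- Formulas see only the marks of type `Base`, so the mark that counts rounds cannot influence an
update. -/
theorem stepMarks_put_round (φ : Form S) (g : Bool → Bool → Bool) (fs : List (Fact S)) (i : ℕ)
    (μ : ℕ → Mark V → Bool) :
    stepMarks φ g fs (put .round i μ) = put .round i (stepMarks φ g fs μ) := by
  funext j
  have e : HoldsAt φ fs (put .round i μ) j ↔ HoldsAt φ fs μ j := by
    unfold HoldsAt interp
    rw [factsOf_put (by simp)]
  have e' : put .round i μ j (.base .set) = μ j (.base .set) := by simp [put]
  simp only [stepMarks, truth_congr e, e']
  exact Function.update_comm (by simp) _ _ _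

/-- The list is its own clock: `round` walks over it once, which gives `fs.length` rounds. -/
theorem exists_runs_iterProg (hC : ∀ p, S.arity p + 2 ≤ C) (φ : Form S) (hφ : φ.WF ∅)
    (hV : φ.maxVar ≤ V) (g : Bool → Bool → Bool) :
    ∃ P : ℕ[X], ∀ (fs : List (Fact S)) (μ : ℕ → Mark V → Bool) (b : Bool), Clean μ →
      (∀ j, μ j .round = false) →
      Runs (iterProg (C := C) (Out := Out) φ g) fs (μ, b)
        ((stepMarks φ g fs)^[fs.length] μ, false) (P.eval (size fs)) := by
  obtain ⟨P, hP⟩ := exists_runs_roundProg (Out := Out) hC φ hφ hV g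
  refine ⟨X * (P + (X * 4 + 3) + 2) + (X * 4 + 3) + 3, fun fs μ b hμ hr => ?_⟩
  have hround : ∀ i j, (stepMarks φ g fs)^[i] μ j .round = false := fun i j => by
    rw [iterate_stepMarks_of_ne _ _ (by simp), hr]
  have h1 := runs_forEach (C := C) (Out := Out) .round (roundProg φ g) fs
    (fun i => ((stepMarks φ g fs)^[i] μ, false)) (P.eval (size fs)) (fun i _ j => hround i j)
    (fun i hi => ?_)
  · exact ((runs_setFlag false fs _).seq h1).mono (by simp; omega)
  · have hc : Clean ((stepMarks φ g fs)^[i] μ) := hμ.iterate i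
    have hc' : Clean (put .round i ((stepMarks φ g fs)^[i] μ)) :=
      ⟨fun j => by simp [put, hc.cur], fun j => by simp [put, hc.new],
        fun j => by simp [put, hc.rel], fun j x => by simp [put, hc.var]⟩
    have h2 := hP fs _ false hc'
    rw [stepMarks_put_round] at h2
    simpa only [Function.iterate_succ_apply'] using h2

theorem factsOf_stepMarks_of_ne {φ : Form S} {g : Bool → Bool → Bool} {fs : List (Fact S)}
    {μ : ℕ → Mark V → Bool} {b : Base} (hb : b ≠ .set) :
    factsOf fs (stepMarks φ g fs μ) b = factsOf fs μ b := by
  simp [factsOf, stepMarks, hb]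

/-! ### Reading the input and writing the output -/

/-- The marks of the facts of the input. -/
def initMarks (V : ℕ) (s : Bool) : Mark V → Bool :=
  fun k => decide (k = .base (if s then .sub else .db))

/-- The control state after reading a letter of the input. -/
def readCtl (v : Ctl S V C) : Option (Letter S) → Ctl S V C
  | some (.pred p) => { v with buf := some (.pred p (initMarks V v.sel)) }
  | some (.bit b) => { v with buf := some (.bit b) }
  | some .arg => { v with buf := some .arg }
  | some .sep => { v with sel := true }
  | none => v

/-- Reads the input. -/
def readProg : Prg S V C Out :=
  .seq (.drain .inp (.ops [.pop .inp readCtl,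
    .push .tmp (fun v => v.buf.isSome) fun v => v.buf.getD .arg,
    .load fun v => { v with buf := none }]))
  (.seq (.ops [.load fun v => { v with sel := false }]) restore)

/-- The effect of a letter of the input. -/
def readLetter (V : ℕ) (x : Bool × List (MLetter S V)) : Letter S → Bool × List (MLetter S V)
  | .pred p => (x.1, .pred p (initMarks V x.1) :: x.2)
  | .bit b => (x.1, .bit b :: x.2)
  | .arg => (x.1, .arg :: x.2)
  | .sep => (true, x.2)

theorem foldl_readLetter_args (x : Bool × List (MLetter S V)) (l : List Const) :
    (l.flatMap fun c => Letter.arg :: c.map Letter.bit).foldl (readLetter V) x =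
      (x.1, (l.flatMap fun c => MLetter.arg :: c.map MLetter.bit).reverse ++ x.2) := by
  have hbits : ∀ (c : Const) (x : Bool × List (MLetter S V)),
      (c.map Letter.bit).foldl (readLetter V) x = (x.1, (c.map MLetter.bit).reverse ++ x.2) := by
    intro c
    induction c with
    | nil => intro x; rfl
    | cons b c ih => intro x; simp [ih, readLetter]
  induction l generalizing x with
  | nil => rfl
  | cons c l ih => simp [ih, hbits, readLetter]

theorem foldl_readLetter (s : Bool) (t : List (MLetter S V)) (fs : List (Fact S)) :
    (fs.flatMap encodeFact).foldl (readLetter V) (s, t) =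
      (s, (enc fs fun _ => initMarks V s).reverse ++ t) := by
  induction fs generalizing t with
  | nil => rfl
  | cons f fs ih =>
    rw [List.flatMap_cons, List.foldl_append, encodeFact, List.foldl_cons, foldl_readLetter_args]
    simp only [readLetter]
    rw [ih]
    simp [enc, markedFact]

theorem single_inp (v : Ctl S V C) (l : List (Letter S)) :
    single (Γ := Gam S V Out) v .inp l = ⟨v, tapes l [] [] [] fun _ => []⟩ := by
  unfold single
  congr 1
  funext k
  cases k <;> rfl

theorem single_out (v : Ctl S V C) (l : List Out) :
    single (Γ := Gam S V Out) v .out l = ⟨v, tapes [] l [] [] fun _ => []⟩ := by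
  unfold single
  congr 1
  funext k
  cases k <;> rfl

/-- The separator is not stored. It only switches the mark given to the facts that follow from `db`
to `sub`. -/
theorem within_readProg (l : List (Letter S)) (m : List (MLetter S V)) (s : Bool)
    (h : l.foldl (readLetter V) (false, []) = (s, m.reverse)) (hm : m.length ≤ l.length) :
    Within (readProg (C := C) (Out := Out)) (single (Γ := Gam S V Out) {} .inp l)
      (work {} m [] fun _ => [])
      (l.length * 4 + 3) := by
  have h1 := Within.drain (p := .ops [.pop .inp readCtl,
    .push .tmp (fun v => v.buf.isSome) fun v => v.buf.getD .arg,
    .load fun v => { v with buf := none }])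
    (k := Stack.inp) (T := 1)
    (fun l x => (⟨{ sel := x.1 }, tapes (Out := Out) l [] [] x.2 fun _ => []⟩ :
      St (Gam S V Out) (Ctl S V C))) (readLetter V)
    (fun _ _ => rfl) (fun a l x => Within.ops _ ?_) l (false, [])
  · rw [h] at h1
    have h2 := within_restore (C := C) (Out := Out) (V := V) (S := S) {} rfl m.reverse []
      (fun _ => [])
    rw [List.reverse_reverse, List.append_nil, List.length_reverse] at h2
    rw [single_inp]
    exact (h1.seq ((Within.ops _ rfl).seq h2)).mono (by omega)
  · cases a <;> simp [Op.app, readCtl, readLetter]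

/-- The initial marks of the facts of a pair of databases, the first of which has `n` facts. -/
def pairMarks (V n : ℕ) : ℕ → Mark V → Bool := fun i => initMarks V (decide (n ≤ i))

theorem within_readProg_pair (D D' : Database S) :
    Within (readProg (V := V) (C := C) (Out := Out))
      (single (Γ := Gam S V Out) {} .inp (encodePair (D, D')))
      (conc (D.list ++ D'.list) (pairMarks V D.list.length, false))
      ((encodePair (D, D')).length * 4 + 3) := by
  refine within_readProg _ _ true ?_ (by simp [encodePair, encodeDatabase, size])
  simp only [encodePair, encodeDatabase, List.foldl_append, List.foldl_cons, foldl_readLetter,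
    enc_append, readLetter]
  simp only [List.append_nil, Prod.mk.injEq, true_and, List.reverse_append]
  congr 2
  · exact enc_congr _ fun i _ => by simp [pairMarks]
  · exact enc_congr _ fun i hi => by simp [pairMarks, Nat.not_le.2 hi]

theorem within_readProg_single (D : Database S) :
    Within (readProg (V := V) (C := C) (Out := Out))
      (single (Γ := Gam S V Out) {} .inp (encodeDatabase D))
      (conc D.list (fun _ => initMarks V false, false)) ((encodeDatabase D).length * 4 + 3) := by
  refine within_readProg _ _ false ?_ (by simp [encodeDatabase, size])
  rw [encodeDatabase, foldl_readLetter, List.append_nil]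

/-- Outputs the flag. -/
def answerProg : Prg S V C Bool :=
  .seq (.drain .main (.ops [.pop .main fun v _ => v]))
    (.ops [.push .out (fun _ => true) fun v => v.flag])

theorem within_answerProg (fs : List (Fact S)) (a : AState V) :
    Within (answerProg (C := C)) (conc fs a) (single (Γ := Gam S V Bool) { flag := a.2 } .out [a.2])
      (size fs * 2 + 2) := by
  have h1 := Within.drain (p := .ops [.pop .main fun v _ => v])
    (k := Stack.main) (T := 1)
    (fun l _ => work (Out := Bool) (C := C) { flag := a.2 } l [] fun _ => []) (fun x _ => x)
    (fun _ _ => rfl) (fun b l x => Within.ops _ (by simp [Op.app, work])) (enc fs a.1) ()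
  rw [length_enc] at h1
  rw [single_out]
  exact (h1.seq (Within.ops _ (by simp [Op.app, work]))).mono (by omega)

/-- A decision problem for pairs of databases is in PTIME if a program solves it in polynomial
time. -/
theorem inPTIME_of_runs {Q : Database S × Database S → Prop} (p : Prg S V C Bool)
    (h : ∃ P : ℕ[X], ∀ D D' : Database S, ∃ μ, Runs p (D.list ++ D'.list)
      (pairMarks V D.list.length, false) (μ, truth (Q (D, D')))
      (P.eval (size (D.list ++ D'.list)))) :
    InPTIME encodePair Q := by
  obtain ⟨P, hP⟩ := h
  refine ⟨fun I => truth (Q I), fun I => truth_eq_true, ?_⟩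
  refine computableInPTIME_of_within (Γ := Gam S V Bool) (σ := Ctl S V C) (k₀ := Stack.inp)
    (k₁ := Stack.out) (.seq readProg (.seq p answerProg)) {} (P + 6 * X + 5) ?_
  rintro ⟨D, D'⟩
  obtain ⟨μ, hμ⟩ := hP D D'
  have hsize : size (D.list ++ D'.list) ≤ (encodePair (D, D')).length := by
    simp [size, encodePair, encodeDatabase]
  refine ⟨_, ((within_readProg_pair D D').seq (Within.seq hμ (within_answerProg _ _))).mono ?_⟩
  -- Polynomials with natural coefficients are monotone, so a bound in the size of the list is a
  -- bound in the length of the input.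
  have hmono : P.eval (size (D.list ++ D'.list)) ≤ P.eval (encodePair (D, D')).length := by
    simp only [Polynomial.eval_eq_sum, Polynomial.sum]
    gcongr
  simp only [eval_add, eval_mul, eval_ofNat, eval_X]
  omega

/-- The control state after reading a letter for the output. -/
def writeCtl (v : Ctl S V C) : Option (MLetter S V) → Ctl S V C
  | some (.pred p m) => { v with sel := m (.base .set), buf := some (.pred p m) }
  | o => { v with buf := o }

/-- The letter of the output that a letter stands for. -/
def MLetter.toLetter : MLetter S V → Letter S
  | .pred p _ => .pred p
  | .bit b => .bit b
  | .arg => .arg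

/-- Outputs the facts that carry the mark `set`. -/
def writeProg : Prg S V C (Letter S) :=
  .seq (.drain .main (.ops [.pop .main writeCtl,
    .push .tmp (fun v => v.sel) fun v => v.buf.getD .arg, .load fun v => { v with buf := none }])) <|
  .drain .tmp (.ops [.pop .tmp fun v o => { v with buf := o },
    .push .out (fun _ => true) fun v => (v.buf.getD .arg).toLetter])

/-- The effect of a letter on the selection bit and the auxiliary list. -/
def writeLetter (x : Bool × List (MLetter S V)) (a : MLetter S V) : Bool × List (MLetter S V) :=
  match a with
  | .pred p m => (m (.base .set), if m (.base .set) then .pred p m :: x.2 else x.2)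
  | a => (x.1, if x.1 then a :: x.2 else x.2)

theorem foldl_writeLetter_args (x : Bool × List (MLetter S V)) (l : List Const) :
    (l.flatMap fun c => MLetter.arg :: c.map MLetter.bit).foldl writeLetter x =
      (x.1, if x.1 then (l.flatMap fun c => MLetter.arg :: c.map MLetter.bit).reverse ++ x.2
        else x.2) := by
  have hbits : ∀ (c : Const) (x : Bool × List (MLetter S V)),
      (c.map MLetter.bit).foldl writeLetter x =
        (x.1, if x.1 then (c.map MLetter.bit).reverse ++ x.2 else x.2) := by
    intro c
    induction c with
    | nil => intro x; simp
    | cons b c ih =>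
      rintro ⟨s, t⟩
      cases s <;> simp [ih, writeLetter]
  induction l generalizing x with
  | nil => simp
  | cons c l ih =>
    obtain ⟨s, t⟩ := x
    cases s <;> simp [ih, hbits, writeLetter]

/-- A predicate letter decides whether it and the following argument letters are kept. By `h` the
decision depends on the fact alone, so repeated facts are treated alike and the output is a filtered
list. -/
theorem foldl_writeLetter (p : Fact S → Bool) (fs : List (Fact S)) (μ : ℕ → Mark V → Bool)
    (h : ∀ i f, fs[i]? = some f → μ i (.base .set) = p f) (s : Bool) (t : List (MLetter S V)) :
    ∃ s' t', (enc fs μ).foldl writeLetter (s, t) = (s', t' ++ t) ∧ t'.length ≤ size fs ∧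
      t'.reverse.map MLetter.toLetter = (fs.filter p).flatMap encodeFact := by
  induction fs generalizing μ s t with
  | nil => exact ⟨s, [], by simp [enc, size]⟩
  | cons f fs ih =>
    have hp : μ 0 (.base .set) = p f := h 0 f rfl
    have hsize : size (f :: fs) = (encodeFact f).length + size fs := by simp [size]
    have hmap : (markedFact f (μ 0)).map MLetter.toLetter = encodeFact f := by
      simp [markedFact, encodeFact, MLetter.toLetter, List.map_flatMap, Function.comp_def]
    have hfact : (markedFact f (μ 0)).foldl writeLetter (s, t) =
        (p f, if p f then (markedFact f (μ 0)).reverse ++ t else t) := by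
      simp only [markedFact, List.foldl_cons, writeLetter, hp, foldl_writeLetter_args]
      cases p f <;> simp
    obtain ⟨s', t', h1, h2, h3⟩ := ih (fun j => μ (j + 1)) (fun i f' hf' => h (i + 1) f'
      (by simpa using hf')) (p f) (if p f then (markedFact f (μ 0)).reverse ++ t else t)
    rw [enc, List.foldl_append, hfact, h1]
    cases hpf : p f with
    | false =>
      exact ⟨s', t', by simp, by omega, by simpa [hpf] using h3⟩
    | true =>
      refine ⟨s', t' ++ (markedFact f (μ 0)).reverse, by simp, ?_, ?_⟩
      · simp [length_markedFact]
        omega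
      · simp only [List.reverse_append, List.reverse_reverse, List.map_append, hmap, h3, hpf,
          List.filter_cons_of_pos, List.flatMap_cons]

theorem within_writeProg (p : Fact S → Bool) (fs : List (Fact S)) (a : AState V)
    (h : ∀ i f, fs[i]? = some f → a.1 i (.base .set) = p f) :
    ∃ v, Within (writeProg (C := C)) (conc fs a)
      (single (Γ := Gam S V (Letter S)) v .out ((fs.filter p).flatMap encodeFact))
      (size fs * 4 + 2) := by
  have h1 := Within.drain (p := (.ops [.pop .main writeCtl, .push .tmp (fun v => v.sel)
    fun v => v.buf.getD .arg, .load fun v => { v with buf := none }] : Prg S V C (Letter S)))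
    (k := Stack.main) (T := 1)
    (fun l x => work (Out := Letter S) (C := C) { flag := a.2, sel := x.1 } l x.2 fun _ => [])
    writeLetter (fun _ _ => rfl) (fun b l x => Within.ops _ ?_) (enc fs a.1) (false, [])
  · obtain ⟨s, t, hst, ht, ht'⟩ := foldl_writeLetter p fs a.1 h false []
    rw [hst, length_enc, List.append_nil] at h1
    have h2 := Within.drain (p := .ops [.pop .tmp fun v o => { v with buf := o },
      .push .out (fun _ => true) fun v => (v.buf.getD .arg).toLetter])
      (k := Stack.tmp) (T := 1)
      (fun l (x : Option (MLetter S V) × List (Letter S)) =>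
        (⟨{ flag := a.2, sel := s, buf := x.1 }, tapes [] x.2 [] l fun _ => []⟩ :
          St (Gam S V (Letter S)) (Ctl S V C)))
      (fun x b => (some b, b.toLetter :: x.2))
      (fun _ _ => rfl) (fun b l x => Within.ops _ (by simp [Op.app])) t (none, [])
    have hfold : ∀ (t : List (MLetter S V)) (x : Option (MLetter S V) × List (Letter S)),
        (t.foldl (fun x b => (some b, b.toLetter :: x.2)) x).2 =
          t.reverse.map MLetter.toLetter ++ x.2 := by
      intro t
      induction t with
      | nil => intro x; rfl
      | cons b t ih => intro x; simp [ih]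
    rw [hfold, ht', List.append_nil] at h2
    refine ⟨_, (single_out (V := V) (C := C) (S := S) _ _).symm ▸
      (h1.seq (h2.mono (T' := size fs * 2 + 1) (by omega))).mono (by omega)⟩
  · obtain ⟨s, t⟩ := x
    cases b <;> cases s <;> simp [Op.app, work, writeCtl, writeLetter]
    all_goals split_ifs <;> simp_all

end FactTape

/-! ### Repairs, independently of machines -/

namespace CQA

variable {S : Signature}

/-! ### Dependencies and variables -/

theorem Term.eval_congr {s s' : Subst} (t : Term) (h : ∀ x ∈ t.vars, s x = s' x) :
    t.eval s = t.eval s' := by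
  cases t with
  | var x => exact h x rfl
  | const c => rfl

theorem Atom.inst_congr {s s' : Subst} (a : Atom S) (h : ∀ x ∈ a.vars, s x = s' x) :
    a.inst s = a.inst s' := by
  simp only [Atom.inst, Fact.mk.injEq, heq_eq_eq, true_and]
  funext i
  exact Term.eval_congr _ fun x hx => h x (Set.mem_iUnion_of_mem i hx)

theorem Conj.vars_of_mem_atoms {g : Conj S} {a : Atom S} (ha : a ∈ g.atoms) : a.vars ⊆ g.vars :=
  fun _ hx => Or.inl (Set.mem_biUnion ha hx)

theorem Conj.vars_of_mem_ineqs {g : Conj S} {e : Term × Term} (he : e ∈ g.ineqs) :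
    e.1.vars ∪ e.2.vars ⊆ g.vars :=
  fun _ hx => Or.inr (Set.mem_biUnion (t := fun e : Term × Term => e.1.vars ∪ e.2.vars) he hx)

theorem Conj.isInstantiation_congr {s s' : Subst} {g : Conj S} {D : Set (Fact S)}
    (h : ∀ x ∈ g.vars, s x = s' x) (hs : g.IsInstantiation s D) : g.IsInstantiation s' D := by
  refine ⟨fun a ha => ?_, fun e he => ?_⟩
  · rw [← a.inst_congr fun x hx => h x (Conj.vars_of_mem_atoms ha hx)]
    exact hs.1 a ha
  · rw [← e.1.eval_congr fun x hx => h x (Conj.vars_of_mem_ineqs he (Or.inl hx)),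
      ← e.2.eval_congr fun x hx => h x (Conj.vars_of_mem_ineqs he (Or.inr hx))]
    exact hs.2 e he

theorem Conj.IsInstantiation.mono {s : Subst} {g : Conj S} {D D' : Set (Fact S)}
    (h : g.IsInstantiation s D) (hD : D ⊆ D') : g.IsInstantiation s D' :=
  ⟨fun a ha => hD (h.1 a ha), h.2⟩

theorem Dependency.HeadHolds.mono {t : Dependency S} {s : Subst} {D D' : Set (Fact S)}
    (h : t.HeadHolds s D) (hD : D ⊆ D') : t.HeadHolds s D' := by
  obtain ⟨q, hq, s', hs', h⟩ := h
  exact ⟨q, hq, s', hs', h.mono hD⟩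

theorem Dependency.HeadHolds.congr {t : Dependency S} {s s' : Subst} {D : Set (Fact S)}
    (h : t.HeadHolds s D) (hs : ∀ x ∈ t.body.vars, s x = s' x) : t.HeadHolds s' D := by
  obtain ⟨q, hq, r, hr, h⟩ := h
  exact ⟨q, hq, r, fun x hx => (hr x hx).trans (hs x hx), h⟩

theorem Term.finite_vars (t : Term) : t.vars.Finite := by
  cases t with
  | var x => exact Set.finite_singleton x
  | const c => exact Set.finite_empty

theorem Conj.finite_vars (g : Conj S) : g.vars.Finite := by
  refine Set.Finite.union ?_ ?_
  · exact (List.finite_toSet g.atoms).biUnion fun a _ =>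
      Set.finite_iUnion fun i => (a.args i).finite_vars
  · exact (List.finite_toSet g.ineqs).biUnion fun e _ => e.1.finite_vars.union e.2.finite_vars

theorem Conj.mem_argList_of_mem_atomVars {g : Conj S} {s : Subst} {D : Set (Fact S)}
    (h : g.IsInstantiation s D) {x : Var} (hx : x ∈ g.atomVars) :
    ∃ f ∈ D, s x ∈ List.ofFn f.args := by
  obtain ⟨a, ha, hx⟩ := Set.mem_iUnion₂.1 hx
  obtain ⟨i, hi⟩ := Set.mem_iUnion.1 hx
  refine ⟨_, h.1 a ha, (List.mem_ofFn' _ _).2 ⟨i, ?_⟩⟩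
  simp only [Atom.inst]
  cases hti : a.args i with
  | var y =>
    rw [hti] at hi
    cases hi
    rfl
  | const c =>
    rw [hti] at hi
    exact hi.elim

theorem Dependency.body_vars (t : Dependency S) : t.body.vars = t.body.atomVars :=
  Set.union_eq_left.2 t.body_safe

/-! ### Repairs -/

theorem consistent_iff {T : Set (Dependency S)} {E : Set (Fact S)} :
    Consistent T E ↔ ¬ ∃ t ∈ T, ∃ s, t.body.IsInstantiation s E ∧ ¬ t.HeadHolds s E := by
  simp [Consistent, Dependency.Satisfied]

/-- A greatest element among the consistent subsets is the only maximal one. -/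
theorem isRepair_iff_eq {T : Set (Dependency S)} {F G : Set (Fact S)} (hG : G ⊆ F)
    (hc : Consistent T G) (hmax : ∀ E ⊆ F, Consistent T E → E ⊆ G) (R : Set (Fact S)) :
    IsRepair T F R ↔ R = G := by
  constructor
  · intro h
    have hRG := hmax R h.prop.1 h.prop.2
    exact hRG.antisymm (h.le_of_ge ⟨hG, hc⟩ hRG)
  · rintro rfl
    exact ⟨⟨hG, hc⟩, fun E hE _ => hmax E hE.1 hE.2⟩

/-- A consistent proper extension of `R` within `F` contains some new fact `f`, and then witnesses
that `insert f R` is weakly consistent. Maximality thus needs only one test per fact instead of a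
search through subsets. -/
theorem isRepair_iff {T : Set (Dependency S)} {F R : Set (Fact S)} :
    IsRepair T F R ↔ R ⊆ F ∧ Consistent T R ∧
      ∀ f ∈ F, f ∈ R ∨ ¬ WeaklyConsistent T F (insert f R) := by
  constructor
  · intro h
    refine ⟨h.prop.1, h.prop.2, fun f _ => ?_⟩
    by_contra! hf
    obtain ⟨hfR, E, hE, hEF, hc⟩ := hf
    exact hfR (h.le_of_ge ⟨hEF, hc⟩ ((Set.subset_insert f R).trans hE) (hE (Set.mem_insert f R)))
  · rintro ⟨hR, hc, h⟩
    refine ⟨⟨hR, hc⟩, fun E hE hRE f hf => ?_⟩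
    exact (h f (hE.1 hf)).resolve_right fun hn => hn ⟨E, Set.insert_subset hf hRE, hE.1, hE.2⟩

/-- A decreasing function reaches a fixed point after as many steps as the rank allows. -/
theorem iterate_fixed_of_rank {α : Type*} (g : α → α) (r : α → ℕ)
    (h : ∀ x, g x ≠ x → r (g x) < r x) (n : ℕ) (x : α) (hx : r x ≤ n) :
    g (g^[n] x) = g^[n] x := by
  induction n generalizing x with
  | zero =>
    by_contra hne
    have := h x hne
    omega
  | succ n ih =>
    rw [Function.iterate_succ_apply]
    by_cases hg : g x = x
    · have : ∀ m, g^[m] (g x) = x := fun m => by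
        rw [hg]
        exact Function.iterate_fixed hg m
      rw [this, hg]
    · refine ih _ ?_
      have := h x hg
      omega

/-! ### Linear dependencies: the greatest consistent subset -/

section Linear

variable {T : Set (Dependency S)}

theorem Dependency.IsLinear.exists_atom {t : Dependency S} (ht : t.IsLinear) :
    ∃ a, a ∈ t.body.atoms ∧ ∀ b ∈ t.body.atoms, b = a := by
  obtain ⟨a, ha⟩ := Set.ncard_eq_one.1 ht
  exact ⟨a, ha.symm.subset rfl, fun b hb => ha.subset hb⟩

/-- All predicate atoms of the body coincide, so one fact carries the instantiation; the
inequalities do not depend on the facts. -/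
theorem Dependency.IsLinear.isInstantiation_iff {t : Dependency S} (ht : t.IsLinear) {s : Subst}
    {E : Set (Fact S)} :
    t.body.IsInstantiation s E ↔ ∃ f ∈ E, t.body.IsInstantiation s {f} := by
  constructor
  · intro h
    obtain ⟨a, ha, ha'⟩ := ht.exists_atom
    exact ⟨_, h.1 a ha, fun b hb => by rw [ha' b hb]; rfl, h.2⟩
  · rintro ⟨f, hf, h⟩
    exact h.mono (Set.singleton_subset_iff.2 hf)

/-- The fact `f` matches the body of some dependency the head of which does not hold in `E`. -/
def Violates (T : Set (Dependency S)) (E : Set (Fact S)) (f : Fact S) : Prop :=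
  ∃ t ∈ T, ∃ s, t.body.IsInstantiation s {f} ∧ ¬ t.HeadHolds s E

/-- Removes all the facts that violate some dependency. -/
def removeViolations (T : Set (Dependency S)) (E : Set (Fact S)) : Set (Fact S) :=
  {f ∈ E | ¬ Violates T E f}

theorem removeViolations_subset (E : Set (Fact S)) : removeViolations T E ⊆ E :=
  Set.sep_subset _ _

theorem iterate_removeViolations_subset (E : Set (Fact S)) (n : ℕ) :
    (removeViolations T)^[n] E ⊆ E := by
  induction n with
  | zero => exact subset_rfl
  | succ n ih =>
    rw [Function.iterate_succ_apply']
    exact (removeViolations_subset _).trans ih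

theorem consistent_of_removeViolations_eq (hT : ∀ t ∈ T, t.IsLinear) {E : Set (Fact S)}
    (h : removeViolations T E = E) : Consistent T E := by
  rw [consistent_iff]
  rintro ⟨t, ht, s, hs, hn⟩
  obtain ⟨f, hf, hs⟩ := (hT t ht).isInstantiation_iff.1 hs
  exact (h.symm.subset hf).2 ⟨t, ht, s, hs, hn⟩

/-- A fact of `E` that matches a body has its head satisfied in `E`, hence in every larger set, so
no round removes it. -/
theorem subset_iterate_removeViolations {E F : Set (Fact S)} (hE : E ⊆ F) (hc : Consistent T E)
    (n : ℕ) : E ⊆ (removeViolations T)^[n] F := by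
  induction n with
  | zero => exact hE
  | succ n ih =>
    rw [Function.iterate_succ_apply']
    refine fun f hf => ⟨ih hf, ?_⟩
    rintro ⟨t, ht, s, hs, hn⟩
    exact hn ((hc t ht s (hs.mono (Set.singleton_subset_iff.2 hf))).mono ih)

/-- The iteration becomes stationary within `n` rounds. The fixed point is consistent because bodies
match single facts, and it contains all consistent subsets. -/
theorem isRepair_iff_iterate_removeViolations (hT : ∀ t ∈ T, t.IsLinear) {F : Set (Fact S)}
    (hF : F.Finite) {n : ℕ} (hn : F.ncard ≤ n) (R : Set (Fact S)) :
    IsRepair T F R ↔ R = (removeViolations T)^[n] F := by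
  refine isRepair_iff_eq (iterate_removeViolations_subset F n)
    (consistent_of_removeViolations_eq hT ?_)
    (fun E hE hc => subset_iterate_removeViolations hE hc n) R
  -- Cardinality is a useful rank only for finite sets, so the iteration is confined to the subsets
  -- of `F`.
  let r : {E : Set (Fact S) // E ⊆ F} → {E : Set (Fact S) // E ⊆ F} := fun E =>
    ⟨removeViolations T E, (removeViolations_subset _).trans E.2⟩
  have hr : ∀ m, (r^[m] ⟨F, subset_rfl⟩).1 = (removeViolations T)^[m] F := by
    intro m
    induction m with
    | zero => rfl
    | succ m ih => rw [Function.iterate_succ_apply', Function.iterate_succ_apply', ← ih]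
  have := iterate_fixed_of_rank r (fun E => E.1.ncard) (fun E hE => Set.ncard_lt_ncard
    ((removeViolations_subset _).ssubset_of_ne fun h => hE (Subtype.ext h)) (hF.subset E.2))
    n ⟨F, subset_rfl⟩ hn
  rw [← hr]
  exact congrArg Subtype.val this

theorem DeletionStep.subset {E E' : Set (Fact S)} (h : DeletionStep T E E') : E' ⊆ E := by
  obtain ⟨t, _, s, _, _, rfl⟩ := h
  exact Set.sdiff_subset

theorem DeletionStep.ssubset (hT : ∀ t ∈ T, t.IsLinear) {E E' : Set (Fact S)}
    (h : DeletionStep T E E') : E' ⊂ E := by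
  refine h.subset.ssubset_of_ne ?_
  obtain ⟨t, ht, s, hs, _, rfl⟩ := h
  obtain ⟨a, ha, -⟩ := (hT t ht).exists_atom
  intro he
  exact (he.symm.subset (hs.1 a ha)).2 ⟨a, ha, rfl⟩

/-- If the deleted fact were in `R`, it would instantiate the body there on its own. The head would
then hold in `R` and so in `E`, against the choice of the step. -/
theorem DeletionStep.subset_of_consistent (hT : ∀ t ∈ T, t.IsLinear) {E E' R : Set (Fact S)}
    (h : DeletionStep T E E') (hR : R ⊆ E) (hc : Consistent T R) : R ⊆ E' := by
  obtain ⟨t, ht, s, hs, hn, rfl⟩ := h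
  obtain ⟨a, ha, ha'⟩ := (hT t ht).exists_atom
  refine fun f hf => ⟨hR hf, ?_⟩
  rintro ⟨b, hb, rfl⟩
  refine hn ((hc t ht s ⟨fun c hc => ?_, hs.2⟩).mono hR)
  rw [ha' c hc, ← ha' b hb]
  exact hf

theorem consistent_of_not_deletionStep {E : Set (Fact S)} (h : ¬ ∃ E', DeletionStep T E E') :
    Consistent T E := by
  rw [consistent_iff]
  rintro ⟨t, ht, s, hs, hn⟩
  exact h ⟨_, t, ht, s, hs, hn, rfl⟩

/-- Three properties persist: the set stays within `F`, it has lost at least one fact per step, and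
it contains every consistent subset of `F`. -/
theorem deletion_sequence (hT : ∀ t ∈ T, t.IsLinear) {F : Set (Fact S)} (hF : F.Finite) (n : ℕ)
    (E : ℕ → Set (Fact S)) (h0 : E 0 = F) (h : ∀ i < n, DeletionStep T (E i) (E (i + 1))) :
    n ≤ F.ncard ∧ ((¬ ∃ E', DeletionStep T (E n) E') → ∀ R, IsRepair T F R ↔ R = E n) := by
  have key : ∀ i ≤ n, E i ⊆ F ∧ (E i).ncard + i ≤ F.ncard ∧
      ∀ R ⊆ F, Consistent T R → R ⊆ E i := by
    intro i
    induction i with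
    | zero =>
      intro _
      rw [h0]
      exact ⟨subset_rfl, le_rfl, fun R hR _ => hR⟩
    | succ i ih =>
      intro hi
      obtain ⟨h1, h2, h3⟩ := ih (by omega)
      have hs := h i hi
      have := Set.ncard_lt_ncard (hs.ssubset hT) (hF.subset h1)
      exact ⟨hs.subset.trans h1, by omega, fun R hR hc => hs.subset_of_consistent hT (h3 R hR hc) hc⟩
  obtain ⟨h1, h2, h3⟩ := key n le_rfl
  exact ⟨by omega, fun hn => isRepair_iff_eq h1 (consistent_of_not_deletionStep hn) h3⟩

end Linear

/-! ### Full dependencies: the chase and its truncation -/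

section Full

variable {T : Set (Dependency S)}

theorem Dependency.IsFull.unique {t : Dependency S} (ht : t.IsFull) {q q' : Conj S}
    (hq : q ∈ t.head) (hq' : q' ∈ t.head) : q = q' := by
  obtain ⟨r, hr⟩ := Set.ncard_eq_one.1 ht.1
  exact (hr.subset hq).trans (hr.subset hq').symm

/-- There is one disjunct and it has no existential variables, so a witness of the head agrees with
`s` on all variables that matter. -/
theorem Dependency.IsFull.isInstantiation {t : Dependency S} (ht : t.IsFull) {s : Subst}
    {E : Set (Fact S)} (h : t.HeadHolds s E) {q : Conj S} (hq : q ∈ t.head) :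
    q.IsInstantiation s E := by
  obtain ⟨q', hq', s', hs', h⟩ := h
  rw [ht.unique hq hq']
  exact Conj.isInstantiation_congr (fun x hx => hs' x (ht.2 q' hq' hx)) h

theorem Dependency.headHolds_of_isInstantiation {t : Dependency S} {s : Subst} {E : Set (Fact S)}
    {q : Conj S} (hq : q ∈ t.head) (h : q.IsInstantiation s E) : t.HeadHolds s E :=
  ⟨q, hq, s, fun _ _ => rfl, h⟩

/-- A consistent set above `D` is closed under the chase rules, and the rule for `⊥` never applies
in it. Conversely the chase itself is the consistent set sought. -/
theorem weaklyConsistent_iff_chase_subset (hT : ∀ t ∈ T, t.IsFull) {F D : Set (Fact S)}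
    (hF : botFact S ∉ F) : WeaklyConsistent T F D ↔ {f | Chase T D f} ⊆ F := by
  constructor
  · rintro ⟨E, hDE, hEF, hc⟩
    refine Set.Subset.trans ?_ hEF
    intro f hf
    induction hf with
    | base f hf => exact hDE hf
    | atom t ht s _ hi q hq a ha ih =>
      exact ((hT t ht).isInstantiation (hc t ht s ⟨ih, hi⟩) hq).1 a ha
    | bot t ht s _ hi q hq e he heq ih =>
      exact absurd heq (((hT t ht).isInstantiation (hc t ht s ⟨ih, hi⟩) hq).2 e he)
  · intro h
    refine ⟨_, fun f hf => Chase.base f hf, h, fun t ht s hs => ?_⟩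
    obtain ⟨q, hq⟩ := List.exists_mem_of_ne_nil _ t.head_nonempty
    refine Dependency.headHolds_of_isInstantiation hq ⟨fun a ha => ?_, fun e he heq => ?_⟩
    · exact Chase.atom t ht s hs.1 hs.2 q hq a ha
    -- An inequality made false would put `⊥` into the chase and hence into `F`.
    · exact hF (h (Chase.bot t ht s hs.1 hs.2 q hq e he heq))

/-- The fact `f` is an instantiated head atom for some instantiation of a body in `E`. -/
def Derives (T : Set (Dependency S)) (E : Set (Fact S)) (f : Fact S) : Prop :=
  ∃ t ∈ T, ∃ s, t.body.IsInstantiation s E ∧ ∃ q ∈ t.head, ∃ a ∈ q.atoms, a.inst s = f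

/-- Adds all the facts of `F` that are derived in one step. -/
def addDerived (T : Set (Dependency S)) (F E : Set (Fact S)) : Set (Fact S) :=
  E ∪ {f ∈ F | Derives T E f}

theorem iterate_addDerived_subset {F D E : Set (Fact S)} (hD : D ⊆ E)
    (h : ∀ f ∈ F, Derives T E f → f ∈ E) (n : ℕ) : (addDerived T F)^[n] D ⊆ E := by
  induction n with
  | zero => exact hD
  | succ n ih =>
    rw [Function.iterate_succ_apply']
    refine Set.union_subset ih ?_
    rintro f ⟨hf, t, ht, s, hs, hd⟩
    exact h f hf ⟨t, ht, s, hs.mono ih, hd⟩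

theorem subset_iterate_addDerived (F D : Set (Fact S)) (n : ℕ) : D ⊆ (addDerived T F)^[n] D := by
  induction n with
  | zero => exact subset_rfl
  | succ n ih =>
    rw [Function.iterate_succ_apply']
    exact ih.trans Set.subset_union_left

/-- Discarding derived facts outside `F` does no harm. If a consistent `E ⊆ F` contains `D`, it
contains the truncated closure; every head atom demanded by the closure then lies in `E`, hence in
`F`, and has been added, while the inequalities hold as they do for `E`. Conversely a consistent
closure is a witness by itself. -/
theorem weaklyConsistent_iff_consistent_iterate (hT : ∀ t ∈ T, t.IsFull) {F D : Set (Fact S)}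
    (hF : F.Finite) (hD : D ⊆ F) {n : ℕ} (hn : F.ncard ≤ n) :
    WeaklyConsistent T F D ↔ Consistent T ((addDerived T F)^[n] D) := by
  have hGF : (addDerived T F)^[n] D ⊆ F := iterate_addDerived_subset hD (fun f hf _ => hf) n
  constructor
  · rintro ⟨E, hDE, hEF, hc⟩
    have hGE : (addDerived T F)^[n] D ⊆ E := by
      refine iterate_addDerived_subset hDE ?_ n
      rintro f - ⟨t, ht, s, hs, q, hq, a, ha, rfl⟩
      exact ((hT t ht).isInstantiation (hc t ht s hs) hq).1 a ha
    have hfix : addDerived T F ((addDerived T F)^[n] D) = (addDerived T F)^[n] D := by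
      -- The rank is the number of facts of `F` still missing.
      refine iterate_fixed_of_rank _ (fun E => (F \ E).ncard) (fun E hE => ?_) n D
        ((Set.ncard_le_ncard Set.sdiff_subset hF).trans hn)
      refine Set.ncard_lt_ncard ?_ (hF.subset Set.sdiff_subset)
      obtain ⟨f, hf, hf'⟩ := Set.exists_of_ssubset
        (Set.subset_union_left.ssubset_of_ne (Ne.symm hE) : E ⊂ addDerived T F E)
      refine (Set.ssubset_iff_of_subset (Set.sdiff_subset_sdiff_right Set.subset_union_left)).2
        ⟨f, ⟨(hf.resolve_left hf').1, hf'⟩, fun h => h.2 hf⟩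
    intro t ht s hs
    obtain ⟨q, hq⟩ := List.exists_mem_of_ne_nil _ t.head_nonempty
    have hE := (hT t ht).isInstantiation (hc t ht s (hs.mono hGE)) hq
    refine Dependency.headHolds_of_isInstantiation hq ⟨fun a ha => ?_, hE.2⟩
    rw [← hfix]
    exact Or.inr ⟨hEF (hE.1 a ha), t, ht, s, hs, q, hq, a, ha, rfl⟩
  · intro hc
    exact ⟨_, subset_iterate_addDerived F D n, hGF, hc⟩

end Full

end CQA

namespace FactTape

open CQA

variable {S : Signature}

/-! ### Formulas for dependencies -/

/-- Conjunction over a list. -/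
def Form.all (l : List (Form S)) : Form S := l.foldr .and .tru

/-- Disjunction over a list. -/
def Form.any (l : List (Form S)) : Form S := .neg (.all (l.map .neg))

/-- Existential quantification over a list of variables. -/
def Form.exs (l : List Var) (φ : Form S) : Form S := l.foldr .ex φ

section Connectives

variable {I : Base → Set (Fact S)} {A : Set Const} {s : Subst} {X : Set Var}

theorem Form.sat_all {l : List (Form S)} : (Form.all l).Sat I A s ↔ ∀ φ ∈ l, φ.Sat I A s := by
  induction l with
  | nil => simp [Form.all, Form.Sat]
  | cons φ l ih => simpa [Form.all, Form.Sat] using fun _ => ih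

theorem Form.sat_any {l : List (Form S)} : (Form.any l).Sat I A s ↔ ∃ φ ∈ l, φ.Sat I A s := by
  simp [Form.any, Form.Sat, Form.sat_all]

theorem Form.sat_all_map {ι : Type*} {l : List ι} {f : ι → Form S} :
    (Form.all (l.map f)).Sat I A s ↔ ∀ i ∈ l, (f i).Sat I A s := by
  rw [Form.sat_all, List.forall_mem_map]

theorem Form.sat_any_map {ι : Type*} {l : List ι} {f : ι → Form S} :
    (Form.any (l.map f)).Sat I A s ↔ ∃ i ∈ l, (f i).Sat I A s := by
  simp [Form.sat_any, List.mem_map]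

/-- Nested quantifiers amount to one simultaneous change of the substitution, the form in which
dependencies are stated. -/
theorem Form.sat_exs {l : List Var} {φ : Form S} : (Form.exs l φ).Sat I A s ↔
    ∃ s', (∀ x ∉ l, s' x = s x) ∧ (∀ x ∈ l, s' x ∈ A) ∧ φ.Sat I A s' := by
  induction l generalizing s with
  | nil =>
    refine ⟨fun h => ⟨s, by simp, by simp, h⟩, ?_⟩
    rintro ⟨s', h, -, h'⟩
    rwa [show s' = s from funext fun x => h x (by simp)] at h'
  | cons x l ih =>
    constructor
    · rintro ⟨c, hc, h⟩
      obtain ⟨s', h1, h2, h3⟩ := ih.1 h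
      refine ⟨s', fun y hy => ?_, fun y hy => ?_, h3⟩
      · simp only [List.mem_cons, not_or] at hy
        rw [h1 y hy.2, Function.update_of_ne hy.1]
      · by_cases hyl : y ∈ l
        · exact h2 y hyl
        · obtain rfl : y = x := by simpa [hyl] using hy
          rw [h1 y hyl, Function.update_self]
          exact hc
    · rintro ⟨s', h1, h2, h3⟩
      refine ⟨s' x, h2 x (by simp), ih.2 ⟨s', fun y hy => ?_, fun y hy => h2 y (by simp [hy]), h3⟩⟩
      by_cases hyx : y = x
      · subst hyx
        rw [Function.update_self]
      · rw [Function.update_of_ne hyx, h1 y (by simp [hyx, hy])]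

theorem Form.wf_all {l : List (Form S)} (h : ∀ φ ∈ l, φ.WF X) : (Form.all l).WF X := by
  induction l with
  | nil => trivial
  | cons φ l ih => exact ⟨h φ (by simp), ih fun ψ hψ => h ψ (by simp [hψ])⟩

theorem Form.wf_any {l : List (Form S)} (h : ∀ φ ∈ l, φ.WF X) : (Form.any l).WF X :=
  Form.wf_all (X := X) fun ψ hψ => by
    obtain ⟨φ, hφ, rfl⟩ := List.mem_map.1 hψ
    exact h φ hφ

theorem Form.wf_exs {l : List Var} {φ : Form S} (hl : l.Nodup) (hX : ∀ x ∈ l, x ∉ X)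
    (h : φ.WF (X ∪ {x | x ∈ l})) : (Form.exs l φ).WF X := by
  induction l generalizing X with
  | nil => simpa [Form.exs] using h
  | cons x l ih =>
    obtain ⟨hx, hl⟩ := List.nodup_cons.1 hl
    refine ⟨hX x (by simp), ih hl (fun y hy hy' => ?_) ?_⟩
    · rcases hy' with rfl | hy'
      · exact hx hy
      · exact hX y (by simp [hy]) hy'
    · convert h using 1
      ext y
      simp only [Set.mem_union, Set.mem_insert_iff, Set.mem_ofPred_eq, List.mem_cons]
      tauto

end Connectives

open Classical in
/-- A list of the elements of a finite set. -/
noncomputable def listOf {α : Type*} (X : Set α) : List α :=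
  if h : X.Finite then h.toFinset.toList else []

theorem mem_listOf {α : Type*} {X : Set α} (h : X.Finite) {x : α} : x ∈ listOf X ↔ x ∈ X := by
  simp [listOf, h]

theorem nodup_listOf {α : Type*} (X : Set α) : (listOf X).Nodup := by
  unfold listOf
  split_ifs
  · exact Finset.nodup_toList _
  · exact List.nodup_nil

/-- The conjunction `g` holds for the facts that carry the mark `b`. -/
def conjForm (b : Base) (g : Conj S) : Form S :=
  .and (.all (g.atoms.map (.rel b))) (.all (g.ineqs.map fun e => .neg (.eq e.1 e.2)))

theorem sat_conjForm {b : Base} {g : Conj S} {I : Base → Set (Fact S)} {A : Set Const} {s : Subst} :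
    (conjForm b g).Sat I A s ↔ g.IsInstantiation s (I b) := by
  simp only [conjForm, Form.Sat, Form.sat_all_map, Conj.IsInstantiation, ne_eq]

theorem wf_conjForm {b : Base} {g : Conj S} {X : Set Var} (h : g.vars ⊆ X) :
    (conjForm b g).WF X := by
  refine ⟨Form.wf_all fun φ hφ => ?_, Form.wf_all fun φ hφ => ?_⟩
  · obtain ⟨a, ha, rfl⟩ := List.mem_map.1 hφ
    exact (Conj.vars_of_mem_atoms ha).trans h
  · obtain ⟨e, he, rfl⟩ := List.mem_map.1 hφ
    exact (Conj.vars_of_mem_ineqs he).trans h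

/-- Some instantiation of the body of `t` in the facts marked by `b` satisfies `φ`. -/
noncomputable def bodyForm (b : Base) (t : Dependency S) (φ : Form S) : Form S :=
  .exs (listOf t.body.vars) (.and (conjForm b t.body) φ)

theorem wf_bodyForm {b : Base} {t : Dependency S} {φ : Form S} (h : φ.WF t.body.vars) :
    (bodyForm b t φ).WF ∅ := by
  have e : ∅ ∪ {x | x ∈ listOf t.body.vars} = t.body.vars := by
    ext x
    simp [mem_listOf t.body.finite_vars]
  refine Form.wf_exs (nodup_listOf _) (fun _ _ => id) ?_
  rw [e]
  exact ⟨wf_conjForm subset_rfl, h⟩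

/-- Restricting quantifiers to the constants of the list loses nothing: by safety every variable of
the body occurs in a predicate atom, so its value is an argument of a fact. Elsewhere the
substitution may be reset to `s₀`, since `Q` depends only on the variables of the body. -/
theorem sat_bodyForm {b : Base} {t : Dependency S} {φ : Form S} {I : Base → Set (Fact S)}
    {A : Set Const} {s₀ : Subst} {Q : Subst → Prop} (hA : ∀ f ∈ I b, ∀ c ∈ f.argList, c ∈ A)
    (hφ : ∀ s, φ.Sat I A s ↔ Q s)
    (hQ : ∀ s s', (∀ x ∈ t.body.vars, s x = s' x) → Q s → Q s') :
    (bodyForm b t φ).Sat I A s₀ ↔ ∃ s, t.body.IsInstantiation s (I b) ∧ Q s := by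
  classical
  simp only [bodyForm, Form.sat_exs, Form.Sat, sat_conjForm, hφ, mem_listOf t.body.finite_vars]
  constructor
  · rintro ⟨s, -, -, h⟩
    exact ⟨s, h⟩
  · rintro ⟨s, hs, hsQ⟩
    have hc : ∀ x ∈ t.body.vars, s x = (fun x => if x ∈ t.body.vars then s x else s₀ x) x :=
      fun x hx => by simp [hx]
    refine ⟨fun x => if x ∈ t.body.vars then s x else s₀ x, fun x hx => by simp [hx],
      fun x hx => ?_, Conj.isInstantiation_congr hc hs, hQ _ _ hc hsQ⟩
    rw [← hc x hx]
    rw [t.body_vars] at hx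
    obtain ⟨f, hf, hx⟩ := Conj.mem_argList_of_mem_atomVars hs hx
    exact hA f hf _ hx

/-- The disjunct `q` of the head of `t` holds for the facts marked by `b`. -/
noncomputable def headForm (b : Base) (t : Dependency S) (q : Conj S) : Form S :=
  .exs (listOf (q.vars \ t.body.vars)) (conjForm b q)

/-- By `head_safe`, an existential variable of the head occurs in a predicate atom of its disjunct,
so again only constants of the list can be witnesses. -/
theorem sat_headForm {b : Base} {t : Dependency S} {q : Conj S} (hq : q ∈ t.head)
    {I : Base → Set (Fact S)} {A : Set Const} {s : Subst}
    (hA : ∀ f ∈ I b, ∀ c ∈ f.argList, c ∈ A) :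
    (headForm b t q).Sat I A s ↔
      ∃ s', (∀ x ∈ t.body.vars, s' x = s x) ∧ q.IsInstantiation s' (I b) := by
  classical
  simp only [headForm, Form.sat_exs, sat_conjForm,
    mem_listOf (q.finite_vars.subset (Set.sdiff_subset (t := t.body.vars)))]
  constructor
  · rintro ⟨s', h1, -, h⟩
    exact ⟨s', fun x hx => h1 x fun h => h.2 hx, h⟩
  · rintro ⟨s', h1, h⟩
    have hc : ∀ x ∈ q.vars, s' x = (fun x => if x ∈ q.vars then s' x else s x) x :=
      fun x hx => by simp [hx]
    refine ⟨fun x => if x ∈ q.vars then s' x else s x, fun x hx => ?_, fun x hx => ?_,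
      Conj.isInstantiation_congr hc h⟩
    · by_cases hxq : x ∈ q.vars
      · simp only [hxq, if_true]
        exact h1 x (by_contra fun hn => hx ⟨hxq, hn⟩)
      · simp [hxq]
    · rw [← hc x hx.1]
      have hx' : x ∈ q.atomVars := by
        rcases hx.1 with h | h
        · exact h
        · exact (t.head_safe q hq h).resolve_right hx.2
      obtain ⟨f, hf, hx'⟩ := Conj.mem_argList_of_mem_atomVars h hx'
      exact hA f hf _ hx'

/-- Some dependency of the list has an instantiation of its body in the facts marked by `b` for
which the head does not hold in the facts marked by `b'`. -/
noncomputable def violForm (b b' : Base) (l : List (Dependency S)) : Form S :=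
  .any (l.map fun t => bodyForm b t (.neg (.any (t.head.map (headForm b' t)))))

theorem wf_violForm (b b' : Base) (l : List (Dependency S)) : (violForm b b' l).WF ∅ := by
  refine Form.wf_any fun φ hφ => ?_
  obtain ⟨t, -, rfl⟩ := List.mem_map.1 hφ
  refine wf_bodyForm (Form.wf_any fun ψ hψ => ?_)
  obtain ⟨q, -, rfl⟩ := List.mem_map.1 hψ
  have hfin := q.finite_vars.subset (Set.sdiff_subset (t := t.body.vars))
  refine Form.wf_exs (nodup_listOf _) (fun x hx => ((mem_listOf hfin).1 hx).2)
    (wf_conjForm fun x hx => ?_)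
  by_cases hxb : x ∈ t.body.vars
  · exact Or.inl hxb
  · exact Or.inr ((mem_listOf hfin).2 ⟨hx, hxb⟩)

/-- With equal marks the formula expresses inconsistency; with `cur` and `set` it says, for linear
dependencies, that the current fact has to be removed. -/
theorem holds_violForm {b b' : Base} {l : List (Dependency S)} {I : Base → Set (Fact S)}
    {A : Set Const} (hb : ∀ f ∈ I b, ∀ c ∈ f.argList, c ∈ A)
    (hb' : ∀ f ∈ I b', ∀ c ∈ f.argList, c ∈ A) :
    (violForm b b' l).Holds I A ↔
      ∃ t ∈ l, ∃ s, t.body.IsInstantiation s (I b) ∧ ¬ t.HeadHolds s (I b') := by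
  simp only [Form.Holds, violForm, Form.sat_any_map]
  refine exists_congr fun t => and_congr_right fun ht => ?_
  refine sat_bodyForm hb (fun s => ?_) fun s s' hs h h' => h (h'.congr fun x hx => (hs x hx).symm)
  simp only [Form.Sat, Form.sat_any_map, Dependency.HeadHolds]
  exact not_congr (exists_congr fun q => and_congr_right fun hq => sat_headForm hq hb')

/-- The current fact is derived in one step, by some dependency of the list, from the facts marked
by `set`. -/
noncomputable def derivForm (l : List (Dependency S)) : Form S :=
  .any (l.map fun t => bodyForm .set t (.any (t.head.map fun q => .any (q.atoms.map (.rel .cur)))))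

theorem wf_derivForm {l : List (Dependency S)} (hl : ∀ t ∈ l, t.IsFull) :
    (derivForm l).WF ∅ := by
  refine Form.wf_any fun φ hφ => ?_
  obtain ⟨t, ht, rfl⟩ := List.mem_map.1 hφ
  refine wf_bodyForm (Form.wf_any fun ψ hψ => ?_)
  obtain ⟨q, hq, rfl⟩ := List.mem_map.1 hψ
  refine Form.wf_any fun χ hχ => ?_
  obtain ⟨a, ha, rfl⟩ := List.mem_map.1 hχ
  exact (Conj.vars_of_mem_atoms ha).trans ((hl t ht).2 q hq)

theorem holds_derivForm {l : List (Dependency S)} (hl : ∀ t ∈ l, t.IsFull)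
    {I : Base → Set (Fact S)} {A : Set Const} (hb : ∀ f ∈ I .set, ∀ c ∈ f.argList, c ∈ A) :
    (derivForm l).Holds I A ↔ ∃ t ∈ l, ∃ s, t.body.IsInstantiation s (I .set) ∧
      ∃ q ∈ t.head, ∃ a ∈ q.atoms, a.inst s ∈ I .cur := by
  simp only [Form.Holds, derivForm, Form.sat_any_map]
  refine exists_congr fun t => and_congr_right fun ht => ?_
  refine sat_bodyForm hb (fun s => ?_) ?_
  · simp only [Form.sat_any_map, Form.Sat]
  · rintro s s' hs ⟨q, hq, a, ha, h⟩
    refine ⟨q, hq, a, ha, ?_⟩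
    rwa [← a.inst_congr fun x hx => hs x ((hl t ht).2 q hq (Conj.vars_of_mem_atoms ha hx))]

/-- The atom of a predicate whose arguments are pairwise distinct variables. -/
def genAtom (p : S.Pred) : Atom S := ⟨p, fun i => .var i⟩

/-- Some fact that is marked by `b` satisfies `φ`, where `φ` is given for atoms. -/
noncomputable def factForm (b : Base) (φ : Atom S → Form S) : Form S :=
  .any ((listOf (Set.univ : Set S.Pred)).map fun p =>
    .exs (List.range (S.arity p)) (.and (.rel b (genAtom p)) (φ (genAtom p))))

theorem wf_factForm {b : Base} {φ : Atom S → Form S}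
    (h : ∀ (a : Atom S) (X : Set Var), a.vars ⊆ X → (φ a).WF X) : (factForm b φ).WF ∅ := by
  refine Form.wf_any fun ψ hψ => ?_
  obtain ⟨p, -, rfl⟩ := List.mem_map.1 hψ
  have hX : (genAtom p).vars ⊆ ∅ ∪ {x | x ∈ List.range (S.arity p)} := by
    intro x hx
    obtain ⟨i, hi⟩ := Set.mem_iUnion.1 hx
    obtain rfl : x = i.val := hi
    exact Or.inr (List.mem_range.2 i.isLt)
  exact Form.wf_exs List.nodup_range (fun _ _ => id) ⟨hX, h _ _ hX⟩

/-- The signature is finite, so quantifying over facts is a finite disjunction over predicates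
followed by quantifiers over arguments. -/
theorem holds_factForm {b : Base} {φ : Atom S → Form S} {Q : Fact S → Prop}
    {I : Base → Set (Fact S)} {A : Set Const} (hb : ∀ f ∈ I b, ∀ c ∈ f.argList, c ∈ A)
    (h : ∀ a s, (φ a).Sat I A s ↔ Q (a.inst s)) :
    (factForm b φ).Holds I A ↔ ∃ f ∈ I b, Q f := by
  simp only [Form.Holds, factForm, Form.sat_any_map, Form.sat_exs, Form.Sat, h,
    mem_listOf Set.finite_univ, Set.mem_univ, true_and]
  constructor
  · rintro ⟨p, s, -, -, h1, h2⟩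
    exact ⟨_, h1, h2⟩
  · rintro ⟨f, hf, hQ⟩
    have hi : (genAtom f.pred).inst (fun x => if h : x < S.arity f.pred then f.args ⟨x, h⟩ else []) =
        f := by
      simp [genAtom, Atom.inst, Term.eval]
    refine ⟨f.pred, fun x => if h : x < S.arity f.pred then f.args ⟨x, h⟩ else [],
      fun x hx => ?_, fun x hx => ?_, ?_, ?_⟩
    · simp only [List.mem_range] at hx
      simp [hx]
    · simp only [List.mem_range] at hx
      refine hb f hf _ ?_
      simp [hx, Fact.argList]
    · rwa [hi]
    · rwa [hi]

/-- Some fact is marked by `b` and by `b'`. -/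
noncomputable def meetForm (S : Signature) (b b' : Base) : Form S := factForm b fun a => .rel b' a

/-- Some fact is marked by `b`, but not by `b'`. -/
noncomputable def diffForm (S : Signature) (b b' : Base) : Form S :=
  factForm b fun a => .neg (.rel b' a)

theorem wf_meetForm (b b' : Base) : (meetForm S b b').WF ∅ := wf_factForm fun _ _ h => h

theorem wf_diffForm (b b' : Base) : (diffForm S b b').WF ∅ := wf_factForm fun _ _ h => h

theorem holds_meetForm {b b' : Base} {I : Base → Set (Fact S)} {A : Set Const}
    (hb : ∀ f ∈ I b, ∀ c ∈ f.argList, c ∈ A) :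
    (meetForm S b b').Holds I A ↔ ∃ f ∈ I b, f ∈ I b' :=
  holds_factForm hb fun _ _ => Iff.rfl

theorem holds_diffForm {b b' : Base} {I : Base → Set (Fact S)} {A : Set Const}
    (hb : ∀ f ∈ I b, ∀ c ∈ f.argList, c ∈ A) :
    (diffForm S b b').Holds I A ↔ ∃ f ∈ I b, f ∉ I b' :=
  holds_factForm hb fun _ _ => Iff.rfl

end FactTape

namespace FactTape

open CQA StackProg Polynomial

variable {S : Signature} {V C : ℕ} {Out : Type}

/-! ### The algorithms -/

theorem exists_runs_comp (hC : ∀ p, S.arity p + 2 ≤ C) (φ : Form S) (hφ : φ.WF ∅)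
    (hV : φ.maxVar ≤ V) : ∃ P : ℕ[X], ∀ (fs : List (Fact S)) (μ : ℕ → Mark V → Bool) (b : Bool),
      Clean μ → Runs (comp (C := C) (Out := Out) φ fun _ => 0) fs (μ, b)
        (μ, truth (φ.Holds (factsOf fs μ) (adom fs))) (P.eval (size fs)) := by
  obtain ⟨P, hP⟩ := decides_comp (Out := Out) hC φ (fun _ => 0) ∅ hφ hV (by simp)
  exact ⟨P, fun fs μ b hμ => hP (fun _ => []) fs μ b (hμ.env _ _ _)⟩

/-- Sets the mark `set` of every fact. -/
def setMarks (h : (Mark V → Bool) → Bool) : Prg S V C Out :=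
  mapMarks fun _ m => Function.update m (.base .set) (h m)

theorem runs_setMarks (h : (Mark V → Bool) → Bool) (fs : List (Fact S)) (a : AState V) :
    Runs (setMarks (C := C) (Out := Out) h) fs a
      (fun j => Function.update (a.1 j) (.base .set) (h (a.1 j)), a.2) (size fs * 4 + 2) :=
  runs_mapMarks _ fs a

theorem Clean.congr {μ μ' : ℕ → Mark V → Bool} (h : Clean μ)
    (he : ∀ j k, k ≠ .base .set → k ≠ .base .pick → μ' j k = μ j k) : Clean μ' :=
  ⟨fun j => by rw [he j _ (by simp) (by simp), h.cur],
    fun j => by rw [he j _ (by simp) (by simp), h.new],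
    fun j => by rw [he j _ (by simp) (by simp), h.rel],
    fun j x => by rw [he j _ (by simp) (by simp), h.var]⟩

theorem factsOf_congr {fs : List (Fact S)} {μ μ' : ℕ → Mark V → Bool} {b : Base}
    (h : ∀ j, μ j (.base b) = μ' j (.base b)) : factsOf fs μ b = factsOf fs μ' b := by
  simp [factsOf, h]

theorem mem_adom_of_mem {fs : List (Fact S)} {f : Fact S} (hf : f ∈ fs) :
    ∀ c ∈ f.argList, c ∈ adom fs := fun _ hc => ⟨f, hf, hc⟩

theorem mem_of_mem_factsOf {fs : List (Fact S)} {μ : ℕ → Mark V → Bool} {b : Base} {f : Fact S}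
    (hf : f ∈ factsOf fs μ b) : f ∈ fs := by
  obtain ⟨i, hi, -⟩ := hf
  exact List.mem_of_getElem? hi

theorem adom_factsOf (fs : List (Fact S)) (μ : ℕ → Mark V → Bool) (b : Base) :
    ∀ f ∈ factsOf fs μ b, ∀ c ∈ f.argList, c ∈ adom fs :=
  fun _ hf => mem_adom_of_mem (mem_of_mem_factsOf hf)

/-! ### The marks after the rounds represent the sets of the two iterations -/

section Sets

variable {T : Set (Dependency S)} {l : List (Dependency S)}

theorem holds_violForm_iff (hl : ∀ t, t ∈ l ↔ t ∈ T) (fs : List (Fact S))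
    (μ : ℕ → Mark V → Bool) (b : Base) :
    (violForm b b l).Holds (factsOf fs μ) (adom fs) ↔ ¬ Consistent T (factsOf fs μ b) := by
  rw [holds_violForm (adom_factsOf fs μ b) (adom_factsOf fs μ b), consistent_iff, not_not]
  simp only [hl]

theorem holdsAt_violForm (hl : ∀ t, t ∈ l ↔ t ∈ T) (fs : List (Fact S))
    (μ : ℕ → Mark V → Bool) (j : ℕ) : HoldsAt (violForm .cur .set l) fs μ j ↔
      ∃ f, fs[j]? = some f ∧ Violates T (factsOf fs μ .set) f := by
  refine exists_congr fun f => and_congr_right fun hf => ?_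
  have hset : interp fs μ f .set = factsOf fs μ .set := by simp [interp]
  have hcur : interp fs μ f .cur = {f} := by simp [interp]
  rw [holds_violForm, hset, hcur]
  · simp only [hl, Violates]
  · rw [hcur]
    rintro g rfl
    exact mem_adom_of_mem (List.mem_of_getElem? hf)
  · rw [hset]
    exact adom_factsOf fs μ _

theorem holdsAt_derivForm (hl : ∀ t, t ∈ l ↔ t ∈ T) (hT : ∀ t ∈ T, t.IsFull) (fs : List (Fact S))
    (μ : ℕ → Mark V → Bool) (j : ℕ) : HoldsAt (derivForm l) fs μ j ↔
      ∃ f, fs[j]? = some f ∧ Derives T (factsOf fs μ .set) f := by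
  refine exists_congr fun f => and_congr_right fun hf => ?_
  have hset : interp fs μ f .set = factsOf fs μ .set := by simp [interp]
  have hcur : interp fs μ f .cur = {f} := by simp [interp]
  rw [holds_derivForm fun t ht => hT t ((hl t).1 ht), hset, hcur]
  · simp only [hl, Derives, Set.mem_singleton_iff]
  · rw [hset]
    exact adom_factsOf fs μ _

/-- The mark `set` is carried by the facts of `E` that carry the mark `db`. -/
structure Represents (fs : List (Fact S)) (μ : ℕ → Mark V → Bool) (E : Set (Fact S)) : Prop where
  subset : E ⊆ factsOf fs μ .db
  iff : ∀ j f, fs[j]? = some f → (μ j (.base .set) = true ↔ μ j (.base .db) = true ∧ f ∈ E)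

theorem Represents.factsOf {fs : List (Fact S)} {μ : ℕ → Mark V → Bool} {E : Set (Fact S)}
    (h : Represents fs μ E) : factsOf fs μ .set = E := by
  ext f
  constructor
  · rintro ⟨j, hj, hs⟩
    exact ((h.iff j f hj).1 hs).2
  · intro hf
    obtain ⟨j, hj, hd⟩ := h.subset hf
    exact ⟨j, hj, (h.iff j f hj).2 ⟨hd, hf⟩⟩

/-- The verdict on a position depends only on the fact there, so all occurrences marked `db` lose
the mark `set` together. -/
theorem Represents.stepMarks (hl : ∀ t, t ∈ l ↔ t ∈ T) {fs : List (Fact S)}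
    {μ : ℕ → Mark V → Bool} {E : Set (Fact S)} (h : Represents fs μ E) :
    Represents fs (stepMarks (violForm .cur .set l) (fun a w => a && !w) fs μ)
      (removeViolations T E) := by
  refine ⟨?_, fun j f hf => ?_⟩
  · rw [factsOf_stepMarks_of_ne (by simp)]
    exact (removeViolations_subset E).trans h.subset
  · have e : HoldsAt (violForm .cur .set l) fs μ j ↔ Violates T E f := by
      rw [holdsAt_violForm hl, h.factsOf]
      simp [hf]
    simp [FactTape.stepMarks, truth_congr e, h.iff j f hf, removeViolations, and_assoc]

theorem Represents.iterate (hl : ∀ t, t ∈ l ↔ t ∈ T) {fs : List (Fact S)}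
    {μ : ℕ → Mark V → Bool} {E : Set (Fact S)} (h : Represents fs μ E) (n : ℕ) :
    Represents fs ((FactTape.stepMarks (violForm .cur .set l) (fun a w => a && !w) fs)^[n] μ)
      ((removeViolations T)^[n] E) := by
  induction n with
  | zero => exact h
  | succ n ih =>
    rw [Function.iterate_succ_apply', Function.iterate_succ_apply']
    exact ih.stepMarks hl

theorem represents_setMarks (fs : List (Fact S)) (μ : ℕ → Mark V → Bool) :
    Represents fs (fun j => Function.update (μ j) (.base .set) (μ j (.base .db)))
      (factsOf fs μ .db) := by
  refine ⟨(factsOf_congr fun j => by simp).subset, fun j f hf => ?_⟩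
  simp only [Function.update_self, ne_eq, Mark.base.injEq, reduceCtorEq, not_false_eq_true,
    Function.update_of_ne, iff_self_and]
  exact fun hd => ⟨j, hf, hd⟩

/-- The closure is taken within all listed facts, including those of the second database. It is the
intended one once the latter is known to be contained in the first. -/
theorem factsOf_iterate_derivForm (hl : ∀ t, t ∈ l ↔ t ∈ T) (hT : ∀ t ∈ T, t.IsFull)
    (fs : List (Fact S)) (μ : ℕ → Mark V → Bool) (n : ℕ) :
    factsOf fs ((stepMarks (derivForm l) (fun a w => a || w) fs)^[n] μ) .set =
      (addDerived T {f | f ∈ fs})^[n] (factsOf fs μ .set) := by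
  induction n with
  | zero => rfl
  | succ n ih =>
    rw [Function.iterate_succ_apply', Function.iterate_succ_apply', ← ih]
    ext f
    simp only [factsOf, stepMarks, Function.update_self, Bool.or_eq_true, truth_eq_true,
      holdsAt_derivForm hl hT, Set.mem_ofPred_eq, addDerived, Set.mem_union]
    constructor
    · rintro ⟨j, hj, h | ⟨f', hf', h⟩⟩
      · exact Or.inl ⟨j, hj, h⟩
      · rw [hj] at hf'
        cases hf'
        exact Or.inr ⟨List.mem_of_getElem? hj, h⟩
    · rintro (⟨j, hj, h⟩ | ⟨hf, h⟩)
      · exact ⟨j, hj, Or.inl h⟩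
      · obtain ⟨j, hj⟩ := List.mem_iff_getElem?.1 hf
        exact ⟨j, hj, Or.inr ⟨f, hj, h⟩⟩

theorem finite_facts (D : Database S) : D.facts.Finite := List.finite_toSet D.list

/-- Lists may contain repetitions, but the number of rounds, given by the length, is still large
enough. -/
theorem ncard_facts_le (D : Database S) : D.facts.ncard ≤ D.list.length := by
  classical
  have : D.facts = (D.list.toFinset : Set (Fact S)) := by
    ext f
    simp [Database.facts]
  rw [this, Set.ncard_coe_finset]
  exact List.toFinset_card_le _

theorem clean_initMarks (s : ℕ → Bool) : Clean fun i => initMarks V (s i) := by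
  constructor <;> intro j <;> cases s j <;> simp [initMarks]

theorem factsOf_pairMarks_db (D D' : Database S) :
    factsOf (D.list ++ D'.list) (pairMarks V D.list.length) .db = D.facts := by
  ext f
  have h : ∀ i, pairMarks V D.list.length i (.base .db) = true ↔ i < D.list.length := by
    intro i
    by_cases hi : D.list.length ≤ i
    · simp [pairMarks, initMarks, hi]
    · simp [pairMarks, initMarks, hi, not_le.1 hi]
  simp only [factsOf, h, Set.mem_ofPred_eq, Database.facts, List.mem_iff_getElem?]
  constructor
  · rintro ⟨i, hf, hi⟩
    rw [List.getElem?_append_left hi] at hf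
    exact ⟨i, hf⟩
  · rintro ⟨i, hf⟩
    have hi := (List.getElem?_eq_some_iff.1 hf).1
    exact ⟨i, by rwa [List.getElem?_append_left hi], hi⟩

theorem factsOf_pairMarks_sub (D D' : Database S) :
    factsOf (D.list ++ D'.list) (pairMarks V D.list.length) .sub = D'.facts := by
  ext f
  have h : ∀ i, pairMarks V D.list.length i (.base .sub) = true ↔ D.list.length ≤ i := by
    intro i
    by_cases hi : D.list.length ≤ i <;> simp [pairMarks, initMarks, hi]
  simp only [factsOf, h, Set.mem_ofPred_eq, Database.facts, List.mem_iff_getElem?]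
  constructor
  · rintro ⟨i, hf, hi⟩
    rw [List.getElem?_append_right hi] at hf
    exact ⟨_, hf⟩
  · rintro ⟨i, hf⟩
    refine ⟨D.list.length + i, ?_, Nat.le_add_right _ _⟩
    rw [List.getElem?_append_right (Nat.le_add_right _ _), Nat.add_sub_cancel_left]
    exact hf

theorem pairMarks_of_ne {n i : ℕ} {k : Mark V} (h : k ≠ .base .db) (h' : k ≠ .base .sub) :
    pairMarks V n i k = false := by
  unfold pairMarks initMarks
  split_ifs <;> simp [h, h']

theorem setOf_mem_append {D D' : Database S} (h : D'.facts ⊆ D.facts) :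
    {f | f ∈ D.list ++ D'.list} = D.facts := by
  ext f
  simp only [List.mem_append, Set.mem_ofPred_eq, Database.facts, or_iff_left_iff_imp]
  exact fun hf => h hf

end Sets

/-! ### The polynomial-time programs and their correctness -/

section Programs

variable {T : Set (Dependency S)} {l : List (Dependency S)}

/-- Computes the repair for linear dependencies; its facts carry the mark `set` in the end. -/
noncomputable def linearProg (l : List (Dependency S)) : Prg S V C Out :=
  .seq (setMarks fun m => m (.base .db)) (iterProg (violForm .cur .set l) fun a w => a && !w)

theorem exists_runs_linearProg (hC : ∀ p, S.arity p + 2 ≤ C) (hl : ∀ t, t ∈ l ↔ t ∈ T)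
    (hV : (violForm .cur .set l).maxVar ≤ V) :
    ∃ P : ℕ[X], ∀ (fs : List (Fact S)) (μ : ℕ → Mark V → Bool) (b : Bool), Clean μ →
      (∀ j, μ j .round = false) → ∃ μ', (∀ j k, k ≠ .base .set → μ' j k = μ j k) ∧
        Represents fs μ' ((removeViolations T)^[fs.length] (factsOf fs μ .db)) ∧
        Runs (linearProg (C := C) (Out := Out) l) fs (μ, b) (μ', false) (P.eval (size fs)) := by
  obtain ⟨P, hP⟩ := exists_runs_iterProg (Out := Out) hC (violForm .cur .set l)
    (wf_violForm _ _ _) hV (fun a w => a && !w)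
  refine ⟨P + 4 * X + 2, fun fs μ b hμ hr => ⟨_, fun j k hk => ?_,
    (represents_setMarks fs μ).iterate hl fs.length,
    ((runs_setMarks _ fs (μ, b)).seq (hP fs _ b (hμ.congr fun j k hk _ => ?_) fun j => ?_)).mono ?_⟩⟩
  · rw [iterate_stepMarks_of_ne _ _ hk, Function.update_of_ne hk]
  · simp [hk]
  · simp [hr]
  · simp
    omega

/-- Decides whether the closure of the facts marked by `sub` or `pick` is inconsistent. -/
noncomputable def chaseProg (l : List (Dependency S)) : Prg S V C Out :=
  .seq (setMarks fun m => m (.base .sub) || m (.base .pick)) <|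
  .seq (iterProg (derivForm l) fun a w => a || w) (comp (violForm .set .set l) fun _ => 0)

/-- Only `set` is overwritten, so the program can be run again for another choice of `pick`. -/
theorem exists_runs_chaseProg (hC : ∀ p, S.arity p + 2 ≤ C) (hl : ∀ t, t ∈ l ↔ t ∈ T)
    (hT : ∀ t ∈ T, t.IsFull) (hV : (derivForm l).maxVar ≤ V)
    (hV' : (violForm .set .set l).maxVar ≤ V) :
    ∃ P : ℕ[X], ∀ (fs : List (Fact S)) (μ : ℕ → Mark V → Bool) (b : Bool), Clean μ →
      (∀ j, μ j .round = false) → ∃ μ', (∀ j k, k ≠ .base .set → μ' j k = μ j k) ∧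
        Runs (chaseProg (C := C) (Out := Out) l) fs (μ, b)
          (μ', truth (¬ Consistent T ((addDerived T {f | f ∈ fs})^[fs.length]
            (factsOf fs μ .sub ∪ factsOf fs μ .pick)))) (P.eval (size fs)) := by
  obtain ⟨P, hP⟩ := exists_runs_iterProg (Out := Out) hC (derivForm l)
    (wf_derivForm fun t ht => hT t ((hl t).1 ht)) hV (fun a w => a || w)
  obtain ⟨P', hP'⟩ := exists_runs_comp (Out := Out) hC (violForm .set .set l) (wf_violForm _ _ _) hV'
  refine ⟨P + P' + 4 * X + 2, fun fs μ b hμ hr => ?_⟩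
  have hc : Clean fun j => Function.update (μ j) (.base .set)
      (μ j (.base .sub) || μ j (.base .pick)) := hμ.congr fun j k hk _ => by simp [hk]
  have h1 := hP fs _ b hc fun j => by simp [hr]
  have h2 := hP' fs _ false (hc.iterate (φ := derivForm l) (g := fun a w => a || w) (fs := fs)
    fs.length)
  have e : factsOf fs (fun j => Function.update (μ j) (.base .set)
      (μ j (.base .sub) || μ j (.base .pick))) .set = factsOf fs μ .sub ∪ factsOf fs μ .pick := by
    ext f
    simp only [factsOf, Function.update_self, Bool.or_eq_true, Set.mem_ofPred_eq, Set.mem_union,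
      and_or_left, exists_or]
  rw [truth_congr (holds_violForm_iff hl _ _ _), factsOf_iterate_derivForm hl hT, e] at h2
  refine ⟨_, fun j k hk => ?_, ((runs_setMarks _ fs (μ, b)).seq (h1.seq h2)).mono ?_⟩
  · rw [iterate_stepMarks_of_ne _ _ hk, Function.update_of_ne hk]
  · simp
    omega

/-- Repair checking for linear dependencies. -/
noncomputable def linearCheckProg (l : List (Dependency S)) : Prg S V C Bool :=
  .seq (linearProg l) <|
  .seq (comp (.any [diffForm S .set .sub, diffForm S .sub .set]) fun _ => 0) notFlag

/-- The unique repair is computed in the mark `set` and compared with the second database by testing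
both differences for emptiness. -/
theorem repairCheckingInPTIME_of_linear (hT : T.Finite) (hlin : ∀ t ∈ T, t.IsLinear) :
    RepairCheckingInPTIME T := by
  obtain ⟨C, hC⟩ := (Set.finite_range S.arity).bddAbove
  -- The argument counter starts at `i + 2` for argument number `i`, hence the two extra values.
  have hC' : ∀ p, S.arity p + 2 ≤ C + 2 := fun p => Nat.add_le_add_right (hC ⟨p, rfl⟩) 2
  have hl : ∀ t, t ∈ listOf T ↔ t ∈ T := fun t => mem_listOf hT
  let φ : Form S := .any [diffForm S .set .sub, diffForm S .sub .set]
  -- The sum bounds the variables of all formulas involved, so that distinct variables get distinct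
  -- marks.
  obtain ⟨V, hV⟩ : ∃ V, V = (violForm .cur .set (listOf T)).maxVar + φ.maxVar := ⟨_, rfl⟩
  obtain ⟨P, hP⟩ := exists_runs_linearProg (V := V) (Out := Bool) hC' hl (by omega)
  obtain ⟨P', hP'⟩ := exists_runs_comp (V := V) (Out := Bool) hC' φ
    (Form.wf_any (by simp [wf_diffForm])) (by omega)
  refine inPTIME_of_runs (V := V) (C := C + 2) (linearCheckProg (listOf T))
    ⟨P + P' + 1, fun D D' => ?_⟩
  have hclean : Clean (pairMarks V D.list.length) := clean_initMarks _
  obtain ⟨μ, hμ, hrep, hrun⟩ := hP (D.list ++ D'.list) (pairMarks V D.list.length) false hclean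
    fun j => pairMarks_of_ne (by simp) (by simp)
  have h2 := hP' (D.list ++ D'.list) μ false (hclean.congr fun j k hk _ => hμ j k hk)
  have e : φ.Holds (factsOf (D.list ++ D'.list) μ) (adom (D.list ++ D'.list)) ↔
      ¬ IsRepair T D.facts D'.facts := by
    have h3 : φ.Holds (factsOf (D.list ++ D'.list) μ) (adom (D.list ++ D'.list)) ↔
        (∃ f ∈ factsOf (D.list ++ D'.list) μ .set, f ∉ factsOf (D.list ++ D'.list) μ .sub) ∨
        ∃ f ∈ factsOf (D.list ++ D'.list) μ .sub, f ∉ factsOf (D.list ++ D'.list) μ .set := by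
      rw [← holds_diffForm (adom_factsOf _ _ _), ← holds_diffForm (adom_factsOf _ _ _)]
      simp [φ, Form.Holds, Form.sat_any]
    rw [h3, hrep.factsOf, factsOf_pairMarks_db,
      factsOf_congr fun j => hμ j (.base .sub) (by simp), factsOf_pairMarks_sub,
      isRepair_iff_iterate_removeViolations hlin (finite_facts D)
        ((ncard_facts_le D).trans (by simp : D.list.length ≤ (D.list ++ D'.list).length)),
      ← Set.not_subset, ← Set.not_subset, ← not_and_or, Set.Subset.antisymm_iff, and_comm]
  rw [truth_congr e] at h2
  have h3 := hrun.seq (h2.seq (runs_notFlag _ _))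
  simp only [not_truth, not_not] at h3
  exact ⟨μ, h3.mono (by simp; omega)⟩

/-- Deciding weak consistency for full dependencies. -/
noncomputable def weakProg (l : List (Dependency S)) : Prg S V C Bool :=
  .seq (comp (diffForm S .sub .db) fun _ => 0) <|
    ifFlag (setFlag false) (.seq (chaseProg l) notFlag)

/-- Inclusion is tested first: it is necessary for weak consistency, and it makes the closure within
the whole list a closure within the first database. -/
theorem weakConsistencyInPTIME_of_full (hT : T.Finite) (hfull : ∀ t ∈ T, t.IsFull) :
    WeakConsistencyInPTIME T := by
  obtain ⟨C, hC⟩ := (Set.finite_range S.arity).bddAbove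
  have hC' : ∀ p, S.arity p + 2 ≤ C + 2 := fun p => Nat.add_le_add_right (hC ⟨p, rfl⟩) 2
  have hl : ∀ t, t ∈ listOf T ↔ t ∈ T := fun t => mem_listOf hT
  obtain ⟨V, hV⟩ : ∃ V, V = (derivForm (listOf T)).maxVar +
    (violForm .set .set (listOf T)).maxVar + (diffForm S .sub .db).maxVar := ⟨_, rfl⟩
  obtain ⟨P, hP⟩ := exists_runs_chaseProg (V := V) (Out := Bool) hC' hl hfull (by omega) (by omega)
  obtain ⟨P', hP'⟩ := exists_runs_comp (V := V) (Out := Bool) hC' (diffForm S .sub .db)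
    (wf_diffForm _ _) (by omega)
  refine inPTIME_of_runs (V := V) (C := C + 2) (weakProg (listOf T)) ⟨P + P' + 2, fun D D' => ?_⟩
  have hclean : Clean (pairMarks V D.list.length) := clean_initMarks _
  have h1 := hP' (D.list ++ D'.list) _ false hclean
  have e : (diffForm S .sub .db).Holds (factsOf (D.list ++ D'.list) (pairMarks V D.list.length))
      (adom (D.list ++ D'.list)) ↔ ¬ D'.facts ⊆ D.facts := by
    rw [holds_diffForm (adom_factsOf _ _ _), factsOf_pairMarks_sub, factsOf_pairMarks_db,
      Set.not_subset]
  rw [truth_congr e] at h1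
  by_cases hsub : D'.facts ⊆ D.facts
  · obtain ⟨μ, -, h2⟩ := hP (D.list ++ D'.list) (pairMarks V D.list.length)
      (truth (¬ D'.facts ⊆ D.facts)) hclean fun j => pairMarks_of_ne (by simp) (by simp)
    have hpick : factsOf (D.list ++ D'.list) (pairMarks V D.list.length) .pick = ∅ := by
      ext f
      simp [factsOf, pairMarks_of_ne]
    rw [factsOf_pairMarks_sub, hpick, Set.union_empty, setOf_mem_append hsub,
      ← truth_congr (not_congr (weaklyConsistent_iff_consistent_iterate hfull (finite_facts D) hsub
        ((ncard_facts_le D).trans (by simp : D.list.length ≤ (D.list ++ D'.list).length))))] at h2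
    have h3 := h1.seq (Runs.if_false (p := setFlag false) (by simpa using hsub)
      (h2.seq (runs_notFlag _ _)))
    simp only [not_truth, not_not] at h3
    exact ⟨μ, h3.mono (by simp; omega)⟩
  · have hn : ¬ WeaklyConsistent T D.facts D'.facts := by
      rintro ⟨E, h, h', -⟩
      exact hsub (h.trans h')
    have h3 := h1.seq (Runs.if_true (q := .seq (chaseProg (listOf T)) notFlag)
      (by simpa using hsub) (runs_setFlag false _ _))
    refine ⟨pairMarks V D.list.length, ?_⟩
    rw [truth_eq_false.2 hn]
    exact h3.mono (by simp)

/-- The test for a single fact in repair checking for full dependencies. -/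
noncomputable def pickProg (l : List (Dependency S)) : Prg S V C Bool :=
  .seq (comp (meetForm S .pick .sub) fun _ => 0) <|
    ifFlag skip (.seq (chaseProg l) (setMarks fun _ => false))

/-- The facts marked `sub` or `pick` form `insert f D'.facts`, and their truncated chase is tested.
-/
theorem exists_runs_pickProg (hC : ∀ p, S.arity p + 2 ≤ C) (hl : ∀ t, t ∈ l ↔ t ∈ T)
    (hT : ∀ t ∈ T, t.IsFull) (hV : (derivForm l).maxVar ≤ V)
    (hV' : (violForm .set .set l).maxVar ≤ V) (hV'' : (meetForm S .pick .sub).maxVar ≤ V) :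
    ∃ P : ℕ[X], ∀ (D D' : Database S), D'.facts ⊆ D.facts → ∀ i f,
      (D.list ++ D'.list)[i]? = some f → ∀ b,
      Runs (pickProg (C := C) l) (D.list ++ D'.list)
        (put (.base .pick) i (pairMarks V D.list.length), b)
        (put (.base .pick) i (pairMarks V D.list.length),
          truth (f ∈ D'.facts ∨ ¬ WeaklyConsistent T D.facts (insert f D'.facts)))
        (P.eval (size (D.list ++ D'.list))) := by
  obtain ⟨P, hP⟩ := exists_runs_chaseProg (Out := Bool) hC hl hT hV hV'
  obtain ⟨P', hP'⟩ := exists_runs_comp (Out := Bool) hC (meetForm S .pick .sub) (wf_meetForm _ _) hV''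
  refine ⟨P + P' + 4 * X + 4, fun D D' hsub i f hf b => ?_⟩
  have hclean : Clean (put (.base .pick) i (pairMarks V D.list.length)) :=
    (clean_initMarks _).congr (μ := pairMarks V D.list.length) fun j k _ hk => by simp [put, hk]
  have hfsub : factsOf (D.list ++ D'.list) (put (.base .pick) i (pairMarks V D.list.length)) .sub =
      D'.facts := by
    rw [← factsOf_pairMarks_sub (V := V) D D']
    exact factsOf_congr fun j => by simp [put]
  have hfpick : factsOf (D.list ++ D'.list) (put (.base .pick) i (pairMarks V D.list.length))
      .pick = {f} := by
    ext g
    simp only [factsOf, put, Function.update_self, decide_eq_true_eq, Set.mem_ofPred_eq,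
      Set.mem_singleton_iff]
    constructor
    · rintro ⟨j, hg, rfl⟩
      exact Option.some.inj (hg.symm.trans hf)
    · rintro rfl
      exact ⟨i, hf, rfl⟩
  have h1 := hP' (D.list ++ D'.list) _ b hclean
  have e : (meetForm S .pick .sub).Holds (factsOf (D.list ++ D'.list)
      (put (.base .pick) i (pairMarks V D.list.length))) (adom (D.list ++ D'.list)) ↔
      f ∈ D'.facts := by
    rw [holds_meetForm (adom_factsOf _ _ _), hfsub, hfpick]
    simp
  rw [truth_congr e] at h1
  by_cases hfD : f ∈ D'.facts
  · have h2 := h1.seq (Runs.if_true (q := .seq (chaseProg l) (setMarks fun _ => false))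
      (by simpa using hfD) (runs_skip _ _))
    have e' : truth (f ∈ D'.facts ∨ ¬ WeaklyConsistent T D.facts (insert f D'.facts)) =
        truth (f ∈ D'.facts) := truth_congr (by simp [hfD])
    rw [e']
    exact h2.mono (by simp; omega)
  · obtain ⟨μ, hμ, h2⟩ := hP (D.list ++ D'.list) _ (truth (f ∈ D'.facts)) hclean fun j => by
      simp [put, pairMarks_of_ne]
    have hins : insert f D'.facts ⊆ D.facts := by
      refine Set.insert_subset ?_ hsub
      have := List.mem_of_getElem? hf
      exact (setOf_mem_append hsub).subset this
    rw [hfsub, hfpick, Set.union_singleton, setOf_mem_append hsub,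
      ← truth_congr (not_congr (weaklyConsistent_iff_consistent_iterate hT (finite_facts D) hins
        ((ncard_facts_le D).trans (by simp : D.list.length ≤ (D.list ++ D'.list).length))))] at h2
    have h3 := h1.seq (Runs.if_false (p := skip) (by simpa using hfD)
      (h2.seq (runs_setMarks (fun _ => false) _ _)))
    have e' : truth (f ∈ D'.facts ∨ ¬ WeaklyConsistent T D.facts (insert f D'.facts)) =
        truth (¬ WeaklyConsistent T D.facts (insert f D'.facts)) := truth_congr (by simp [hfD])
    -- Clearing `set` restores the initial marking, in which it was unused, as the enclosing loop
    -- over the facts requires.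
    have e'' : (fun j => Function.update (μ j) (.base .set) false) =
        put (.base .pick) i (pairMarks V D.list.length) := by
      funext j k
      by_cases hk : k = .base .set
      · subst hk
        simp [put, pairMarks_of_ne]
      · rw [Function.update_of_ne hk, hμ j k hk]
    beta_reduce at h3
    rw [e''] at h3
    rw [e']
    exact h3.mono (by simp; omega)

/-- Repair checking for full dependencies. -/
noncomputable def fullCheckProg (l : List (Dependency S)) : Prg S V C Bool :=
  .seq (comp (.any [diffForm S .sub .db, violForm .sub .sub l]) fun _ => 0) <|
    ifFlag (setFlag false) <|
      .seq (setFlag true) <| forEach (.base .pick) (ifFlag (pickProg l) skip)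

/-- This is the criterion `isRepair_iff`: inclusion and consistency are checked by one formula, and
then `pick` runs through the facts while the flag records whether all facts so far passed. Facts
listed for the second database are tried too, but they pass trivially. -/
theorem repairCheckingInPTIME_of_full (hT : T.Finite) (hfull : ∀ t ∈ T, t.IsFull) :
    RepairCheckingInPTIME T := by
  obtain ⟨C, hC⟩ := (Set.finite_range S.arity).bddAbove
  have hC' : ∀ p, S.arity p + 2 ≤ C + 2 := fun p => Nat.add_le_add_right (hC ⟨p, rfl⟩) 2
  have hl : ∀ t, t ∈ listOf T ↔ t ∈ T := fun t => mem_listOf hT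
  let φ : Form S := .any [diffForm S .sub .db, violForm .sub .sub (listOf T)]
  obtain ⟨V, hV⟩ : ∃ V, V = (derivForm (listOf T)).maxVar +
    (violForm .set .set (listOf T)).maxVar + (meetForm S .pick .sub).maxVar + φ.maxVar := ⟨_, rfl⟩
  obtain ⟨P, hP⟩ := exists_runs_pickProg (V := V) hC' hl hfull (by omega) (by omega) (by omega)
  obtain ⟨P', hP'⟩ := exists_runs_comp (V := V) (Out := Bool) hC' φ
    (Form.wf_any (by simp [wf_diffForm, wf_violForm])) (by omega)
  refine inPTIME_of_runs (V := V) (C := C + 2) (fullCheckProg (listOf T))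
    ⟨X * (P + 2 + (X * 4 + 3) + 2) + (X * 4 + 3) + P' + 5, fun D D' => ?_⟩
  refine ⟨pairMarks V D.list.length, ?_⟩
  have hclean : Clean (pairMarks V D.list.length) := clean_initMarks _
  have h1 := hP' (D.list ++ D'.list) _ false hclean
  have e : φ.Holds (factsOf (D.list ++ D'.list) (pairMarks V D.list.length))
      (adom (D.list ++ D'.list)) ↔ ¬ (D'.facts ⊆ D.facts ∧ Consistent T D'.facts) := by
    have h3 : φ.Holds (factsOf (D.list ++ D'.list) (pairMarks V D.list.length))
        (adom (D.list ++ D'.list)) ↔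
        (diffForm S .sub .db).Holds (factsOf (D.list ++ D'.list) (pairMarks V D.list.length))
          (adom (D.list ++ D'.list)) ∨ (violForm .sub .sub (listOf T)).Holds
          (factsOf (D.list ++ D'.list) (pairMarks V D.list.length)) (adom (D.list ++ D'.list)) := by
      simp [φ, Form.Holds, Form.sat_any]
    rw [h3, holds_diffForm (adom_factsOf _ _ _), holds_violForm_iff hl, factsOf_pairMarks_sub,
      factsOf_pairMarks_db, ← Set.not_subset, not_and_or]
  rw [truth_congr e] at h1
  rw [truth_congr isRepair_iff]
  by_cases h0 : D'.facts ⊆ D.facts ∧ Consistent T D'.facts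
  · have h2 := runs_forEach (C := C + 2) (Out := Bool) (.base .pick)
      (ifFlag (pickProg (listOf T)) skip) (D.list ++ D'.list)
      (fun i => (pairMarks V D.list.length, truth (∀ j < i, ∀ f,
        (D.list ++ D'.list)[j]? = some f →
          f ∈ D'.facts ∨ ¬ WeaklyConsistent T D.facts (insert f D'.facts))))
      (P.eval (size (D.list ++ D'.list)) + 2)
      (fun i _ j => pairMarks_of_ne (by simp) (by simp)) (fun i hi => ?_)
    · have e1 : (∀ j < (D.list ++ D'.list).length, ∀ f, (D.list ++ D'.list)[j]? = some f →
          f ∈ D'.facts ∨ ¬ WeaklyConsistent T D.facts (insert f D'.facts)) ↔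
          D'.facts ⊆ D.facts ∧ Consistent T D'.facts ∧ ∀ f ∈ D.facts, f ∈ D'.facts ∨
            ¬ WeaklyConsistent T D.facts (insert f D'.facts) := by
        constructor
        · refine fun h => ⟨h0.1, h0.2, fun f hf => ?_⟩
          obtain ⟨j, hj⟩ := List.mem_iff_getElem?.1 ((setOf_mem_append h0.1).symm.subset hf)
          exact h j (List.getElem?_eq_some_iff.1 hj).1 f hj
        · exact fun h j _ f hf =>
            h.2.2 f ((setOf_mem_append h0.1).subset (List.mem_of_getElem? hf))
      have e2 : truth (∀ j < 0, ∀ f, (D.list ++ D'.list)[j]? = some f →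
          f ∈ D'.facts ∨ ¬ WeaklyConsistent T D.facts (insert f D'.facts)) = true :=
        truth_eq_true.2 (by simp)
      beta_reduce at h2
      rw [truth_congr e1, e2] at h2
      exact (h1.seq (Runs.if_false (p := setFlag false) (by simpa using h0)
        ((runs_setFlag true _ _).seq h2))).mono (by simp; omega)
    · obtain ⟨f, hf⟩ : ∃ f, (D.list ++ D'.list)[i]? = some f := ⟨_, List.getElem?_eq_getElem hi⟩
      by_cases hQ : ∀ j < i, ∀ f, (D.list ++ D'.list)[j]? = some f →
          f ∈ D'.facts ∨ ¬ WeaklyConsistent T D.facts (insert f D'.facts)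
      · have e1 : (∀ j < i + 1, ∀ f, (D.list ++ D'.list)[j]? = some f →
            f ∈ D'.facts ∨ ¬ WeaklyConsistent T D.facts (insert f D'.facts)) ↔
            (f ∈ D'.facts ∨ ¬ WeaklyConsistent T D.facts (insert f D'.facts)) := by
          constructor
          · exact fun h => h i (Nat.lt_succ_self i) f hf
          · intro h j hj g hg
            rcases Nat.lt_succ_iff_lt_or_eq.1 hj with hj | rfl
            · exact hQ j hj g hg
            · rw [hf] at hg
              cases hg
              exact h
        simp only [truth_congr e1]
        exact (Runs.if_true (truth_eq_true.2 hQ) (hP D D' h0.1 i f hf _)).mono (by omega)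
      · have hQ' : ¬ ∀ j < i + 1, ∀ f, (D.list ++ D'.list)[j]? = some f →
            f ∈ D'.facts ∨ ¬ WeaklyConsistent T D.facts (insert f D'.facts) :=
          fun h => hQ fun j hj => h j (hj.trans (Nat.lt_succ_self i))
        simp only [truth_eq_false.2 hQ, truth_eq_false.2 hQ']
        exact (Runs.if_false rfl (runs_skip _ _)).mono (by omega)
  · rw [truth_eq_false.2 fun h => h0 ⟨h.1, h.2.1⟩]
    exact (h1.seq (Runs.if_true (q := .seq (setFlag true) <| forEach (.base .pick)
      (ifFlag (pickProg (listOf T)) skip)) (by simpa using h0) (runs_setFlag false _ _))).mono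
      (by simp; omega)

/-- The repair of a database with linear dependencies. -/
noncomputable def linearRepair (T : Set (Dependency S)) (D : Database S) : Database S where
  list := D.list.filter fun f => truth (f ∈ (removeViolations T)^[D.list.length] D.facts)
  bot_not_mem h := D.bot_not_mem (List.mem_of_mem_filter h)

theorem facts_linearRepair (D : Database S) :
    (linearRepair T D).facts = (removeViolations T)^[D.list.length] D.facts := by
  ext f
  simp only [Database.facts, linearRepair, List.mem_filter, truth_eq_true, Set.mem_ofPred_eq,
    and_iff_right_iff_imp]
  exact fun h => iterate_removeViolations_subset _ _ h

/-- In a single database every fact carries `db`, so `set` ends up on exactly the occurrences of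
facts of the iterated set, and writing them out yields the filtered list. -/
theorem computableInPTIME_linearRepair (hT : T.Finite) :
    ComputableInPTIME encodeDatabase encodeDatabase (linearRepair T) := by
  obtain ⟨C, hC⟩ := (Set.finite_range S.arity).bddAbove
  have hC' : ∀ p, S.arity p + 2 ≤ C + 2 := fun p => Nat.add_le_add_right (hC ⟨p, rfl⟩) 2
  have hl : ∀ t, t ∈ listOf T ↔ t ∈ T := fun t => mem_listOf hT
  obtain ⟨V, hV⟩ : ∃ V, V = (violForm .cur .set (listOf T)).maxVar := ⟨_, rfl⟩
  obtain ⟨P, hP⟩ := exists_runs_linearProg (V := V) (Out := Letter S) hC' hl hV.ge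
  refine StackProg.computableInPTIME_of_within (Γ := Gam S V (Letter S)) (σ := Ctl S V (C + 2))
    (k₀ := Stack.inp) (k₁ := Stack.out)
    (.seq readProg (.seq (linearProg (listOf T)) writeProg) : Prg S V (C + 2) (Letter S)) {}
    (P + 8 * X + 5) fun D => ?_
  obtain ⟨μ, hμ, hrep, hrun⟩ := hP D.list (fun _ => initMarks _ false) false (clean_initMarks _)
    fun j => by simp [initMarks]
  have hdb : factsOf D.list (fun _ => initMarks V false) .db =
      D.facts := by
    ext f
    simp [factsOf, initMarks, Database.facts, List.mem_iff_getElem?]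
  rw [hdb] at hrep
  obtain ⟨v, hv⟩ := within_writeProg (C := C + 2)
    (fun f => truth (f ∈ (removeViolations T)^[D.list.length] D.facts)) D.list (μ, false)
    fun i f hf => by
      rw [Bool.eq_iff_iff, truth_eq_true, hrep.iff i f hf, hμ i _ (by simp)]
      simp [initMarks]
  refine ⟨v, ((within_readProg_single D).seq (Within.seq hrun hv)).mono ?_⟩
  have : size D.list = (encodeDatabase D).length := rfl
  simp only [eval_add, eval_mul, eval_ofNat, eval_X, this]
  omega

end Programs

end FactTape

/-! ### The theorem, assembled from the semantic and the algorithmic results -/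

theorem mainTheorem6 (S : CQA.Signature) (T : Set (CQA.Dependency S)) (hT : T.Finite) :
    -- repair checking
    (((∀ t ∈ T, t.IsLinear) ∨ (∀ t ∈ T, t.IsFull)) → CQA.RepairCheckingInPTIME T) ∧
    -- full dependencies: weak consistency and the chase
    ((∀ t ∈ T, t.IsFull) →
      (∀ D D' : CQA.Database S, D'.facts ⊆ D.facts →
        (CQA.WeaklyConsistent T D.facts D'.facts ↔
          {f | CQA.Chase T D'.facts f} ⊆ D.facts)) ∧
      CQA.WeakConsistencyInPTIME T) ∧
    -- linear dependencies: the unique repair, its computation, and exhaustive deletion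
    ((∀ t ∈ T, t.IsLinear) →
      (∃ rep : CQA.Database S → CQA.Database S,
        (∀ (D : CQA.Database S) (R : Set (CQA.Fact S)),
          CQA.IsRepair T D.facts R ↔ R = (rep D).facts) ∧
        CQA.ComputableInPTIME CQA.encodeDatabase CQA.encodeDatabase rep) ∧
      (∀ (D : CQA.Database S) (n : ℕ) (E : ℕ → Set (CQA.Fact S)), E 0 = D.facts →
        (∀ i < n, CQA.DeletionStep T (E i) (E (i + 1))) →
        n ≤ D.facts.ncard ∧
        ((¬ ∃ E', CQA.DeletionStep T (E n) E') →
          ∀ R : Set (CQA.Fact S), CQA.IsRepair T D.facts R ↔ R = E n))) := by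
  refine ⟨?_, fun hfull => ⟨fun D D' _ => ?_, ?_⟩,
    fun hlin => ⟨⟨FactTape.linearRepair T, ?_, ?_⟩, ?_⟩⟩
  · rintro (hlin | hfull)
    · exact FactTape.repairCheckingInPTIME_of_linear hT hlin
    · exact FactTape.repairCheckingInPTIME_of_full hT hfull
  · exact CQA.weaklyConsistent_iff_chase_subset hfull D.bot_not_mem
  · exact FactTape.weakConsistencyInPTIME_of_full hT hfull
  · intro D R
    rw [FactTape.facts_linearRepair]
    exact CQA.isRepair_iff_iterate_removeViolations hlin (FactTape.finite_facts D)
      (FactTape.ncard_facts_le D) R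
  · exact FactTape.computableInPTIME_linearRepair hT
  · exact fun D n E h0 h => CQA.deletion_sequence hlin (FactTape.finite_facts D) n E h0 h
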